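/- **Setting.** Let $\Omega_1,\dots,\Omega_d\subseteq\mathbb C$ be simply connected domains and $\Omega=\prod_{i=1}^d\Omega_i$. For each $i$ let $S_i\subseteq\partial\Omega_i$ be open in the relative topology of $\partial\Omega_i$, and suppose that $\mathbb C\setminus(\Omega_i\cup S_i)$ is connected and that it is either empty or unbounded. Put $S=\prod_{i=1}^d S_i$. For a multi-index $a\in\mathbb N^d$ write $D_a=\partial^{a_1+\dots+a_d}/\partial z_1^{a_1}\cdots\partial z_d^{a_d}$. Let $A^\infty(\Omega,S)$ be the space of all holomorphic $f:\Omega\to\mathbb C$ such that, for every $a\in\mathbb N^d$, $D_af$ extends continuously to $\prod_{i=1}^d(\Omega_i\cup S_i)$, with the topology of the seminorms $f\mapsto\sup_{z\in L}|D_af(z)|$, where $a\in\mathbb N^d$ and $L$ runs over the compact subsets of $\prod_{i=1}^d(\Omega_i\cup S_i)$. Let $X^\infty(\Omega,S)$ be the closure of the set of polynomials in $A^\infty(\Omega,S)$. For a compact set $K\subset\mathbb C^d$ let $O(K)$ be the set of functions holomorphic on some open set containing $K$, with the topology of the seminorms $h\mapsto\sup_{z\in K}|D_ah(z)|$, $a\in\mathbb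 N^d$. Fix $\zeta_0\in\Omega$, an enumeration $(N_j)_{j\ge0}$ of $\mathbb N^d$ (every multi-index occurring exactly once), and an infinite set $\mu\subseteq\mathbb N=\{0,1,2,\dots\}$. For $f$ holomorphic on $\Omega$ put $$S_n(f,\zeta_0)(z)=\sum_{j=0}^{n}a_{N_j}(f,\zeta_0)\,(z-\zeta_0)^{N_j},\qquad a_\alpha(f,\zeta_0)=\frac{D_\alpha f(\zeta_0)}{\alpha_1!\cdots\alpha_d!}.$$ Call $f\in A^\infty(\Omega,S)$ *universal* if for all compact sets $K_1,\dots,K_d\subset\mathbb C$ such that every $\mathbb C\setminus K_i$ is connected and $K=\prod_{i=1}^dK_i$ is disjoint from $\prod_{i=1}^d(\Omega_i\cup\overline{S_i})$, and for every $h\in O(K)$, there is a strictly increasing sequence $(\lambda_n)$ in $\mu$ such that, as $n\to\infty$, $S_{\lambda_n}(f,\zeta_0)\to h$ in the topology of $O(K)$ and $S_{\lambda_n}(f,\zeta_0)\to f$ in the topology of $A^\infty(\Omega,S)$. **Theorem 3.8.** There exists a universal $f\in A^\infty(\Omega,S)$. Furthermore, the set of universal $f\in X^\infty(\Omega,S)$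 is a dense $G_\delta$ subset of $X^\infty(\Omega,S)$, and there is a vector subspace of $X^\infty(\Omega,S)$ that is dense in $X^\infty(\Omega,S)$ and all of whose non-zero elements are universal. -/

import Mathlib

open Set Filter Topology TopologicalSpace

noncomputable section

namespace PartialTaylor

variable {d : ℕ}

/-! ### Mixed partial derivatives on `ℂ^d` -/

/-- The partial derivative `∂F/∂z_i`. -/
def partialDeriv (i : Fin d) (F : (Fin d → ℂ) → ℂ) : (Fin d → ℂ) → ℂ :=
  fun z => lineDeriv ℂ F z (Pi.single i 1)

/-- The mixed partial derivative
`D_a F = ∂^{a_1 + ⋯ + a_d} F / ∂z_1^{a_1} ⋯ ∂z_d^{a_d}`. -/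
def mixedPartial (a : Fin d → ℕ) (F : (Fin d → ℂ) → ℂ) : (Fin d → ℂ) → ℂ :=
  (List.finRange d).foldr (fun i G => (partialDeriv i)^[a i] G) F

section Aux

variable {U : Set (Fin d → ℂ)} {F G : (Fin d → ℂ) → ℂ}

theorem partialDeriv_analytic (hF : AnalyticOnNhd ℂ F U) (i : Fin d) :
    AnalyticOnNhd ℂ (partialDeriv i F) U := by
  intro z hz
  have h1 : AnalyticAt ℂ (fun w => fderiv ℂ F w (Pi.single i 1)) z :=
    (((ContinuousLinearMap.apply ℂ ℂ (Pi.single i (1 : ℂ) : Fin d → ℂ)).analyticAt _).comp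
      (hF z hz).fderiv)
  refine h1.congr ?_
  filter_upwards [(hF z hz).eventually_analyticAt] with w hw
  exact hw.differentiableAt.lineDeriv_eq_fderiv.symm

theorem partialDeriv_congr (hU : IsOpen U) (h : EqOn F G U) (i : Fin d) :
    EqOn (partialDeriv i F) (partialDeriv i G) U := by
  intro z hz
  exact (h.eventuallyEq_of_mem (hU.mem_nhds hz)).lineDeriv_eq

theorem partialDeriv_lin (hF : AnalyticOnNhd ℂ F U) (hG : AnalyticOnNhd ℂ G U) (c : ℂ)
    (i : Fin d) :
    EqOn (partialDeriv i (c • F + G)) (c • partialDeriv i F + partialDeriv i G) U := by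
  intro z hz
  have h1 := (hF z hz).differentiableAt
  have h2 := (hG z hz).differentiableAt
  simp only [partialDeriv, Pi.add_apply, Pi.smul_apply]
  rw [h1.lineDeriv_eq_fderiv, h2.lineDeriv_eq_fderiv,
    ((h1.const_smul c).add h2).lineDeriv_eq_fderiv, fderiv_add (h1.const_smul c) h2,
    fderiv_const_smul h1]
  rfl

theorem partialDeriv_iterate_aux (hU : IsOpen U) (i : Fin d) (k : ℕ) :
    (∀ F, AnalyticOnNhd ℂ F U → AnalyticOnNhd ℂ ((partialDeriv i)^[k] F) U) ∧
    (∀ F G, EqOn F G U → EqOn ((partialDeriv i)^[k] F) ((partialDeriv i)^[k] G) U) ∧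
    (∀ (c : ℂ) F G, AnalyticOnNhd ℂ F U → AnalyticOnNhd ℂ G U →
      EqOn ((partialDeriv i)^[k] (c • F + G))
        (c • (partialDeriv i)^[k] F + (partialDeriv i)^[k] G) U) := by
  induction k with
  | zero => exact ⟨fun _ h => h, fun _ _ h => h, fun _ _ _ _ _ _ _ => rfl⟩
  | succ k ih =>
    obtain ⟨h1, h2, h3⟩ := ih
    simp only [Function.iterate_succ']
    refine ⟨fun F hF => partialDeriv_analytic (h1 F hF) i,
      fun F G h => partialDeriv_congr hU (h2 F G h) i, fun c F G hF hG => ?_⟩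
    exact (partialDeriv_congr hU (h3 c F G hF hG) i).trans
      (partialDeriv_lin (h1 F hF) (h1 G hG) c i)

theorem mixedPartial_aux (hU : IsOpen U) (a : Fin d → ℕ) :
    (∀ F, AnalyticOnNhd ℂ F U → AnalyticOnNhd ℂ (mixedPartial a F) U) ∧
    (∀ F G, EqOn F G U → EqOn (mixedPartial a F) (mixedPartial a G) U) ∧
    (∀ (c : ℂ) F G, AnalyticOnNhd ℂ F U → AnalyticOnNhd ℂ G U →
      EqOn (mixedPartial a (c • F + G)) (c • mixedPartial a F + mixedPartial a G) U) := by
  unfold mixedPartial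
  induction List.finRange d with
  | nil => exact ⟨fun _ h => h, fun _ _ h => h, fun _ _ _ _ _ _ _ => rfl⟩
  | cons i l ih =>
    obtain ⟨h1, h2, h3⟩ := ih
    obtain ⟨k1, k2, k3⟩ := partialDeriv_iterate_aux hU i (a i)
    simp only [List.foldr_cons]
    refine ⟨fun F hF => k1 _ (h1 F hF), fun F G h => k2 _ _ (h2 F G h),
      fun c F G hF hG => ?_⟩
    exact (k2 _ _ (h3 c F G hF hG)).trans (k3 c _ _ (h1 F hF) (h1 G hG))

end Aux

/-! ### The space `A^∞(Ω, S)` -/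

/-- The product `Ω = Ω_1 × ⋯ × Ω_d`. -/
def prodDomain (Ω : Fin d → Opens ℂ) : Set (Fin d → ℂ) :=
  univ.pi fun i => (Ω i : Set ℂ)

/-- The product `(Ω_1 ∪ S_1) × ⋯ × (Ω_d ∪ S_d)`. -/
def partialClosure (Ω : Fin d → Opens ℂ) (S : Fin d → Set ℂ) : Set (Fin d → ℂ) :=
  univ.pi fun i => (Ω i : Set ℂ) ∪ S i

theorem isOpen_prodDomain (Ω : Fin d → Opens ℂ) : IsOpen (prodDomain Ω) :=
  isOpen_set_pi finite_univ fun i _ => (Ω i).isOpen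

/-- The extension by zero of a function on `Ω` to `ℂ^d`. As `Ω` is open, this affects neither
holomorphy nor the derivatives at points of `Ω`. -/
def zeroExt {Ω : Fin d → Opens ℂ} (f : prodDomain Ω → ℂ) : (Fin d → ℂ) → ℂ :=
  Function.extend Subtype.val f 0

theorem zeroExt_eq {Ω : Fin d → Opens ℂ} (f : prodDomain Ω → ℂ) (z : prodDomain Ω) :
    zeroExt f z = f z :=
  Subtype.val_injective.extend_apply f 0 z

theorem zeroExt_lin {Ω : Fin d → Opens ℂ} (c : ℂ) (f g : prodDomain Ω → ℂ) :
    EqOn (zeroExt (c • f + g)) (c • zeroExt f + zeroExt g) (prodDomain Ω) := by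
  intro z hz
  have := fun f : prodDomain Ω → ℂ => zeroExt_eq f ⟨z, hz⟩
  simp only at this
  simp [this]

/-- `f : Ω → ℂ` belongs to `A^∞(Ω, S)`: it is holomorphic on `Ω`, and every mixed partial
derivative of `f` extends continuously to `∏ (Ω_i ∪ S_i)`. -/
def MemAInfty (Ω : Fin d → Opens ℂ) (S : Fin d → Set ℂ) (f : prodDomain Ω → ℂ) : Prop :=
  AnalyticOnNhd ℂ (zeroExt f) (prodDomain Ω) ∧
    ∀ a : Fin d → ℕ, ∃ g : (Fin d → ℂ) → ℂ, ContinuousOn g (partialClosure Ω S) ∧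
      EqOn g (mixedPartial a (zeroExt f)) (prodDomain Ω)

theorem memAInfty_lin {Ω : Fin d → Opens ℂ} {S : Fin d → Set ℂ} (c : ℂ)
    {f g : prodDomain Ω → ℂ} (hf : MemAInfty Ω S f) (hg : MemAInfty Ω S g) :
    MemAInfty Ω S (c • f + g) := by
  have hU := isOpen_prodDomain Ω
  refine ⟨(hf.1.const_smul.add hg.1).congr hU (zeroExt_lin c f g).symm, fun a => ?_⟩
  obtain ⟨u, hu, hu'⟩ := hf.2 a
  obtain ⟨v, hv, hv'⟩ := hg.2 a
  obtain ⟨-, h2, h3⟩ := mixedPartial_aux hU a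
  refine ⟨c • u + v, (hu.const_smul c).add hv, fun z hz => ?_⟩
  rw [h2 _ _ (zeroExt_lin c f g) hz, h3 c _ _ hf.1 hg.1 hz]
  simp [hu' hz, hv' hz]

theorem memAInfty_of_entire (Ω : Fin d → Opens ℂ) (S : Fin d → Set ℂ)
    {F : (Fin d → ℂ) → ℂ} (hF : AnalyticOnNhd ℂ F univ) :
    MemAInfty Ω S (fun z => F z) := by
  have hU := isOpen_prodDomain Ω
  have he : EqOn F (zeroExt fun z : prodDomain Ω => F z) (prodDomain Ω) :=
    fun z hz => (zeroExt_eq (fun z : prodDomain Ω => F z) ⟨z, hz⟩).symm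
  refine ⟨(hF.mono (subset_univ _)).congr hU he, fun a => ⟨mixedPartial a F, ?_, ?_⟩⟩
  · exact (((mixedPartial_aux isOpen_univ a).1 F hF).continuousOn).mono (subset_univ _)
  · exact (mixedPartial_aux hU a).2.1 _ _ he

/-- `A^∞(Ω, S)` as a vector space of functions on `Ω`. -/
def aInftySubmodule (Ω : Fin d → Opens ℂ) (S : Fin d → Set ℂ) :
    Submodule ℂ (prodDomain Ω → ℂ) where
  carrier := {f | MemAInfty Ω S f}
  zero_mem' := memAInfty_of_entire Ω S (F := fun _ => 0) analyticOnNhd_const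
  add_mem' := fun {f g} hf hg => by simpa using memAInfty_lin 1 hf hg
  smul_mem' := fun c f hf => by
    have h0 : MemAInfty Ω S 0 := memAInfty_of_entire Ω S (F := fun _ => 0) analyticOnNhd_const
    simpa using memAInfty_lin c hf h0

/-- The space `A^∞(Ω, S)`, kept apart from the submodule above because its topology is not the
topology of pointwise convergence. -/
def AInfty (Ω : Fin d → Opens ℂ) (S : Fin d → Set ℂ) : Type :=
  aInftySubmodule Ω S

instance (Ω : Fin d → Opens ℂ) (S : Fin d → Set ℂ) : AddCommGroup (AInfty Ω S) :=
  inferInstanceAs (AddCommGroup (aInftySubmodule Ω S))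

instance (Ω : Fin d → Opens ℂ) (S : Fin d → Set ℂ) : Module ℂ (AInfty Ω S) :=
  inferInstanceAs (Module ℂ (aInftySubmodule Ω S))

/-- The underlying function `Ω → ℂ` of an element of `A^∞(Ω, S)`. -/
def AInfty.toFun {Ω : Fin d → Opens ℂ} {S : Fin d → Set ℂ} (f : AInfty Ω S) :
    prodDomain Ω → ℂ :=
  Subtype.val f

/-- The continuous extension of `D_a f` to `∏ (Ω_i ∪ S_i)`, given by its limits along `Ω`
(only its values on that product matter). -/
def AInfty.extPartial {Ω : Fin d → Opens ℂ} {S : Fin d → Set ℂ} (a : Fin d → ℕ)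
    (f : AInfty Ω S) : (Fin d → ℂ) → ℂ :=
  extendFrom (prodDomain Ω) (mixedPartial a (zeroExt f.toFun))

/-- The topology of `A^∞(Ω, S)`: uniform convergence of (the extension of) every mixed partial
derivative on every compact subset of `∏ (Ω_i ∪ S_i)`, that is, the topology of the seminorms
`f ↦ sup_{z ∈ L} |D_a f (z)|`. -/
instance (Ω : Fin d → Opens ℂ) (S : Fin d → Set ℂ) : TopologicalSpace (AInfty Ω S) :=
  ⨅ a : Fin d → ℕ, TopologicalSpace.induced
    (fun f : AInfty Ω S =>
      UniformOnFun.ofFun {L : Set (Fin d → ℂ) | IsCompact L ∧ L ⊆ partialClosure Ω S}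
        (f.extPartial a))
    inferInstance

/-- The restriction of a polynomial to `Ω`, as an element of `A^∞(Ω, S)`. -/
def AInfty.ofPoly (Ω : Fin d → Opens ℂ) (S : Fin d → Set ℂ) (p : MvPolynomial (Fin d) ℂ) :
    AInfty Ω S :=
  ⟨fun z => MvPolynomial.eval z.1 p,
    memAInfty_of_entire Ω S (F := fun z => MvPolynomial.eval z p)
      (AnalyticOnNhd.eval_mvPolynomial p)⟩

/-- `X^∞(Ω, S)`: the closure of the set of polynomials in `A^∞(Ω, S)`. -/
def XInfty (Ω : Fin d → Opens ℂ) (S : Fin d → Set ℂ) : Set (AInfty Ω S) :=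
  closure (range (AInfty.ofPoly Ω S))

/-! ### Taylor partial sums and universality -/

/-- The Taylor coefficient `a_α(f, ζ) = (α_1! ⋯ α_d!)⁻¹ D_α f(ζ)`. -/
def taylorCoeff {Ω : Fin d → Opens ℂ} (f : prodDomain Ω → ℂ) (ζ : prodDomain Ω)
    (α : Fin d → ℕ) : ℂ :=
  (∏ i, ((α i).factorial : ℂ))⁻¹ * mixedPartial α (zeroExt f) ζ

/-- The partial sum `S_n(f, ζ)(z) = ∑_{j=0}^{n} a_{N_j}(f, ζ) (z - ζ)^{N_j}`, a polynomial
in `z`, where `N` enumerates the multi-indices. -/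
def taylorSum {Ω : Fin d → Opens ℂ} (N : ℕ ≃ (Fin d → ℕ)) (f : prodDomain Ω → ℂ)
    (ζ : prodDomain Ω) (n : ℕ) : MvPolynomial (Fin d) ℂ :=
  ∑ j ∈ Finset.range (n + 1), MvPolynomial.C (taylorCoeff f ζ (N j)) *
    ∏ i, (MvPolynomial.X i - MvPolynomial.C (ζ.1 i)) ^ (N j i)

/-- `h ∈ O(K)`: the function `h` is holomorphic on an open set containing `K`. -/
def MemO (K : Set (Fin d → ℂ)) (h : (Fin d → ℂ) → ℂ) : Prop :=
  ∃ U : Set (Fin d → ℂ), IsOpen U ∧ K ⊆ U ∧ AnalyticOnNhd ℂ h U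

/-- Convergence in `O(K)`, i.e. for the seminorms `h ↦ sup_{z ∈ K} |D_a h (z)|`. -/
def TendstoO (K : Set (Fin d → ℂ)) (u : ℕ → (Fin d → ℂ) → ℂ) (h : (Fin d → ℂ) → ℂ) : Prop :=
  ∀ a : Fin d → ℕ,
    TendstoUniformlyOn (fun n => mixedPartial a (u n)) (mixedPartial a h) atTop K

/-- The universality property of `f ∈ A^∞(Ω, S)` with respect to the enumeration `N`, the
centre `ζ` and the set of indices `μ`. -/
def IsUniversal {Ω : Fin d → Opens ℂ} {S : Fin d → Set ℂ} (N : ℕ ≃ (Fin d → ℕ))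
    (ζ : prodDomain Ω) (μ : Set ℕ) (f : AInfty Ω S) : Prop :=
  ∀ K : Fin d → Set ℂ, (∀ i, IsCompact (K i)) → (∀ i, IsConnected (K i)ᶜ) →
    Disjoint (univ.pi K) (univ.pi fun i => (Ω i : Set ℂ) ∪ closure (S i)) →
    ∀ h : (Fin d → ℂ) → ℂ, MemO (univ.pi K) h →
      ∃ l : ℕ → ℕ, StrictMono l ∧ (∀ n, l n ∈ μ) ∧
        TendstoO (univ.pi K)
          (fun n z => MvPolynomial.eval z (taylorSum N f.toFun ζ (l n))) h ∧
        Tendsto (fun n => AInfty.ofPoly Ω S (taylorSum N f.toFun ζ (l n))) atTop (𝓝 f)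

end PartialTaylor

end

open PartialTaylor

/-!
The universal functions are found by the Baire category theorem, in the space of sequences
`ℕ → X^∞(Ω, S)`, which is completely metrizable because `A^∞(Ω, S)` is
(`AInfty.isCompletelyPseudoMetrizableSpace`).

Universality is a countable family of conditions. There are countably many admissible products `K`
that contain all others (`exists_countable_cofinal_admissible`), and by Runge's theorem on products
(`runge_pi`, `runge_pi_mixedPartial`) the targets `h` may be taken from a countable set of
polynomials. Each condition, "for some `n ∈ μ` with `n ≥ n₀` the Taylor sum `S_n(f)` is close to the
target on `K` and close to `f` in `A^∞(Ω, S)`", is open, since `S_n(f)` depends continuously on `f`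
(`isOpen_approxSet`).

It is dense because of simultaneous approximation (`exists_polynomial_mem_closeTo`). If `K` is
admissible, then some factor `K_i` is disjoint from `Ω_i ∪ closure S_i`. A compact subset of
`Ω_i ∪ S_i` may be enlarged within that set so as to have connected complement, and then its union
with `K_i` has connected complement too, by Janiszewski's theorem (`isPreconnected_compl_union`). So
Runge's theorem yields a polynomial `q` that is close to a given polynomial `g` on a large part of
`∏ (Ω_i ∪ S_i)` and close to the target on `K`. As `S_n(q) = q` for large `n`
(`eventually_taylorSum_ofPoly`), this `q` satisfies the condition.

For the vector space, the conditions are imposed on finitely many members of a sequence `F` at once,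
with one common index `n` and independent targets. For generic `F` they hold, and the range of `F`
is dense in `X^∞(Ω, S)`. A linear combination `∑ c_j F_j` with `c_k ≠ 0` is then universal: to
approximate `h`, use the target `h / c_k` for `F_k` and `0` for the other members
(`sum_smul_mem_approxSet`). So the span of the range of `F` is the required subspace. The single
members of generic sequences give the existence and the density of universal functions.

Runge's theorem for products is derived one variable at a time from the Cauchy–Pompeiu formula
(`cauchy_pompeiu`), poles being pushed to infinity by the invariance of the spectrum in closed
subalgebras. Completeness uses that locally uniform limits of holomorphic functions of several
variables are holomorphic, together with their derivatives; this rests on Osgood's lemma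
(`analyticOnNhd_of_separately`).
-/

noncomputable section

namespace PartialTaylor

/-! ### Compact plane sets with connected complements -/

section

theorem isPreconnected_compl_closedBall (R : ℝ) :
    IsPreconnected (Metric.closedBall (0 : ℂ) R)ᶜ := by
  rcases lt_or_ge R 0 with hR | hR
  · simpa [Metric.closedBall_eq_empty.2 hR] using isPreconnected_univ
  have h : (Metric.closedBall (0 : ℂ) R)ᶜ =
      (fun p : ℝ × ℝ => (p.1 : ℂ) * Complex.exp (p.2 * Complex.I)) '' (Ioi R ×ˢ univ) := by
    ext z
    simp only [mem_compl_iff, Metric.mem_closedBall, dist_zero_right, not_le, mem_image,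
      mem_prod, mem_Ioi, mem_univ, and_true, Prod.exists]
    constructor
    · intro hz
      exact ⟨‖z‖, Complex.arg z, hz, Complex.norm_mul_exp_arg_mul_I z⟩
    · rintro ⟨r, t, hr, rfl⟩
      rw [norm_mul, Complex.norm_exp_ofReal_mul_I, mul_one, Complex.norm_real]
      exact hr.trans_le (le_abs_self r)
  rw [h]
  refine ((convex_Ioi R).isPreconnected.prod isPreconnected_univ).image _ ?_
  fun_prop

/-- The hull of a compact set `K`, that is, the complement of the unbounded component of `Kᶜ`. The
last clause says that a connected set off `K` that leaves the disc of radius `R` stays off the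
hull. -/
theorem exists_hull {K : Set ℂ} (hK : IsCompact K) {R : ℝ} (hR : K ⊆ Metric.closedBall 0 R) :
    ∃ L : Set ℂ, IsCompact L ∧ K ⊆ L ∧ L ⊆ Metric.closedBall 0 R ∧ IsPreconnected Lᶜ ∧
      ∀ C : Set ℂ, IsPreconnected C → C ⊆ Kᶜ → (∃ x ∈ C, R < ‖x‖) → C ⊆ Lᶜ := by
  set x : ℂ := ((|R| + 1 : ℝ) : ℂ) with hx
  have hxR : R < ‖x‖ := by
    rw [hx, Complex.norm_real, Real.norm_of_nonneg (by positivity)]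
    linarith [le_abs_self R]
  have hE : (Metric.closedBall (0 : ℂ) R)ᶜ ⊆ Kᶜ := compl_subset_compl.2 hR
  have hxE : x ∈ (Metric.closedBall (0 : ℂ) R)ᶜ := by simpa using hxR
  have hEc : (Metric.closedBall (0 : ℂ) R)ᶜ ⊆ connectedComponentIn Kᶜ x :=
    (isPreconnected_compl_closedBall R).subset_connectedComponentIn hxE hE
  have hsub : (connectedComponentIn Kᶜ x)ᶜ ⊆ Metric.closedBall 0 R :=
    compl_subset_comm.1 hEc
  refine ⟨(connectedComponentIn Kᶜ x)ᶜ, ?_, ?_, hsub, ?_, ?_⟩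
  · exact Metric.isCompact_of_isClosed_isBounded
      (hK.isClosed.isOpen_compl.connectedComponentIn).isClosed_compl
      (Metric.isBounded_closedBall.subset hsub)
  · exact subset_compl_comm.1 (connectedComponentIn_subset _ _)
  · rw [compl_compl]
    exact isPreconnected_connectedComponentIn
  · rintro C hC hCK ⟨y, hy, hyR⟩
    rw [compl_compl]
    have hyE : y ∈ (Metric.closedBall (0 : ℂ) R)ᶜ := by simpa using hyR
    have h1 : IsPreconnected (C ∪ (Metric.closedBall (0 : ℂ) R)ᶜ) :=
      hC.union y hy hyE (isPreconnected_compl_closedBall R)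
    exact subset_union_left.trans
      (h1.subset_connectedComponentIn (Or.inr hxE) (union_subset hCK hE))

/-- A compact set with connected complement has arbitrarily small compact neighbourhoods with
connected complement, namely the hulls of its thickenings. -/
theorem exists_compact_nhds_isPreconnected_compl {K V : Set ℂ} (hK : IsCompact K)
    (hKc : IsPreconnected Kᶜ) (hV : IsOpen V) (hKV : K ⊆ V) :
    ∃ L : Set ℂ, IsCompact L ∧ K ⊆ interior L ∧ L ⊆ V ∧ IsPreconnected Lᶜ := by
  obtain ⟨R, hR⟩ := (hK.cthickening (r := 1)).isBounded.subset_closedBall (0 : ℂ)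
  set x : ℂ := ((|R| + 1 : ℝ) : ℂ) with hx
  have hxR : R < ‖x‖ := by
    rw [hx, Complex.norm_real, Real.norm_of_nonneg (by positivity)]
    linarith [le_abs_self R]
  have hthick : ∀ δ : ℝ, ∃ L : Set ℂ, IsCompact L ∧ Metric.cthickening (min δ 1) K ⊆ L ∧
      L ⊆ Metric.closedBall 0 R ∧ IsPreconnected Lᶜ ∧
      ∀ C : Set ℂ, IsPreconnected C → C ⊆ (Metric.cthickening (min δ 1) K)ᶜ →
        (∃ x ∈ C, R < ‖x‖) → C ⊆ Lᶜ := fun δ =>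
    exists_hull hK.cthickening ((Metric.cthickening_mono (min_le_right _ _) _).trans hR)
  choose L hLc hKL hLR hLconn hL using hthick
  have hxK : x ∈ Kᶜ := fun h => by
    have := hR (Metric.self_subset_cthickening _ h)
    rw [Metric.mem_closedBall, dist_zero_right] at this
    linarith
  have hpath : IsPathConnected Kᶜ :=
    (hK.isClosed.isOpen_compl.isConnected_iff_isPathConnected).1 ⟨⟨x, hxK⟩, hKc⟩
  -- Points off `K` are joined to infinity off a small thickening of `K`, locally uniformly.
  have hloc : ∀ z ∈ Kᶜ, ∃ U ∈ 𝓝 z, ∃ δ > 0, ∀ δ' ≤ δ, U ⊆ (L δ')ᶜ := by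
    intro z hz
    have hj := hpath.joinedIn z hz x hxK
    set C : Set ℂ := range hj.somePath
    have hC : IsCompact C := isCompact_range hj.somePath.continuous
    have hd : Disjoint K C := by
      rw [Set.disjoint_right]
      rintro _ ⟨t, rfl⟩
      exact hj.somePath_mem t
    obtain ⟨δ, hδ, hdis⟩ := hd.exists_cthickenings hK hC.isClosed
    have hzC : z ∈ C := ⟨0, by simp⟩
    refine ⟨Metric.ball z δ, Metric.ball_mem_nhds _ hδ, δ, hδ, fun δ' hδ' => ?_⟩
    have hconn : IsPreconnected (Metric.ball z δ ∪ C) :=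
      (convex_ball z δ).isPreconnected.union z (Metric.mem_ball_self hδ) hzC
        (isPreconnected_range hj.somePath.continuous)
    refine subset_union_left.trans (hL δ' _ hconn ?_ ⟨_, Or.inr ⟨1, rfl⟩, by simpa using hxR⟩)
    have h1 : Metric.ball z δ ∪ C ⊆ Metric.cthickening δ C :=
      union_subset (fun y hy => Metric.mem_cthickening_of_dist_le y z δ C hzC
        (Metric.mem_ball.1 hy).le) (Metric.self_subset_cthickening _)
    have h2 : Metric.cthickening (min δ' 1) K ⊆ Metric.cthickening δ K :=
      Metric.cthickening_mono ((min_le_left _ _).trans hδ') _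
    exact (h1.trans hdis.symm.subset_compl_right).trans (compl_subset_compl.2 h2)
  have hcpt : IsCompact (Metric.closedBall (0 : ℂ) R ∩ Vᶜ) :=
    (isCompact_closedBall _ _).inter_right hV.isClosed_compl
  obtain ⟨δ, hδ, hsub⟩ : ∃ δ > 0, ∀ δ' ≤ δ, Metric.closedBall (0 : ℂ) R ∩ Vᶜ ⊆ (L δ')ᶜ := by
    refine hcpt.induction_on (p := fun s => ∃ δ > 0, ∀ δ' ≤ δ, s ⊆ (L δ')ᶜ)
      ⟨1, one_pos, fun _ _ => empty_subset _⟩ ?_ ?_ ?_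
    · rintro s t hst ⟨δ, hδ, h⟩
      exact ⟨δ, hδ, fun δ' hδ' => hst.trans (h δ' hδ')⟩
    · rintro s t ⟨δ, hδ, h⟩ ⟨ε, hε, h'⟩
      exact ⟨min δ ε, lt_min hδ hε, fun δ' hδ' => union_subset
        (h δ' (hδ'.trans (min_le_left _ _))) (h' δ' (hδ'.trans (min_le_right _ _)))⟩
    · intro z hz
      obtain ⟨U, hU, h⟩ := hloc z fun hzK => hz.2 (hKV hzK)
      exact ⟨U, mem_nhdsWithin_of_mem_nhds hU, h⟩
  refine ⟨L δ, hLc δ, ?_, fun z hz => ?_, hLconn δ⟩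
  · refine Subset.trans ?_ (interior_mono (hKL δ))
    exact (Metric.self_subset_thickening (lt_min hδ one_pos) K).trans
      (Metric.thickening_subset_interior_cthickening _ _)
  · by_contra hzV
    exact hsub δ le_rfl ⟨hLR δ hz, hzV⟩ hz

/-- Properties of points off a compact set with connected complement propagate from infinity, if
they persist when a point is moved by less than its distance to the set. -/
theorem propagate_compl {L : Set ℂ} (hL : IsCompact L) (hLc : IsPreconnected Lᶜ) {P : ℂ → Prop}
    (hstep : ∀ a b ε, P a → ‖a - b‖ < ε → (∀ z ∈ L, ε ≤ ‖z - a‖) → P b)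
    (hfar : ∀ b, (∀ z ∈ L, ‖z‖ < ‖b‖) → P b) {w : ℂ} (hw : w ∉ L) : P w := by
  have hdist : ∀ a ∉ L, ∃ ε > 0, ∀ b, ‖b - a‖ < ε → ∀ z ∈ L, ε ≤ ‖z - b‖ := by
    intro a ha
    obtain ⟨ε, hε, hball⟩ := Metric.isOpen_iff.1 hL.isClosed.isOpen_compl a ha
    refine ⟨ε / 2, half_pos hε, fun b hb z hz => ?_⟩
    by_contra! h
    have hzb : z ∈ Metric.ball a ε := ?_
    · exact hball hzb hz
    rw [Metric.mem_ball, dist_eq_norm]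
    calc ‖z - a‖ = ‖(z - b) + (b - a)‖ := by ring_nf
      _ ≤ _ := norm_add_le _ _
      _ < ε := by linarith
  set U : Set ℂ := {a | a ∉ L ∧ P a} with hU
  have hUo : IsOpen U := by
    rw [Metric.isOpen_iff]
    rintro a ⟨ha, hPa⟩
    obtain ⟨ε, hε, h⟩ := hdist a ha
    refine ⟨ε, hε, fun b hb => ?_⟩
    rw [Metric.mem_ball, dist_eq_norm] at hb
    refine ⟨fun hbL => ?_, hstep a b ε hPa (by rwa [norm_sub_rev]) (h a (by simpa using hε))⟩
    have := h b hb b hbL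
    simp only [sub_self, norm_zero] at this
    linarith
  obtain ⟨R, hR⟩ := hL.isBounded.subset_closedBall (0 : ℂ)
  have hne : (Lᶜ ∩ U).Nonempty := by
    have hb : ∀ z ∈ L, ‖z‖ < ‖((|R| + 1 : ℝ) : ℂ)‖ := fun z hz => by
      have := hR hz
      rw [Metric.mem_closedBall, dist_zero_right] at this
      rw [Complex.norm_real, Real.norm_of_nonneg (by positivity)]
      linarith [le_abs_self R]
    have hnot : ((|R| + 1 : ℝ) : ℂ) ∉ L := fun h => lt_irrefl _ (hb _ h)
    exact ⟨_, hnot, hnot, hfar _ hb⟩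
  refine (hLc.subset_of_closure_inter_subset hUo hne ?_ hw).2
  rintro b ⟨hb, hbL⟩
  obtain ⟨ε, hε, h⟩ := hdist b hbL
  obtain ⟨a, ⟨ha, hPa⟩, hab⟩ := Metric.mem_closure_iff.1 hb ε hε
  rw [dist_comm, dist_eq_norm] at hab
  exact ⟨hbL, hstep a b ε hPa hab (h a hab)⟩

/-- A continuous logarithm of `z - w` on a compact set whose complement is connected. -/
theorem exists_continuousOn_exp_eq_sub {L : Set ℂ} (hL : IsCompact L) (hLc : IsPreconnected Lᶜ)
    {w : ℂ} (hw : w ∉ L) :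
    ∃ g : ℂ → ℂ, ContinuousOn g L ∧ ∀ z ∈ L, Complex.exp (g z) = z - w := by
  have hslit : ∀ u : ℂ, ‖u‖ < 1 → 1 + u ∈ Complex.slitPlane := fun u hu =>
    Complex.mem_slitPlane_of_norm_lt_one hu
  refine propagate_compl hL hLc (P := fun w => ∃ g : ℂ → ℂ, ContinuousOn g L ∧
    ∀ z ∈ L, Complex.exp (g z) = z - w) ?_ ?_ hw
  · rintro a b ε ⟨g, hg, hgexp⟩ hab hε
    have hε0 : 0 < ε := (norm_nonneg _).trans_lt hab
    have hne : ∀ z ∈ L, z - a ≠ 0 := fun z hz h => by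
      have := hε z hz
      rw [h, norm_zero] at this
      linarith
    have hsl : ∀ z ∈ L, 1 + (a - b) / (z - a) ∈ Complex.slitPlane := fun z hz => by
      refine hslit _ ?_
      rw [norm_div, div_lt_one (norm_pos_iff.2 (hne z hz))]
      exact hab.trans_le (hε z hz)
    refine ⟨fun z => g z + Complex.log (1 + (a - b) / (z - a)), ?_, fun z hz => ?_⟩
    · refine hg.add (ContinuousOn.clog ?_ hsl)
      exact continuousOn_const.add (continuousOn_const.div (by fun_prop) hne)
    · rw [Complex.exp_add, hgexp z hz, Complex.exp_log (Complex.slitPlane_ne_zero (hsl z hz))]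
      field_simp [hne z hz]
      ring
  · intro b hb
    by_cases hne : L.Nonempty
    · have hb0 : b ≠ 0 := by
        obtain ⟨z, hz⟩ := hne
        exact norm_pos_iff.1 ((norm_nonneg _).trans_lt (hb z hz))
      have hsl : ∀ z ∈ L, 1 + -z / b ∈ Complex.slitPlane := fun z hz => by
        refine hslit _ ?_
        rw [norm_div, norm_neg, div_lt_one (norm_pos_iff.2 hb0)]
        exact hb z hz
      refine ⟨fun z => Complex.log (-b) + Complex.log (1 + -z / b), ?_, fun z hz => ?_⟩
      · exact continuousOn_const.add (ContinuousOn.clog (by fun_prop) hsl)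
      · rw [Complex.exp_add, Complex.exp_log (neg_ne_zero.2 hb0),
          Complex.exp_log (Complex.slitPlane_ne_zero (hsl z hz))]
        field_simp
        ring
    · rw [not_nonempty_iff_eq_empty] at hne
      subst hne
      exact ⟨0, continuousOn_empty _, by simp⟩

/-- `z - w` has no nonvanishing continuous extension from the circle around `w` to the plane: such
an extension would have a continuous logarithm, and the logarithm of `z - w` has a monodromy. -/
theorem not_continuous_extension_sub {M : ℂ → ℂ} (hM : Continuous M) (hM0 : ∀ z, M z ≠ 0)
    (w : ℂ) {R : ℝ} (hR : 0 < R) (h : ∀ z, ‖z - w‖ = R → M z = z - w) : False := by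
  obtain ⟨l, ⟨-, hlM⟩, -⟩ := Complex.isCoveringMapOn_exp.existsUnique_continuousMap_lifts
    (⟨M, hM⟩ : C(ℂ, ℂ)) (a₀ := 0) (Complex.exp_log (hM0 0)) (fun z => hM0 z)
  set g : ℝ → ℂ := fun t => l (w + R * Complex.exp (t * Complex.I)) - t * Complex.I with hg
  have hgc : Continuous g := by fun_prop
  have hexp : ∀ t, Complex.exp (g t) = R := by
    intro t
    have h1 := congrFun hlM (w + R * Complex.exp (t * Complex.I))
    simp only [Function.comp, ContinuousMap.coe_mk] at h1
    rw [h _ (by simp [Complex.norm_exp_ofReal_mul_I, abs_of_pos hR])] at h1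
    rw [hg, Complex.exp_sub, h1, add_sub_cancel_left, mul_div_assoc,
      div_self (Complex.exp_ne_zero _), mul_one]
  have hconst : g = fun _ => g 0 := by
    refine Complex.isCoveringMap_exp.eq_of_comp_eq hgc continuous_const ?_ 0 rfl
    funext t
    exact Subtype.ext ((hexp t).trans (hexp 0).symm)
  have := congrFun hconst (2 * Real.pi)
  simp [hg, Complex.exp_two_pi_mul_I] at this

/-- **Janiszewski's theorem** for disjoint compact sets: the union of two disjoint compact plane
sets that do not separate the plane does not separate it either. For a point `w` of the hull of the
union, the logarithms of `z - w` on both sets combine to one on the union; its exponential, extended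
continuously to the hull, extends `z - w` from outside the hull without zeros. -/
theorem isPreconnected_compl_union {K L : Set ℂ} (hK : IsCompact K) (hL : IsCompact L)
    (hKc : IsPreconnected Kᶜ) (hLc : IsPreconnected Lᶜ) (hKL : Disjoint K L) :
    IsPreconnected (K ∪ L)ᶜ := by
  have hX : IsCompact (K ∪ L) := hK.union hL
  obtain ⟨R, hR⟩ := hX.isBounded.subset_closedBall (0 : ℂ)
  obtain ⟨X, hXc, hsub, hXR, hXconn, hout⟩ := exists_hull hX hR
  suffices X = K ∪ L by rwa [← this]
  refine Subset.antisymm (fun w hw => ?_) hsub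
  by_contra hwX
  -- The boundary of the hull lies in `K ∪ L`.
  have hfr : frontier X ⊆ K ∪ L := by
    intro y hy
    by_contra hyX
    obtain ⟨ε, hε, hball⟩ := Metric.isOpen_iff.1 hX.isClosed.isOpen_compl y hyX
    have hy' : y ∈ closure Xᶜ := by
      rw [← frontier_compl] at hy
      exact frontier_subset_closure hy
    obtain ⟨v, hv, hvy⟩ := Metric.mem_closure_iff.1 hy' ε hε
    rw [dist_comm] at hvy
    set x : ℂ := ((|R| + 1 : ℝ) : ℂ) with hx
    have hxR : R < ‖x‖ := by
      rw [hx, Complex.norm_real, Real.norm_of_nonneg (by positivity)]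
      linarith [le_abs_self R]
    have hxX : x ∈ Xᶜ := fun h => by
      have := hXR h
      rw [Metric.mem_closedBall, dist_zero_right] at this
      linarith
    have hc : IsPreconnected (Metric.ball y ε ∪ Xᶜ) :=
      (convex_ball y ε).isPreconnected.union v hvy hv hXconn
    exact hout _ hc (union_subset hball (compl_subset_compl.2 hsub)) ⟨x, Or.inr hxX, hxR⟩
      (Or.inl (Metric.mem_ball_self hε)) (hXc.isClosed.frontier_subset hy)
  have hwK : w ∉ K := fun h => hwX (Or.inl h)
  have hwL : w ∉ L := fun h => hwX (Or.inr h)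
  obtain ⟨g₁, hg₁, hg₁e⟩ := exists_continuousOn_exp_eq_sub hK hKc hwK
  obtain ⟨g₂, hg₂, hg₂e⟩ := exists_continuousOn_exp_eq_sub hL hLc hwL
  classical
  obtain ⟨G, hG⟩ : ∃ G : C(ℂ, ℂ), ∀ z ∈ K ∪ L, Complex.exp (G z) = z - w := by
    have hc : ContinuousOn (K.piecewise g₁ g₂) (K ∪ L) := by
      refine ContinuousOn.union_of_isClosed ?_ ?_ hK.isClosed hL.isClosed
      · exact hg₁.congr fun z hz => piecewise_eq_of_mem _ _ _ hz
      · exact hg₂.congr fun z hz => piecewise_eq_of_notMem _ _ _ (hKL.notMem_of_mem_right hz)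
    obtain ⟨G, hG⟩ := ContinuousMap.exists_restrict_eq hX.isClosed
      (⟨(K ∪ L).domRestrict (K.piecewise g₁ g₂), continuousOn_iff_continuous_domRestrict.1 hc⟩ :
        C(↥(K ∪ L), ℂ))
    refine ⟨G, fun z hz => ?_⟩
    have h1 : G z = K.piecewise g₁ g₂ z := DFunLike.congr_fun hG ⟨z, hz⟩
    rw [h1]
    by_cases hzK : z ∈ K
    · rw [piecewise_eq_of_mem _ _ _ hzK, hg₁e z hzK]
    · rw [piecewise_eq_of_notMem _ _ _ hzK, hg₂e z (hz.resolve_left hzK)]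
  refine not_continuous_extension_sub (M := X.piecewise (fun z => Complex.exp (G z)) (· - w))
    ?_ ?_ w (R := |R| + ‖w‖ + 1) (by positivity) ?_
  · refine Continuous.piecewise (fun z hz => hG z (hfr hz)) (by fun_prop) (by fun_prop)
  · intro z
    by_cases hz : z ∈ X
    · rw [piecewise_eq_of_mem _ _ _ hz]
      exact Complex.exp_ne_zero _
    · rw [piecewise_eq_of_notMem _ _ _ hz]
      intro h
      exact hz (sub_eq_zero.1 h ▸ hw)
  · intro z hz
    refine piecewise_eq_of_notMem _ _ _ fun hzX => ?_
    have := hXR hzX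
    rw [Metric.mem_closedBall, dist_zero_right] at this
    linarith [norm_sub_le z w, le_abs_self R]

end

/-! ### The Cauchy–Pompeiu formula -/

section

/-- Twice `i` times the Cauchy-Riemann operator `∂/∂z̄`. -/
def dbar (χ : ℂ → ℂ) (w : ℂ) : ℂ :=
  Complex.I * fderiv ℝ χ w 1 - fderiv ℝ χ w Complex.I

theorem continuous_dbar {χ : ℂ → ℂ} (hχ : ContDiff ℝ 1 χ) : Continuous (dbar χ) := by
  have h := hχ.continuous_fderiv (by norm_num)
  unfold dbar
  fun_prop

theorem dbar_eq_zero_of_notMem_tsupport {χ : ℂ → ℂ} {w : ℂ} (hw : w ∉ tsupport χ) :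
    dbar χ w = 0 := by
  have : fderiv ℝ χ w = 0 := by
    have h := (notMem_tsupport_iff_eventuallyEq.1 hw).fderiv_eq (𝕜 := ℝ)
    rw [h]
    exact fderiv_const_apply _
  simp [dbar, this]

theorem dbar_eq_zero_of_eventuallyEq_one {χ : ℂ → ℂ} {w : ℂ} (hw : χ =ᶠ[𝓝 w] fun _ => 1) :
    dbar χ w = 0 := by
  have : fderiv ℝ χ w = 0 := by
    rw [hw.fderiv_eq (𝕜 := ℝ)]
    exact fderiv_const_apply _
  simp [dbar, this]

/-- The integral that an edge of a square around `z` contributes to `∮ dw / (w - z)`, up to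
a factor, after the contribution of the opposite edge has been added. -/
theorem integral_two_mul_div_sq_add_sq (c : ℝ) {B : ℝ} (hB : 0 < B) :
    ∫ x in (c - B)..(c + B), 2 * B / ((x - c) ^ 2 + B ^ 2) = Real.pi := by
  have hd : ∀ x : ℝ, HasDerivAt (fun x => 2 * Real.arctan ((x - c) / B))
      (2 * B / ((x - c) ^ 2 + B ^ 2)) x := by
    intro x
    have h := ((((hasDerivAt_id x).sub_const c).div_const B).arctan).const_mul 2
    refine h.congr_deriv ?_
    rw [id]
    have : (x - c) ^ 2 + B ^ 2 ≠ 0 := by positivity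
    have h2 : 1 + ((x - c) / B) ^ 2 ≠ 0 := by positivity
    field_simp
    ring
  rw [intervalIntegral.integral_eq_sub_of_hasDerivAt (fun x _ => hd x)]
  · simp [hB.ne']
    ring
  · refine Continuous.intervalIntegrable ?_ _ _
    refine continuous_const.div (by fun_prop) fun x => ?_
    positivity

theorem integral_two_mul_div_sq_add_sq_complex (c : ℝ) {B : ℝ} (hB : 0 < B) (k : ℂ) {F : ℝ → ℂ}
    (hF : ∀ x, F x = k * ((2 * B / ((x - c) ^ 2 + B ^ 2) : ℝ) : ℂ)) :
    ∫ x in (c - B)..(c + B), F x = k * Real.pi := by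
  rw [intervalIntegral.integral_congr (fun x _ => hF x), intervalIntegral.integral_const_mul,
    intervalIntegral.integral_ofReal, integral_two_mul_div_sq_add_sq c hB]

variable {V : Set ℂ} {χ h : ℂ → ℂ} {z : ℂ}

theorem continuous_pompeiu_integrand (hV : IsOpen V) (hχ : ContDiff ℝ 1 χ)
    (hsupp : tsupport χ ⊆ V) (hh : ContinuousOn h V) (hz : χ =ᶠ[𝓝 z] fun _ => 1) :
    Continuous fun w => dbar χ w * h w / (w - z) := by
  rw [continuous_iff_continuousAt]
  intro w
  by_cases hw : w ∈ tsupport χ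
  · by_cases hwz : w = z
    · subst hwz
      have : (fun u => dbar χ u * h u / (u - w)) =ᶠ[𝓝 w] fun _ => 0 := by
        filter_upwards [hz.eventuallyEq_nhds] with u hu
        simp [dbar_eq_zero_of_eventuallyEq_one hu]
      exact continuousAt_const.congr this.symm
    · refine ContinuousAt.div ?_ (by fun_prop) (sub_ne_zero.2 hwz)
      exact (continuous_dbar hχ).continuousAt.mul (hh.continuousAt (hV.mem_nhds (hsupp hw)))
  · have : (fun u => dbar χ u * h u / (u - z)) =ᶠ[𝓝 w] fun _ => 0 := by
      filter_upwards [(isClosed_tsupport χ).isOpen_compl.mem_nhds hw] with u hu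
      simp [dbar_eq_zero_of_notMem_tsupport hu]
    exact continuousAt_const.congr this.symm

theorem hasFDerivAt_cutoff_mul (hV : IsOpen V) (hχ : ContDiff ℝ 1 χ)
    (hsupp : tsupport χ ⊆ V) (hh : DifferentiableOn ℂ h V) (w : ℂ) :
    ∃ φ' : ℂ →L[ℝ] ℂ, HasFDerivAt (fun u => χ u * h u) φ' w ∧
      Complex.I * φ' 1 - φ' Complex.I = dbar χ w * h w := by
  by_cases hw : w ∈ tsupport χ
  · have h1 := (hχ.differentiable (by norm_num) w).hasFDerivAt
    have h2 := ((hh.differentiableAt (hV.mem_nhds (hsupp hw))).hasDerivAt.hasFDerivAt).restrictScalars ℝ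
    refine ⟨_, h1.mul h2, ?_⟩
    simp [dbar]
    ring
  · refine ⟨0, ?_, ?_⟩
    · refine (hasFDerivAt_const (0 : ℂ) w).congr_of_eventuallyEq ?_
      filter_upwards [(isClosed_tsupport χ).isOpen_compl.mem_nhds hw] with u hu
      simp [image_eq_zero_of_notMem_tsupport hu]
    · simp [dbar_eq_zero_of_notMem_tsupport hw]

/-- The **Cauchy–Pompeiu formula** for a holomorphic function `h` times a cutoff `χ` that is `1`
near `z`. It is Green's formula for the difference quotient `(χ h - χ(z) h(z)) / (w - z)`, which is
continuous at `z`, on a square centred at `z` outside of which `χ` vanishes; on the boundary of the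
square only `-h(z) / (w - z)` is left. -/
theorem cauchy_pompeiu (hV : IsOpen V) (hχ : ContDiff ℝ 1 χ) (hsupp : tsupport χ ⊆ V)
    (hh : DifferentiableOn ℂ h V) (hz : χ =ᶠ[𝓝 z] fun _ => 1) {A : ℝ}
    (hA : ∀ w ∈ tsupport χ, ‖w‖ < A) :
    ∫ x in (-A)..A, ∫ y in (-A)..A, dbar χ (x + y * Complex.I) * h (x + y * Complex.I) /
      (x + y * Complex.I - z) = -(2 * Real.pi * Complex.I) * h z := by
  set φ : ℂ → ℂ := fun u => χ u * h u with hφ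
  have hzs : z ∈ tsupport χ := subset_tsupport _ (by simp [hz.self_of_nhds])
  have hφz : φ z = h z := by simp [hφ, hz.self_of_nhds]
  have hA0 : 0 < A := (norm_nonneg z).trans_lt (hA z hzs)
  set G : ℂ → ℂ := fun w => dbar χ w * h w / (w - z) with hG
  have hGc : Continuous G := continuous_pompeiu_integrand hV hχ hsupp hh.continuousOn hz
  have hG0 : ∀ w : ℂ, A ≤ ‖w‖ → G w = 0 := fun w hw => by
    have : w ∉ tsupport χ := fun h => absurd (hA w h) (not_lt.2 hw)
    simp [hG, dbar_eq_zero_of_notMem_tsupport this]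
  -- The integral over any square containing the support is the same.
  have hsq : ∀ a b c d : ℝ, a ≤ -A → A ≤ b → c ≤ -A → A ≤ d →
      ∫ x in a..b, ∫ y in c..d, G (x + y * Complex.I) = ∫ x : ℝ, ∫ y : ℝ, G (x + y * Complex.I) := by
    intro a b c d ha hb hc hd
    have hx : ∀ x y : ℝ, A ≤ |x| → G (x + y * Complex.I) = 0 := fun x y hx =>
      hG0 _ (hx.trans (by simpa using Complex.abs_re_le_norm (x + y * Complex.I)))
    have hy : ∀ x y : ℝ, A ≤ |y| → G (x + y * Complex.I) = 0 := fun x y hy =>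
      hG0 _ (hy.trans (by simpa using Complex.abs_im_le_norm (x + y * Complex.I)))
    have h1 : ∀ x : ℝ, ∫ y in c..d, G (x + y * Complex.I) = ∫ y : ℝ, G (x + y * Complex.I) := by
      intro x
      refine intervalIntegral.integral_eq_integral_of_support_subset fun y hy' => ?_
      have : |y| < A := by
        by_contra! hcon
        exact hy' (hy x y hcon)
      rw [abs_lt] at this
      exact ⟨by linarith, by linarith⟩
    simp_rw [h1]
    refine intervalIntegral.integral_eq_integral_of_support_subset fun x hx' => ?_
    have : |x| < A := by
      by_contra! hcon
      refine hx' ?_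
      simp [hx x _ hcon]
    rw [abs_lt] at this
    exact ⟨by linarith, by linarith⟩
  set B : ℝ := A + ‖z‖ with hB
  have hB0 : 0 < B := by positivity
  have hre : |z.re| ≤ ‖z‖ := Complex.abs_re_le_norm z
  have him : |z.im| ≤ ‖z‖ := Complex.abs_im_le_norm z
  rw [abs_le] at hre him
  rw [hsq (-A) A (-A) A le_rfl le_rfl le_rfl le_rfl,
    ← hsq (z.re - B) (z.re + B) (z.im - B) (z.im + B) (by linarith) (by linarith) (by linarith)
      (by linarith)]
  -- The squares in the formulas below are centred at `z`, so that opposite edges combine.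
  set f : ℂ → ℂ := dslope φ z with hf
  have hφd : ∀ w, ∃ φ' : ℂ →L[ℝ] ℂ, HasFDerivAt φ φ' w ∧
      Complex.I * φ' 1 - φ' Complex.I = dbar χ w * h w := hasFDerivAt_cutoff_mul hV hχ hsupp hh
  choose φ' hφ' hφ'bar using hφd
  have hφz' : DifferentiableAt ℂ φ z := by
    have : φ =ᶠ[𝓝 z] h := by
      filter_upwards [hz] with u hu
      simp [hφ, hu]
    exact (hh.differentiableAt (hV.mem_nhds (hsupp hzs))).congr_of_eventuallyEq this
  have hfc : Continuous f := by
    rw [continuous_iff_continuousAt]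
    intro w
    by_cases hwz : w = z
    · subst hwz
      exact continuousAt_dslope_same.2 hφz'
    · exact (continuousAt_dslope_of_ne hwz).2 (hφ' w).continuousAt
  have hfne : ∀ w, w ≠ z → f w = (w - z)⁻¹ * (φ w - φ z) := fun w hw => by
    rw [hf, dslope_of_ne _ hw, slope_def_module, smul_eq_mul]
  have hfd : ∀ w, w ≠ z → ∃ f' : ℂ →L[ℝ] ℂ, HasFDerivAt f f' w ∧
      Complex.I * f' 1 - f' Complex.I = G w := by
    intro w hw
    have hw0 : w - z ≠ 0 := sub_ne_zero.2 hw
    have h1 : HasFDerivAt (fun u : ℂ => (u - z)⁻¹) _ w :=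
      ((((hasDerivAt_id w).sub_const z).fun_inv hw0).hasFDerivAt).restrictScalars ℝ
    have h2 := h1.mul ((hφ' w).sub_const (φ z))
    refine ⟨_, h2.congr_of_eventuallyEq ?_, ?_⟩
    · filter_upwards [isOpen_ne.mem_nhds hw] with u hu using hfne u hu
    · have := hφ'bar w
      simp only [hG]
      rw [← this]
      simp
      field_simp
      ring
  set f' : ℂ → ℂ →L[ℝ] ℂ := fun w => if hw : w = z then 0 else (hfd w hw).choose with hf'
  have hf'd : ∀ w, w ≠ z → HasFDerivAt f (f' w) w := fun w hw => by
    simp only [hf', dif_neg hw]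
    exact (hfd w hw).choose_spec.1
  have hf'G : ∀ w, Complex.I • f' w 1 - f' w Complex.I = G w := fun w => by
    by_cases hw : w = z
    · simp [hf', hG, hw]
    · simp only [hf', dif_neg hw]
      exact (hfd w hw).choose_spec.2
  have key := Complex.integral_boundary_rect_of_hasFDerivAt_real_off_countable f f'
    (z - (B + B * Complex.I)) (z + (B + B * Complex.I)) {z} (countable_singleton z)
    hfc.continuousOn (fun w hw => hf'd w hw.2) (by
      simp_rw [hf'G]
      exact hGc.continuousOn.integrableOn_compact
        (isCompact_uIcc.reProdIm isCompact_uIcc))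
  simp_rw [hf'G] at key
  have e1 : (z - (B + B * Complex.I)).re = z.re - B := by simp
  have e2 : (z - (B + B * Complex.I)).im = z.im - B := by simp
  have e3 : (z + (B + B * Complex.I)).re = z.re + B := by simp
  have e4 : (z + (B + B * Complex.I)).im = z.im + B := by simp
  rw [e1, e2, e3, e4] at key
  rw [← key]
  have hφ0 : ∀ w : ℂ, A ≤ ‖w‖ → φ w = 0 := fun w hw => by
    have : w ∉ tsupport χ := fun h => absurd (hA w h) (not_lt.2 hw)
    simp [hφ, image_eq_zero_of_notMem_tsupport this]
  -- On the boundary of the square the cutoff is zero.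
  have hfbd : ∀ w : ℂ, B ≤ ‖w - z‖ → f w = -h z / (w - z) := fun w hw => by
    have hwz : w ≠ z := fun h => by
      rw [h, sub_self, norm_zero] at hw
      linarith
    rw [hfne w hwz, hφ0 w (by linarith [norm_sub_le w z]), hφz]
    ring
  have hzeq : z = z.re + z.im * Complex.I := (Complex.re_add_im z).symm
  have hreB : ∀ x : ℝ, ∀ w : ℂ, (w - z).im = x → |x| = B → B ≤ ‖w - z‖ := fun x w h1 h2 => by
    rw [← h2, ← h1]
    exact Complex.abs_im_le_norm _
  have himB : ∀ x : ℝ, ∀ w : ℂ, (w - z).re = x → |x| = B → B ≤ ‖w - z‖ := fun x w h1 h2 => by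
    rw [← h2, ← h1]
    exact Complex.abs_re_le_norm _
  have hne : ∀ t : ℝ, (t : ℂ) ^ 2 + (B : ℂ) ^ 2 ≠ 0 := fun t => by
    have : t ^ 2 + B ^ 2 ≠ 0 := by positivity
    exact_mod_cast this
  have hfac1 : ∀ t : ℝ, (t : ℂ) - B * Complex.I ≠ 0 ∧ (t : ℂ) + B * Complex.I ≠ 0 := fun t => by
    have h := hne t
    have h2 : ((t : ℂ) - B * Complex.I) * (t + B * Complex.I) = t ^ 2 + B ^ 2 := by
      ring_nf; rw [Complex.I_sq]; ring
    rw [← h2] at h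
    exact ⟨left_ne_zero_of_mul h, right_ne_zero_of_mul h⟩
  have hfac2 : ∀ t : ℝ, (B : ℂ) + t * Complex.I ≠ 0 ∧ -(B : ℂ) + t * Complex.I ≠ 0 := fun t => by
    have h := hne t
    have h2 : ((B : ℂ) + t * Complex.I) * (-B + t * Complex.I) = -(t ^ 2 + B ^ 2) := by
      ring_nf; rw [Complex.I_sq]; ring
    rw [← neg_ne_zero, ← h2] at h
    exact ⟨left_ne_zero_of_mul h, right_ne_zero_of_mul h⟩
  rw [← intervalIntegral.integral_sub (Continuous.intervalIntegrable (by fun_prop) _ _)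
    (Continuous.intervalIntegrable (by fun_prop) _ _), add_sub_assoc, ← smul_sub,
    ← intervalIntegral.integral_sub (Continuous.intervalIntegrable (by fun_prop) _ _)
    (Continuous.intervalIntegrable (by fun_prop) _ _),
    integral_two_mul_div_sq_add_sq_complex z.re hB0 (-h z * Complex.I),
    integral_two_mul_div_sq_add_sq_complex z.im hB0 (-h z), smul_eq_mul]
  · ring
  · intro y
    rw [hfbd _ (himB B _ (by simp) (abs_of_pos hB0)),
      hfbd _ (himB (-B) _ (by simp) (by rw [abs_neg, abs_of_pos hB0]))]
    have h1 := hfac2 (y - z.im)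
    have h2 := hne (y - z.im)
    have e5 : ((z.re + B : ℝ) : ℂ) + y * Complex.I - z = B + (y - z.im : ℝ) * Complex.I := by
      nth_rw 2 [hzeq]; push_cast; ring
    have e6 : ((z.re - B : ℝ) : ℂ) + y * Complex.I - z = -B + (y - z.im : ℝ) * Complex.I := by
      nth_rw 2 [hzeq]; push_cast; ring
    rw [e5, e6]
    push_cast at h1 h2 ⊢
    rw [div_sub_div _ _ h1.1 h1.2, ← mul_div_assoc, div_eq_div_iff (mul_ne_zero h1.1 h1.2) h2]
    ring_nf; rw [Complex.I_sq]; ring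
  · intro x
    rw [hfbd _ (hreB (-B) _ (by simp) (by rw [abs_neg, abs_of_pos hB0])),
      hfbd _ (hreB B _ (by simp) (abs_of_pos hB0))]
    have h1 := hfac1 (x - z.re)
    have h2 := hne (x - z.re)
    have e5 : (x : ℂ) + (z.im - B : ℝ) * Complex.I - z = (x - z.re : ℝ) - B * Complex.I := by
      nth_rw 2 [hzeq]; push_cast; ring
    have e6 : (x : ℂ) + (z.im + B : ℝ) * Complex.I - z = (x - z.re : ℝ) + B * Complex.I := by
      nth_rw 2 [hzeq]; push_cast; ring
    rw [e5, e6]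
    push_cast at h1 h2 ⊢
    rw [div_sub_div _ _ h1.1 h1.2, ← mul_div_assoc, div_eq_div_iff (mul_ne_zero h1.1 h1.2) h2]
    ring_nf; rw [Complex.I_pow_three]; ring

end

/-! ### Runge's theorem on products of compact plane sets -/

section

/-- A smooth cutoff function that is `1` near `L` and supported in `V`. -/
theorem exists_cutoff {L V : Set ℂ} (hL : IsCompact L) (hV : IsOpen V) (hLV : L ⊆ V) :
    ∃ χ : ℂ → ℂ, ContDiff ℝ 1 χ ∧ HasCompactSupport χ ∧ tsupport χ ⊆ V ∧
      ∃ O, IsOpen O ∧ L ⊆ O ∧ ∀ z ∈ O, χ z = 1 := by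
  obtain ⟨L', hL'c, hLL', hL'V⟩ := exists_compact_between hL hV hLV
  obtain ⟨f, hf1, hf0, -⟩ := exists_contMDiffMap_one_nhds_of_subset_interior
    (modelWithCornersSelf ℝ ℂ) (n := 1) hL.isClosed hLL'
  have hsub : tsupport (fun z => (f z : ℂ)) ⊆ L' := by
    refine closure_minimal (fun z hz => ?_) hL'c.isClosed
    by_contra hzL
    exact hz (by simp [hf0 z hzL])
  obtain ⟨O, hO, hLO, hO1⟩ := mem_nhdsSet_iff_exists.1 hf1
  refine ⟨fun z => (f z : ℂ), ?_, HasCompactSupport.of_support_subset_isCompact hL'c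
    (subset_closure.trans hsub), hsub.trans hL'V, O, hO, hLO, fun z hz => ?_⟩
  · exact Complex.ofRealCLM.contDiff.comp f.contMDiff.contDiff
  · simp [show f z = 1 from hO1 hz]

variable {d : ℕ}

/-- The `i`-th coordinate as a continuous function on a subset of `ℂ^d`. -/
def coordMap (P : Set (Fin d → ℂ)) (i : Fin d) : C(P, ℂ) :=
  ⟨fun z => z.1 i, (continuous_apply i).comp continuous_subtype_val⟩

/-- The uniform closure of the polynomials in the algebra of continuous functions on a subset
of `ℂ^d`. -/
def polyAlgebra (P : Set (Fin d → ℂ)) [CompactSpace P] : Subalgebra ℂ C(P, ℂ) :=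
  (MvPolynomial.aeval (R := ℂ) (coordMap P)).range.topologicalClosure

theorem aeval_coordMap_apply {P : Set (Fin d → ℂ)} (p : MvPolynomial (Fin d) ℂ) (z : P) :
    MvPolynomial.aeval (R := ℂ) (coordMap P) p z = MvPolynomial.eval z.1 p := by
  induction p using MvPolynomial.induction_on with
  | C a => simp
  | add p q hp hq => simp [hp, hq]
  | mul_X p i hp => simp [hp, coordMap]

theorem coordMap_mem_polyAlgebra (P : Set (Fin d → ℂ)) [CompactSpace P] (i : Fin d) :
    coordMap P i ∈ polyAlgebra P :=
  Subalgebra.le_topologicalClosure _ ⟨MvPolynomial.X i, by simp⟩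

/-- If the complement of `L i` is connected, poles off `L i` can be pushed to infinity: the
spectrum of the coordinate `z i` in the closed subalgebra of polynomials is the same as in the
algebra of all continuous functions, namely `L i`. -/
theorem exists_pole_mem_polyAlgebra {L : Fin d → Set ℂ} [CompactSpace (univ.pi L)]
    {i : Fin d} (hLc : IsPreconnected (L i)ᶜ) {w : ℂ} (hw : w ∉ L i) :
    ∃ r ∈ polyAlgebra (univ.pi L), ∀ z : univ.pi L, r z = (w - z.1 i)⁻¹ := by
  by_cases hne : (univ.pi L).Nonempty
  · set x : polyAlgebra (univ.pi L) := ⟨coordMap _ i, coordMap_mem_polyAlgebra _ i⟩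
    have hspec : spectrum ℂ (x : C(univ.pi L, ℂ)) = L i := by
      rw [ContinuousMap.spectrum_eq_range]
      ext u
      constructor
      · rintro ⟨z, rfl⟩
        exact z.2 i (mem_univ i)
      · intro hu
        obtain ⟨z₀, hz₀⟩ := hne
        refine ⟨⟨Function.update z₀ i u, fun j _ => ?_⟩, by simp [x, coordMap]⟩
        by_cases hj : j = i
        · subst hj; simpa using hu
        · simpa [hj] using hz₀ j (mem_univ j)
    have hcl : IsClosed (polyAlgebra (univ.pi L) : Set C(univ.pi L, ℂ)) :=
      Subalgebra.isClosed_topologicalClosure _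
    have hw' : w ∉ spectrum ℂ x := by
      rw [Subalgebra.spectrum_eq_of_isPreconnected_compl (polyAlgebra (univ.pi L)) x
        (by rwa [hspec]), hspec]
      exact hw
    obtain ⟨r, hr⟩ := (spectrum.notMem_iff.1 hw').exists_right_inv
    refine ⟨r, r.2, fun z => ?_⟩
    have h1 : ((algebraMap ℂ (polyAlgebra (univ.pi L)) w - x) * r : polyAlgebra (univ.pi L)).1 z
      = 1 := by rw [hr]; rfl
    refine eq_inv_of_mul_eq_one_right ?_
    rw [← h1]
    rfl
  · exact ⟨0, zero_mem _, fun z => (hne ⟨z.1, z.2⟩).elim⟩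

/-- The integrand of the Cauchy–Pompeiu formula is jointly continuous in the variable of integration
and the parameters: it vanishes where `χ` is locally constant, in particular near its pole. -/
theorem continuous_cauchy_kernel {X : Type*} [TopologicalSpace X] {V L O : Set ℂ} {χ : ℂ → ℂ}
    (hχ : ContDiff ℝ 1 χ) (hsupp : tsupport χ ⊆ V) (hO : IsOpen O) (hLO : L ⊆ O)
    (hO1 : ∀ z ∈ O, χ z = 1) {H : ℂ × X → ℂ} (hH : ∀ u ∈ V, ∀ x, ContinuousAt H (u, x))
    {ℓ : X → ℂ} (hℓ : Continuous ℓ) (hℓL : ∀ x, ℓ x ∈ L) :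
    Continuous fun p : ℂ × X => dbar χ p.1 * H p / (p.1 - ℓ p.2) := by
  have hO0 : ∀ u ∈ O, dbar χ u = 0 := fun u hu =>
    dbar_eq_zero_of_eventuallyEq_one (by filter_upwards [hO.mem_nhds hu] with v hv using hO1 v hv)
  rw [continuous_iff_continuousAt]
  rintro ⟨u, x⟩
  by_cases hu : u ∈ tsupport χ
  · by_cases huO : u ∈ O
    · have : (fun p : ℂ × X => dbar χ p.1 * H p / (p.1 - ℓ p.2)) =ᶠ[𝓝 (u, x)] fun _ => 0 := by
        filter_upwards [(hO.preimage continuous_fst).mem_nhds (show (u, x) ∈ _ from huO)] with p hp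
        simp [hO0 p.1 hp]
      exact continuousAt_const.congr this.symm
    · refine ContinuousAt.div ?_ (by fun_prop) ?_
      · exact ((continuous_dbar hχ).comp continuous_fst).continuousAt.mul (hH u (hsupp hu) x)
      · exact sub_ne_zero.2 fun h => huO (hLO (by rw [show u = ℓ x from h]; exact hℓL x))
  · have : (fun p : ℂ × X => dbar χ p.1 * H p / (p.1 - ℓ p.2)) =ᶠ[𝓝 (u, x)] fun _ => 0 := by
      filter_upwards [((isClosed_tsupport χ).isOpen_compl.preimage continuous_fst).mem_nhds
        (show (u, x) ∈ _ from hu)] with p hp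
      simp [dbar_eq_zero_of_notMem_tsupport hp]
    exact continuousAt_const.congr this.symm

/-- The Cauchy–Pompeiu integral of functions in a closed subspace stays in that subspace. -/
theorem exists_mem_eq_integral {X : Type*} [TopologicalSpace X] [CompactSpace X]
    {S : Submodule ℂ C(X, ℂ)} (hS : IsClosed (S : Set C(X, ℂ))) {k : ℂ × X → ℂ}
    (hk : Continuous k) (hkS : ∀ u, ∃ F ∈ S, ∀ x, F x = k (u, x)) (A : ℝ) :
    ∃ F ∈ S, ∀ x, F x = ∫ s in (-A)..A, ∫ t in (-A)..A, k (s + t * Complex.I, x) := by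
  have : CompleteSpace S := hS.completeSpace_coe
  choose F hFS hF using hkS
  set Ψ : ℂ → S := fun u => ⟨F u, hFS u⟩ with hΨ
  have hΨc : Continuous Ψ := by
    refine Continuous.subtype_mk ?_ _
    have : F = (ContinuousMap.curry ⟨k, hk⟩ : C(ℂ, C(X, ℂ))) := by
      funext u
      ext x
      exact hF u x
    rw [this]
    exact ContinuousMap.continuous _
  have hinner : Continuous fun s : ℝ => ∫ t in (-A)..A, Ψ (s + t * Complex.I) :=
    intervalIntegral.continuous_parametric_intervalIntegral_of_continuous'
      (f := fun (s t : ℝ) => Ψ (s + t * Complex.I)) (by unfold Function.uncurry; fun_prop) _ _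
  refine ⟨(∫ s in (-A)..A, ∫ t in (-A)..A, Ψ (s + t * Complex.I) : S), Subtype.prop _, fun x => ?_⟩
  set ev : S →L[ℂ] ℂ := (ContinuousMap.evalCLM ℂ x).comp S.subtypeL with hev
  have h1 : ∀ G : S, ev G = G.1 x := fun G => rfl
  rw [← h1, ← ContinuousLinearMap.intervalIntegral_comp_comm ev (hinner.intervalIntegrable _ _)]
  refine intervalIntegral.integral_congr fun s _ => ?_
  rw [← ContinuousLinearMap.intervalIntegral_comp_comm ev
    (Continuous.intervalIntegrable (by fun_prop) _ _)]
  exact intervalIntegral.integral_congr fun t _ => hF _ x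

/-- A holomorphic function near a product of compact sets with connected complements is in the
uniform closure of the polynomials, also after the variables outside `s` have been frozen. Releasing
one more variable `j` is the Cauchy–Pompeiu formula in that variable, which writes the function as
an integral of functions in the closure. -/
theorem exists_mem_polyAlgebra_eq {L V : Fin d → Set ℂ} (hLc : ∀ i, IsCompact (L i))
    (hLconn : ∀ i, IsPreconnected (L i)ᶜ) (hV : ∀ i, IsOpen (V i)) (hLV : ∀ i, L i ⊆ V i)
    [CompactSpace (univ.pi L)] {h : (Fin d → ℂ) → ℂ} (hh : DifferentiableOn ℂ h (univ.pi V))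
    (s : Finset (Fin d)) : ∀ w ∈ univ.pi V,
      ∃ F ∈ polyAlgebra (univ.pi L), ∀ z : univ.pi L, F z = h (s.piecewise z.1 w) := by
  classical
  have hVo : IsOpen (univ.pi V) := isOpen_set_pi finite_univ fun i _ => hV i
  induction s using Finset.induction_on with
  | empty =>
    intro w _
    exact ⟨algebraMap ℂ _ (h w), Subalgebra.algebraMap_mem _ _, fun z => by simp⟩
  | insert j s hj ih =>
    intro w hw
    obtain ⟨χ, hχ, hχc, hχV, O, hO, hLO, hO1⟩ := exists_cutoff (hLc j) (hV j) (hLV j)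
    obtain ⟨A, hA⟩ := hχc.isBounded.subset_ball (0 : ℂ)
    have hmem : ∀ (z : univ.pi L), ∀ u ∈ V j,
        s.piecewise z.1 (Function.update w j u) ∈ univ.pi V := by
      intro z u hu i _
      by_cases hi : i ∈ s
      · simpa [hi] using hLV i (z.2 i (mem_univ i))
      · by_cases hij : i = j
        · subst hij; simpa [hi] using hu
        · simpa [hi, hij] using hw i (mem_univ i)
    have hins : ∀ z : univ.pi L, (insert j s).piecewise z.1 w =
        s.piecewise z.1 (Function.update w j (z.1 j)) := by
      intro z
      funext i
      by_cases hij : i = j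
      · subst hij; simp [hj]
      · by_cases hi : i ∈ s <;> simp [hi, hij]
    have hcont : ContinuousOn h (univ.pi V) := hh.continuousOn
    have hpc : Continuous fun p : ℂ × univ.pi L =>
        s.piecewise p.2.1 (Function.update w j p.1) := by
      refine continuous_pi fun i => ?_
      by_cases hi : i ∈ s
      · simp only [Finset.piecewise_eq_of_mem _ _ _ hi]
        exact (continuous_apply i).comp (continuous_subtype_val.comp continuous_snd)
      · simp only [Finset.piecewise_eq_of_notMem _ _ _ hi]
        fun_prop
    set k : ℂ × univ.pi L → ℂ := fun p =>
      dbar χ p.1 * h (s.piecewise p.2.1 (Function.update w j p.1)) / (p.1 - p.2.1 j) with hk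
    have hkc : Continuous k := by
      refine continuous_cauchy_kernel (L := L j) (ℓ := fun z : univ.pi L => z.1 j)
        (H := fun p => h (s.piecewise p.2.1 (Function.update w j p.1))) hχ hχV hO hLO hO1 ?_
        ((continuous_apply j).comp continuous_subtype_val) fun z => z.2 j (mem_univ j)
      intro u hu z
      exact ContinuousAt.comp (f := fun p : ℂ × univ.pi L =>
        s.piecewise p.2.1 (Function.update w j p.1)) (g := h) (x := (u, z))
        (hcont.continuousAt (hVo.mem_nhds (hmem z u hu))) hpc.continuousAt
    have hkS : ∀ u, ∃ F ∈ Subalgebra.toSubmodule (polyAlgebra (univ.pi L)),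
        ∀ z, F z = k (u, z) := by
      intro u
      by_cases hu : dbar χ u = 0
      · exact ⟨0, zero_mem _, fun z => by simp [hk, hu]⟩
      · have huV : u ∈ V j := by
          by_contra hcon
          exact hu (dbar_eq_zero_of_notMem_tsupport fun h' => hcon (hχV h'))
        have huL : u ∉ L j := fun h' => hu <| dbar_eq_zero_of_eventuallyEq_one <| by
          filter_upwards [hO.mem_nhds (hLO h')] with v hv using hO1 v hv
        obtain ⟨r, hr, hr'⟩ := exists_pole_mem_polyAlgebra (hLconn j) huL
        obtain ⟨F, hF, hF'⟩ := ih (Function.update w j u) (by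
          intro i _
          by_cases hij : i = j
          · subst hij; simpa using huV
          · simpa [hij] using hw i (mem_univ i))
        refine ⟨dbar χ u • (F * r), Subalgebra.smul_mem _ (Subalgebra.mul_mem _ hF hr) _,
          fun z => ?_⟩
        simp [hk, hF', hr', div_eq_mul_inv, mul_assoc]
    obtain ⟨F, hF, hF'⟩ := exists_mem_eq_integral
      (S := Subalgebra.toSubmodule (polyAlgebra (univ.pi L)))
      (Subalgebra.isClosed_topologicalClosure _) hkc hkS A
    refine ⟨(-(2 * Real.pi * Complex.I))⁻¹ • F, Subalgebra.smul_mem _ hF _, fun z => ?_⟩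
    have hc0 : -(2 * Real.pi * Complex.I) ≠ 0 := neg_ne_zero.2 Complex.two_pi_I_ne_zero
    have hzL : z.1 j ∈ L j := z.2 j (mem_univ j)
    rw [hins z, ContinuousMap.smul_apply, hF' z, smul_eq_mul, inv_mul_eq_iff_eq_mul₀ hc0]
    have hdiff : DifferentiableOn ℂ (fun u => h (s.piecewise z.1 (Function.update w j u)))
        (V j) := by
      refine hh.comp (f := fun u => s.piecewise z.1 (Function.update w j u)) ?_
        fun u hu => hmem z u hu
      refine Differentiable.differentiableOn (differentiable_pi.2 fun i => ?_)
      by_cases hi : i ∈ s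
      · simp [hi]
      · by_cases hij : i = j
        · subst hij; simp [hi]
        · simp [hi, hij]
    have hone : χ =ᶠ[𝓝 (z.1 j)] fun _ => 1 := by
      filter_upwards [hO.mem_nhds (hLO hzL)] with v hv using hO1 v hv
    have key := cauchy_pompeiu (z := z.1 j) (A := A) (hV j) hχ hχV hdiff hone
      fun u hu => by simpa using hA hu
    exact key

theorem exists_pi_thickening_subset {K : Fin d → Set ℂ} (hK : ∀ i, IsCompact (K i))
    {U : Set (Fin d → ℂ)} (hU : IsOpen U) (hKU : univ.pi K ⊆ U) :
    ∃ V : Fin d → Set ℂ, (∀ i, IsOpen (V i)) ∧ (∀ i, K i ⊆ V i) ∧ univ.pi V ⊆ U := by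
  obtain ⟨δ, hδ, hsub⟩ := (isCompact_univ_pi hK).exists_thickening_subset_open hU hKU
  refine ⟨fun i => Metric.thickening δ (K i), fun i => Metric.isOpen_thickening,
    fun i => Metric.self_subset_thickening hδ _, fun z hz => hsub ?_⟩
  have : ∀ i, ∃ k ∈ K i, dist (z i) k < δ := fun i => Metric.mem_thickening_iff.1 (hz i (mem_univ i))
  choose k hk hzk using this
  exact Metric.mem_thickening_iff.2 ⟨k, fun i _ => hk i, (dist_pi_lt_iff hδ).2 hzk⟩

/-- **Runge's theorem** for products of plane compact sets with connected complements. The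
approximation is uniform on a neighbourhood `W`, so that derivatives converge as well. -/
theorem runge_pi {K : Fin d → Set ℂ} (hK : ∀ i, IsCompact (K i))
    (hKc : ∀ i, IsPreconnected (K i)ᶜ) {U : Set (Fin d → ℂ)} (hU : IsOpen U)
    (hKU : univ.pi K ⊆ U) {h : (Fin d → ℂ) → ℂ} (hh : DifferentiableOn ℂ h U) :
    ∃ W : Set (Fin d → ℂ), IsOpen W ∧ univ.pi K ⊆ W ∧ W ⊆ U ∧
      ∀ ε > 0, ∃ p : MvPolynomial (Fin d) ℂ, ∀ z ∈ W, ‖MvPolynomial.eval z p - h z‖ < ε := by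
  obtain ⟨V, hV, hKV, hVU⟩ := exists_pi_thickening_subset hK hU hKU
  choose L hLc hKL hLV hLconn using fun i =>
    exists_compact_nhds_isPreconnected_compl (hK i) (hKc i) (hV i) (hKV i)
  have hcs : CompactSpace (univ.pi L) := isCompact_iff_compactSpace.1 (isCompact_univ_pi hLc)
  refine ⟨univ.pi fun i => interior (L i), isOpen_set_pi finite_univ fun i _ => isOpen_interior,
    pi_mono fun i _ => hKL i, (pi_mono fun i _ => interior_subset.trans (hLV i)).trans hVU,
    fun ε hε => ?_⟩
  by_cases hne : (univ.pi V).Nonempty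
  · obtain ⟨w, hw⟩ := hne
    obtain ⟨F, hF, hF'⟩ := exists_mem_polyAlgebra_eq hLc hLconn hV hLV (hh.mono hVU)
      Finset.univ w hw
    obtain ⟨_, ⟨p, rfl⟩, hp⟩ := Metric.mem_closure_iff.1 hF ε hε
    refine ⟨p, fun z hz => ?_⟩
    have hzL : z ∈ univ.pi L := fun i _ => interior_subset (hz i (mem_univ i))
    have h1 := (ContinuousMap.dist_apply_le_dist (⟨z, hzL⟩ : univ.pi L)).trans_lt hp
    rw [dist_comm, dist_eq_norm, hF', Finset.piecewise_univ] at h1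
    exact (aeval_coordMap_apply p ⟨z, hzL⟩) ▸ h1
  · exact ⟨0, fun z hz => (hne ⟨z, fun i _ => hLV i (interior_subset (hz i (mem_univ i)))⟩).elim⟩

end

/-! ### The theorems of Weierstrass and Osgood -/

section

variable {d : ℕ} {U : Set (Fin d → ℂ)}

/-- The Cauchy estimate for partial derivatives. -/
theorem norm_partialDeriv_sub_le {F f : (Fin d → ℂ) → ℂ} (hF : AnalyticOnNhd ℂ F U)
    (hf : AnalyticOnNhd ℂ f U) {z : Fin d → ℂ} {r C : ℝ} (hr : 0 < r)
    (hz : Metric.closedBall z r ⊆ U) (hC : ∀ y ∈ Metric.closedBall z r, ‖F y - f y‖ ≤ C)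
    (i : Fin d) : ‖partialDeriv i F z - partialDeriv i f z‖ ≤ C / r := by
  set γ : ℂ → (Fin d → ℂ) := fun t => z + t • Pi.single i 1 with hγ
  have hγd : Differentiable ℂ γ := by fun_prop
  have hγm : ∀ t ∈ Metric.closedBall (0 : ℂ) r, γ t ∈ Metric.closedBall z r := by
    intro t ht
    rw [Metric.mem_closedBall, dist_zero_right] at ht
    rw [Metric.mem_closedBall, hγ, dist_eq_norm, add_sub_cancel_left, norm_smul, Pi.norm_single,
      norm_one, mul_one]
    exact ht
  have hd : ∀ G : (Fin d → ℂ) → ℂ, AnalyticOnNhd ℂ G U → ∀ t ∈ Metric.closedBall (0 : ℂ) r,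
      DifferentiableAt ℂ (fun t => G (γ t)) t := fun G hG t ht =>
    (hG _ (hz (hγm t ht))).differentiableAt.comp t (hγd t)
  have h0 : (0 : ℂ) ∈ Metric.closedBall (0 : ℂ) r := by simp [hr.le]
  have heq : partialDeriv i F z - partialDeriv i f z = deriv (fun t => F (γ t) - f (γ t)) 0 :=
    (deriv_fun_sub (hd F hF 0 h0) (hd f hf 0 h0)).symm
  rw [heq]
  refine Complex.norm_deriv_le_of_forall_mem_sphere_norm_le hr ?_ fun t ht =>
    hC _ (hγm t (Metric.sphere_subset_closedBall ht))
  refine DifferentiableOn.diffContOnCl_ball (U := Metric.closedBall (0 : ℂ) r) (fun t ht => ?_)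
    Subset.rfl
  exact ((hd F hF t ht).sub (hd f hf t ht)).differentiableWithinAt

theorem tendstoLocallyUniformlyOn_partialDeriv (hU : IsOpen U) {ι : Type*} {l : Filter ι}
    {F : ι → (Fin d → ℂ) → ℂ} {f : (Fin d → ℂ) → ℂ} (hF : ∀ n, AnalyticOnNhd ℂ (F n) U)
    (hf : AnalyticOnNhd ℂ f U) (h : TendstoLocallyUniformlyOn F f l U) (i : Fin d) :
    TendstoLocallyUniformlyOn (fun n => partialDeriv i (F n)) (partialDeriv i f) l U := by
  rw [Metric.tendstoLocallyUniformlyOn_iff]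
  intro ε hε z hz
  obtain ⟨r, hr, hball⟩ := Metric.nhds_basis_closedBall.mem_iff.1 (hU.mem_nhds hz)
  have hunif := (tendstoLocallyUniformlyOn_iff_forall_isCompact hU).1 h _ hball
    (isCompact_closedBall z r)
  have hr2 : 0 < r / 2 := half_pos hr
  refine ⟨Metric.closedBall z (r / 2),
    mem_nhdsWithin_of_mem_nhds (Metric.closedBall_mem_nhds z hr2), ?_⟩
  filter_upwards [Metric.tendstoUniformlyOn_iff.1 hunif (ε / 2 * (r / 2)) (by positivity)]
    with n hn y hy
  have hsub : Metric.closedBall y (r / 2) ⊆ Metric.closedBall z r := by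
    refine Metric.closedBall_subset_closedBall' ?_
    have := Metric.mem_closedBall.1 hy
    linarith
  have := norm_partialDeriv_sub_le hf (hF n) hr2 (hsub.trans hball)
    (C := ε / 2 * (r / 2)) (fun x hx => by
      have := hn x (hsub hx)
      rw [dist_eq_norm] at this
      exact this.le) i
  rw [dist_eq_norm]
  rw [mul_div_assoc, div_self hr2.ne', mul_one] at this
  linarith

/-- **Weierstrass' theorem**: mixed partial derivatives are continuous for locally uniform
convergence of holomorphic functions. -/
theorem tendstoLocallyUniformlyOn_mixedPartial (hU : IsOpen U) {ι : Type*} {l : Filter ι}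
    {F : ι → (Fin d → ℂ) → ℂ} {f : (Fin d → ℂ) → ℂ} (hF : ∀ n, AnalyticOnNhd ℂ (F n) U)
    (hf : AnalyticOnNhd ℂ f U) (h : TendstoLocallyUniformlyOn F f l U) (a : Fin d → ℕ) :
    TendstoLocallyUniformlyOn (fun n => mixedPartial a (F n)) (mixedPartial a f) l U := by
  have hiter : ∀ (i : Fin d) (k : ℕ) (F : ι → (Fin d → ℂ) → ℂ) (f : (Fin d → ℂ) → ℂ),
      (∀ n, AnalyticOnNhd ℂ (F n) U) → AnalyticOnNhd ℂ f U → TendstoLocallyUniformlyOn F f l U →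
      TendstoLocallyUniformlyOn (fun n => (partialDeriv i)^[k] (F n)) ((partialDeriv i)^[k] f) l U := by
    intro i k
    induction k with
    | zero => exact fun F f _ _ h => h
    | succ k ih =>
      intro F f hF hf h
      exact ih _ _ (fun n => partialDeriv_analytic (hF n) i) (partialDeriv_analytic hf i)
        (tendstoLocallyUniformlyOn_partialDeriv hU hF hf h i)
  have main : ∀ L : List (Fin d),
      (∀ n, AnalyticOnNhd ℂ (L.foldr (fun i G => (partialDeriv i)^[a i] G) (F n)) U) ∧
      AnalyticOnNhd ℂ (L.foldr (fun i G => (partialDeriv i)^[a i] G) f) U ∧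
      TendstoLocallyUniformlyOn (fun n => L.foldr (fun i G => (partialDeriv i)^[a i] G) (F n))
        (L.foldr (fun i G => (partialDeriv i)^[a i] G) f) l U := by
    intro L
    induction L with
    | nil => exact ⟨hF, hf, h⟩
    | cons i L ih =>
      obtain ⟨h1, h2, h3⟩ := ih
      simp only [List.foldr_cons]
      exact ⟨fun n => (partialDeriv_iterate_aux hU i (a i)).1 _ (h1 n),
        (partialDeriv_iterate_aux hU i (a i)).1 _ h2, hiter i (a i) _ _ h1 h2 h3⟩
  exact (main _).2.2

section Osgood

/-- The torus of points whose coordinates all have distance `r` to those of `c`. -/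
def torus (c : Fin d → ℂ) (r : ℝ) : Set (Fin d → ℂ) :=
  univ.pi fun i => Metric.sphere (c i) r

instance (c : Fin d → ℂ) (r : ℝ) : CompactSpace (torus c r) :=
  isCompact_iff_compactSpace.1 (isCompact_univ_pi fun i => isCompact_sphere (c i) r)

theorem update_circleMap_mem_torus {c : Fin d → ℂ} {r : ℝ} (hr : 0 ≤ r) (i : Fin d)
    {w : Fin d → ℂ} (hw : w ∈ torus c r) (θ : ℝ) :
    Function.update w i (circleMap (c i) r θ) ∈ torus c r := by
  intro j _
  by_cases hj : j = i
  · subst hj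
    simpa using circleMap_mem_sphere (c j) hr θ
  · simpa [hj] using hw j (mem_univ j)

theorem continuous_update_circleMap {c : Fin d → ℂ} {r : ℝ} (hr : 0 ≤ r) (i : Fin d) :
    Continuous fun p : torus c r × ℝ =>
      (⟨Function.update p.1.1 i (circleMap (c i) r p.2),
        update_circleMap_mem_torus hr i p.1.2 p.2⟩ : torus c r) := by
  refine Continuous.subtype_mk ?_ _
  refine Continuous.update (continuous_subtype_val.comp continuous_fst) i ?_
  exact (continuous_circleMap _ _).comp continuous_snd

/-- The contour integral of a continuous function on a torus over the circle in the `i`-th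
coordinate, as a bounded operator; the result does not depend on that coordinate. -/
def torusAverage (c : Fin d → ℂ) {r : ℝ} (hr : 0 ≤ r) (i : Fin d) :
    C(torus c r, ℂ) →L[ℂ] C(torus c r, ℂ) :=
  LinearMap.mkContinuous
    { toFun := fun g =>
        ⟨fun w => ∫ θ in (0 : ℝ)..2 * Real.pi, deriv (circleMap (c i) r) θ *
          g ⟨Function.update w.1 i (circleMap (c i) r θ),
            update_circleMap_mem_torus hr i w.2 θ⟩, by
          refine intervalIntegral.continuous_parametric_intervalIntegral_of_continuous' ?_ _ _
          have h1 : Continuous fun θ => deriv (circleMap (c i) r) θ := by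
            simp only [deriv_circleMap]
            fun_prop
          exact (h1.comp continuous_snd).mul (g.continuous.comp (continuous_update_circleMap hr i))⟩
      map_add' := fun g g' => by
        ext w
        have h1 : Continuous fun θ => deriv (circleMap (c i) r) θ := by
          simp only [deriv_circleMap]
          fun_prop
        have h2 : ∀ g : C(torus c r, ℂ), Continuous fun θ => g ⟨Function.update w.1 i
            (circleMap (c i) r θ), update_circleMap_mem_torus hr i w.2 θ⟩ := fun g =>
          g.continuous.comp ((continuous_update_circleMap hr i).comp
            (continuous_const.prodMk continuous_id : Continuous fun θ : ℝ => (w, θ)))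
        simp only [ContinuousMap.coe_mk, ContinuousMap.add_apply, mul_add]
        exact intervalIntegral.integral_add ((h1.mul (h2 g)).intervalIntegrable _ _)
          ((h1.mul (h2 g')).intervalIntegrable _ _)
      map_smul' := fun a g => by
        ext w
        simp only [ContinuousMap.coe_mk, ContinuousMap.smul_apply, smul_eq_mul, RingHom.id_apply,
          ← intervalIntegral.integral_const_mul]
        exact intervalIntegral.integral_congr fun θ _ => by ring }
    (r * (2 * Real.pi)) fun g => by
      refine (ContinuousMap.norm_le _ (by positivity)).2 fun w => ?_
      refine (intervalIntegral.norm_integral_le_of_norm_le_const (C := r * ‖g‖) ?_).trans ?_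
      · intro θ _
        rw [norm_mul]
        refine mul_le_mul ?_ (g.norm_coe_le_norm _) (norm_nonneg _) hr
        simp [deriv_circleMap, abs_of_nonneg hr]
      · rw [sub_zero, abs_of_nonneg Real.two_pi_pos.le]
        exact le_of_eq (by ring)

theorem torusAverage_apply (c : Fin d → ℂ) {r : ℝ} (hr : 0 ≤ r) (i : Fin d) (g : C(torus c r, ℂ))
    (w : torus c r) {G : ℂ → ℂ}
    (hG : ∀ u, ∀ hu : Function.update w.1 i u ∈ torus c r, u ∈ Metric.sphere (c i) r →
      g ⟨Function.update w.1 i u, hu⟩ = G u) :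
    torusAverage c hr i g w = ∮ u in C(c i, r), G u := by
  refine intervalIntegral.integral_congr fun θ _ => ?_
  simp only [smul_eq_mul]
  rw [hG _ _ (circleMap_mem_sphere _ hr θ)]

/-- The Cauchy kernel in the `i`-th coordinate depends holomorphically on the pole, as an element
of the Banach algebra of continuous functions on the torus. -/
theorem exists_analytic_cauchy_kernel (c : Fin d → ℂ) (r : ℝ) (i : Fin d) :
    ∃ k : (Fin d → ℂ) → C(torus c r, ℂ), AnalyticOnNhd ℂ k (Metric.ball c r) ∧
      ∀ z ∈ Metric.ball c r, ∀ w : torus c r, k z w = (w.1 i - z i)⁻¹ := by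
  set D : (Fin d → ℂ) → C(torus c r, ℂ) := fun z => coordMap _ i - algebraMap ℂ _ (z i) with hD
  have hne : ∀ z ∈ Metric.ball c r, ∀ w : torus c r, w.1 i - z i ≠ 0 := by
    intro z hz w h
    have h1 := w.2 i (mem_univ i)
    have h2 := (dist_le_pi_dist z c i).trans_lt hz
    rw [← sub_eq_zero.1 h, Metric.mem_sphere.1 h1] at h2
    exact lt_irrefl _ h2
  have hunit : ∀ z ∈ Metric.ball c r, IsUnit (D z) := fun z hz =>
    (ContinuousMap.isUnit_iff_forall_ne_zero _).2 (hne z hz)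
  refine ⟨fun z => Ring.inverse (D z), fun z hz => ?_, fun z hz w => ?_⟩
  · obtain ⟨u, hu⟩ := hunit z hz
    have h1 : AnalyticAt ℂ D z := by
      have h2 : AnalyticAt ℂ (fun z : Fin d → ℂ =>
          ((Algebra.linearMap ℂ C(torus c r, ℂ)).toContinuousLinearMap.comp
            (ContinuousLinearMap.proj (R := ℂ) i)) z) z := ContinuousLinearMap.analyticAt _ _
      exact analyticAt_const.sub h2
    have h3 := analyticAt_inverse (𝕜 := ℂ) u
    rw [hu] at h3
    exact h3.comp h1
  · have h1 := Ring.mul_inverse_cancel _ (hunit z hz)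
    have h2 : (D z * Ring.inverse (D z)) w = 1 := by rw [h1]; rfl
    exact eq_inv_of_mul_eq_one_right h2

theorem analyticAt_clm_apply {E F G : Type*} [NormedAddCommGroup E] [NormedSpace ℂ E]
    [NormedAddCommGroup F] [NormedSpace ℂ F] [NormedAddCommGroup G] [NormedSpace ℂ G]
    (T : F →L[ℂ] G) {f : E → F} {z : E} (hf : AnalyticAt ℂ f z) :
    AnalyticAt ℂ (fun z => T (f z)) z :=
  (T.analyticAt _).comp hf

/-- **Osgood's lemma**: a continuous separately holomorphic function is holomorphic. Iterating
Cauchy's formula expresses it through bounded operators applied to the Cauchy kernels, which are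
analytic maps into the Banach algebra of continuous functions on a torus. -/
theorem analyticOnNhd_of_separately {f : (Fin d → ℂ) → ℂ} (hU : IsOpen U) (hc : ContinuousOn f U)
    (hs : ∀ z ∈ U, ∀ i, DifferentiableAt ℂ (fun t => f (Function.update z i t)) (z i)) :
    AnalyticOnNhd ℂ f U := by
  classical
  intro c hcU
  obtain ⟨r, hr, hball⟩ := Metric.nhds_basis_closedBall.mem_iff.1 (hU.mem_nhds hcU)
  have hmem : ∀ z : Fin d → ℂ, (∀ i, z i ∈ Metric.closedBall (c i) r) → z ∈ U := fun z hz =>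
    hball ((dist_pi_le_iff hr.le).2 hz)
  have hzm : ∀ z ∈ Metric.ball c r, ∀ i, z i ∈ Metric.closedBall (c i) r := fun z hz i =>
    ((dist_le_pi_dist z c i).trans_lt hz).le
  have hwm : ∀ w ∈ torus c r, ∀ i, w i ∈ Metric.closedBall (c i) r := fun w hw i =>
    Metric.sphere_subset_closedBall (hw i (mem_univ i))
  -- Replace the variables one after the other, starting from a point of the torus.
  have key : ∀ s : Finset (Fin d), ∃ A : (Fin d → ℂ) → C(torus c r, ℂ),
      AnalyticOnNhd ℂ A (Metric.ball c r) ∧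
      ∀ z ∈ Metric.ball c r, ∀ w : torus c r, A z w = f (s.piecewise z w.1) := by
    intro s
    induction s using Finset.induction_on with
    | empty =>
      set g : C(torus c r, ℂ) := ⟨fun w => f w.1,
        hc.comp_continuous continuous_subtype_val fun w => hmem _ (hwm _ w.2)⟩ with hg
      exact ⟨fun _ => g, analyticOnNhd_const, fun z _ w => by simp [hg]⟩
    | insert i s hi ih =>
      obtain ⟨A, hA, hA'⟩ := ih
      obtain ⟨k, hk, hk'⟩ := exists_analytic_cauchy_kernel c r i
      refine ⟨fun z => (2 * Real.pi * Complex.I : ℂ)⁻¹ • torusAverage c hr.le i (A z * k z),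
        ?_, ?_⟩
      · intro z hz
        have h1 : AnalyticAt ℂ (fun z => A z * k z) z := (hA z hz).mul (hk z hz)
        exact analyticAt_clm_apply ((2 * Real.pi * Complex.I : ℂ)⁻¹ • torusAverage c hr.le i) h1
      · intro z hz w
        have hins : (insert i s).piecewise z w.1 = s.piecewise z (Function.update w.1 i (z i)) := by
          funext j
          by_cases hij : j = i
          · subst hij; simp [hi]
          · by_cases hj : j ∈ s <;> simp [hj, hij]
        have hm : ∀ u ∈ Metric.closedBall (c i) r, ∀ j,
            s.piecewise z (Function.update w.1 i u) j ∈ Metric.closedBall (c j) r := by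
          intro u hu j
          by_cases hj : j ∈ s
          · simpa [hj] using hzm z hz j
          · by_cases hij : j = i
            · subst hij; simpa [hj] using hu
            · simpa [hj, hij] using hwm _ w.2 j
        have hupd : ∀ u t, s.piecewise z (Function.update w.1 i t) =
            Function.update (s.piecewise z (Function.update w.1 i u)) i t := by
          intro u t
          funext j
          by_cases hij : j = i
          · subst hij; simp [hi]
          · by_cases hj : j ∈ s <;> simp [hj, hij]
        have hd : DifferentiableOn ℂ (fun t => f (s.piecewise z (Function.update w.1 i t)))
            (Metric.closedBall (c i) r) := by
          intro u hu
          have h1 := hs _ (hmem _ (hm u hu)) i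
          simp only [← hupd] at h1
          simp only [Finset.piecewise_eq_of_notMem _ _ _ hi, Function.update_self] at h1
          exact h1.differentiableWithinAt
        rw [ContinuousMap.smul_apply, torusAverage_apply c hr.le i _ w
          (G := fun u => (u - z i)⁻¹ • f (s.piecewise z (Function.update w.1 i u))),
          (hd.diffContOnCl_ball Subset.rfl).circleIntegral_sub_inv_smul
            ((dist_le_pi_dist z c i).trans_lt hz), hins, smul_eq_mul, smul_eq_mul,
          inv_mul_cancel_left₀ Complex.two_pi_I_ne_zero]
        intro u hu _
        rw [ContinuousMap.mul_apply, hA' z hz, hk' z hz, smul_eq_mul, mul_comm]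
        simp
  obtain ⟨A, hA, hA'⟩ := key Finset.univ
  have hw : (fun i => c i + r) ∈ torus c r := fun i _ => by simp [abs_of_pos hr]
  have h1 : AnalyticAt ℂ (fun z => A z ⟨_, hw⟩) c :=
    analyticAt_clm_apply (ContinuousMap.evalCLM ℂ (⟨_, hw⟩ : torus c r))
      (hA c (Metric.mem_ball_self hr))
  refine h1.congr ?_
  filter_upwards [Metric.ball_mem_nhds c hr] with z hz
  rw [hA' z hz, Finset.piecewise_univ]

end Osgood

/-- A locally uniform limit of holomorphic functions of several variables is holomorphic. -/
theorem analyticOnNhd_of_tendstoLocallyUniformlyOn (hU : IsOpen U) {ι : Type*} {l : Filter ι}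
    [l.NeBot] {F : ι → (Fin d → ℂ) → ℂ} {f : (Fin d → ℂ) → ℂ}
    (hF : ∀ n, AnalyticOnNhd ℂ (F n) U) (h : TendstoLocallyUniformlyOn F f l U) :
    AnalyticOnNhd ℂ f U := by
  refine analyticOnNhd_of_separately hU
    (h.continuousOn (Eventually.frequently (Eventually.of_forall fun n => (hF n).continuousOn)))
    fun z hz i => ?_
  have hupd : Continuous fun t : ℂ => Function.update z i t := by fun_prop
  set V : Set ℂ := (fun t => Function.update z i t) ⁻¹' U with hVdef
  have hV : IsOpen V := hU.preimage hupd
  have hzV : z i ∈ V := by simpa [hVdef] using hz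
  have h1 : TendstoLocallyUniformlyOn (fun n t => F n (Function.update z i t))
      (fun t => f (Function.update z i t)) l V :=
    h.comp (fun t => Function.update z i t) (fun t ht => ht) hupd.continuousOn
  refine (h1.differentiableOn (Eventually.of_forall fun n t ht => ?_) hV).differentiableAt
    (hV.mem_nhds hzV)
  have h2 : DifferentiableAt ℂ (fun t : ℂ => Function.update z i t) t :=
    (hasDerivAt_update z i t).differentiableAt
  exact ((hF n _ ht).differentiableAt.comp t h2).differentiableWithinAt

end

/-! ### Derivatives and Taylor sums of polynomials -/

section

variable {d : ℕ}

theorem partialDeriv_eval (p : MvPolynomial (Fin d) ℂ) (i : Fin d) :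
    partialDeriv i (fun z => MvPolynomial.eval z p) =
      fun z => MvPolynomial.eval z (MvPolynomial.pderiv i p) := by
  funext z
  refine HasDerivAt.deriv (f := fun t : ℂ =>
    MvPolynomial.eval (z + t • (Pi.single i 1 : Fin d → ℂ)) p) ?_
  induction p using MvPolynomial.induction_on with
  | C a => simpa using hasDerivAt_const (0 : ℂ) a
  | add p q hp hq => simpa using hp.fun_add hq
  | mul_X p j hp =>
    have h1 : HasDerivAt (fun t : ℂ => (z + t • (Pi.single i 1 : Fin d → ℂ)) j)
        ((Pi.single i 1 : Fin d → ℂ) j) 0 := by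
      simpa using (((hasDerivAt_id (0 : ℂ)).mul_const ((Pi.single i 1 : Fin d → ℂ) j)).const_add (z j))
    have h2 := hp.mul h1
    simp only [zero_smul, add_zero] at h2
    simp only [map_mul, MvPolynomial.eval_X, Derivation.leibniz, MvPolynomial.pderiv_X,
      smul_eq_mul, map_add]
    refine h2.congr_deriv ?_
    by_cases hij : j = i
    · subst hij
      simp
      ring
    · simp [hij]
      ring

/-- The formal mixed partial derivative of a polynomial. -/
def mixedPDeriv (a : Fin d → ℕ) (p : MvPolynomial (Fin d) ℂ) : MvPolynomial (Fin d) ℂ :=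
  (List.finRange d).foldr (fun i q => (MvPolynomial.pderiv i)^[a i] q) p

theorem mixedPartial_eval (a : Fin d → ℕ) (p : MvPolynomial (Fin d) ℂ) :
    mixedPartial a (fun z => MvPolynomial.eval z p) =
      fun z => MvPolynomial.eval z (mixedPDeriv a p) := by
  unfold mixedPartial mixedPDeriv
  have hiter : ∀ (i : Fin d) (k : ℕ) (p : MvPolynomial (Fin d) ℂ),
      (partialDeriv i)^[k] (fun z => MvPolynomial.eval z p) =
        fun z => MvPolynomial.eval z ((MvPolynomial.pderiv i)^[k] p) := by
    intro i k
    induction k with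
    | zero => exact fun p => rfl
    | succ k ih =>
      intro p
      rw [Function.iterate_succ_apply, partialDeriv_eval, ih, Function.iterate_succ_apply]
  induction List.finRange d with
  | nil => rfl
  | cons i l ih => rw [List.foldr_cons, ih, hiter, List.foldr_cons]

/-- The constant term of `D_a p` is `a!` times the coefficient of `p` at `a`. -/
theorem coeff_mixedPDeriv_zero (a : Fin d → ℕ) (p : MvPolynomial (Fin d) ℂ) :
    MvPolynomial.coeff 0 (mixedPDeriv a p) =
      (∏ i, ((a i).factorial : ℂ)) * MvPolynomial.coeff (Finsupp.equivFunOnFinite.symm a) p := by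
  have hiter : ∀ (i : Fin d) (k : ℕ) (p : MvPolynomial (Fin d) ℂ) (m : Fin d →₀ ℕ),
      MvPolynomial.coeff m ((MvPolynomial.pderiv i)^[k] p) =
        ((m i + 1).ascFactorial k : ℂ) * MvPolynomial.coeff (m + Finsupp.single i k) p := by
    intro i k
    induction k with
    | zero => intro p m; simp
    | succ k ih =>
      intro p m
      rw [Function.iterate_succ_apply, ih, MvPolynomial.coeff_pderiv, add_assoc,
        ← Finsupp.single_add, Nat.ascFactorial_succ]
      simp
      ring
  have main : ∀ l : List (Fin d), l.Nodup → ∀ m : Fin d →₀ ℕ, (∀ i ∈ l, m i = 0) →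
      MvPolynomial.coeff m (l.foldr (fun i q => (MvPolynomial.pderiv i)^[a i] q) p) =
        ((l.map fun i => ((a i).factorial : ℂ)).prod) *
          MvPolynomial.coeff (m + (l.map fun i => Finsupp.single i (a i)).sum) p := by
    intro l
    induction l with
    | nil => intro _ m _; simp
    | cons i l ih =>
      intro hl m hm
      obtain ⟨hi, hl⟩ := List.nodup_cons.1 hl
      rw [List.foldr_cons, hiter, ih hl]
      · simp [hm i (by simp), Nat.one_ascFactorial, add_assoc, mul_assoc]
      · intro j hj
        have hij : i ≠ j := fun h => hi (h ▸ hj)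
        simp [hm j (by simp [hj]), hij]
  rw [mixedPDeriv, main _ (List.nodup_finRange d) 0 (by simp), zero_add,
    ← List.ofFn_eq_map, ← List.ofFn_eq_map, List.prod_ofFn, List.sum_ofFn]
  congr 2
  ext j
  simp [Finsupp.finsetSum_apply, Finsupp.single_apply]

theorem mixedPartial_comp_add (a : Fin d → ℕ) (F : (Fin d → ℂ) → ℂ) (ζ : Fin d → ℂ) :
    mixedPartial a (fun z => F (z + ζ)) = fun z => mixedPartial a F (z + ζ) := by
  have h1 : ∀ (i : Fin d) (F : (Fin d → ℂ) → ℂ),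
      partialDeriv i (fun z => F (z + ζ)) = fun z => partialDeriv i F (z + ζ) := by
    intro i F
    funext z
    simp only [partialDeriv, lineDeriv, add_right_comm]
  have hiter : ∀ (i : Fin d) (k : ℕ) (F : (Fin d → ℂ) → ℂ),
      (partialDeriv i)^[k] (fun z => F (z + ζ)) = fun z => (partialDeriv i)^[k] F (z + ζ) := by
    intro i k
    induction k with
    | zero => exact fun F => rfl
    | succ k ih =>
      intro F
      rw [Function.iterate_succ_apply, h1, ih, Function.iterate_succ_apply]
  unfold mixedPartial
  induction List.finRange d with
  | nil => rfl
  | cons i l ih => rw [List.foldr_cons, ih, hiter, List.foldr_cons]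

variable {Ω : Fin d → Opens ℂ} {S : Fin d → Set ℂ}

theorem mixedPartial_zeroExt_ofPoly (p : MvPolynomial (Fin d) ℂ) (a : Fin d → ℕ) :
    EqOn (mixedPartial a (zeroExt (AInfty.ofPoly Ω S p).toFun))
      (fun z => MvPolynomial.eval z (mixedPDeriv a p)) (prodDomain Ω) := by
  rw [← mixedPartial_eval]
  refine (mixedPartial_aux (isOpen_prodDomain Ω) a).2.1 _ _ fun z hz => ?_
  exact zeroExt_eq (AInfty.ofPoly Ω S p).toFun ⟨z, hz⟩

/-- The partial sums of the Taylor series of a polynomial are eventually equal to it. -/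
theorem eventually_taylorSum_ofPoly (N : ℕ ≃ (Fin d → ℕ)) (ζ : prodDomain Ω)
    (p : MvPolynomial (Fin d) ℂ) :
    ∀ᶠ n in atTop, taylorSum N (AInfty.ofPoly Ω S p).toFun ζ n = p := by
  -- The Taylor coefficients of `p` at `ζ` are the coefficients of the translate `q` of `p`.
  set q : MvPolynomial (Fin d) ℂ :=
    MvPolynomial.bind₁ (fun i => MvPolynomial.X i + MvPolynomial.C (ζ.1 i)) p with hq
  have hqp : ∀ y, MvPolynomial.eval y q = MvPolynomial.eval (y + ζ.1) p := by
    intro y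
    rw [hq]
    clear hq q
    induction p using MvPolynomial.induction_on with
    | C a => simp
    | add p q hp hq => simp [hp, hq]
    | mul_X p i hp => simp [hp]
  have hcoeff : ∀ α : Fin d → ℕ, taylorCoeff (AInfty.ofPoly Ω S p).toFun ζ α =
      MvPolynomial.coeff (Finsupp.equivFunOnFinite.symm α) q := by
    intro α
    have h0 : (∏ i, ((α i).factorial : ℂ)) ≠ 0 :=
      Finset.prod_ne_zero_iff.2 fun i _ => by exact_mod_cast (α i).factorial_ne_zero
    have h1 : mixedPartial α (fun z => MvPolynomial.eval z p) ζ.1 =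
        mixedPartial α (fun y => MvPolynomial.eval y q) 0 := by
      have h2 : (fun y => MvPolynomial.eval y q) = fun y => MvPolynomial.eval (y + ζ.1) p :=
        funext hqp
      rw [h2, mixedPartial_comp_add α (fun z => MvPolynomial.eval z p)]
      simp only [zero_add]
    rw [taylorCoeff, mixedPartial_zeroExt_ofPoly p α ζ.2, ← mixedPartial_eval, h1,
      mixedPartial_eval, inv_mul_eq_iff_eq_mul₀ h0, ← coeff_mixedPDeriv_zero]
    simp only [MvPolynomial.eval_zero, MvPolynomial.constantCoeff_eq]
  obtain ⟨n₀, hn₀⟩ : ∃ n₀, ∀ s ∈ q.support, N.symm (Finsupp.equivFunOnFinite s) < n₀ := by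
    obtain ⟨b, hb⟩ := (q.support.image fun s => N.symm (Finsupp.equivFunOnFinite s)).bddAbove
    exact ⟨b + 1, fun s hs => Nat.lt_succ_of_le (hb (Finset.mem_image_of_mem _ hs))⟩
  filter_upwards [eventually_ge_atTop n₀] with n hn
  refine MvPolynomial.funext fun z => ?_
  have h1 : MvPolynomial.eval z p = MvPolynomial.eval (z - ζ.1) q := by
    rw [hqp, sub_add_cancel]
  rw [h1, MvPolynomial.eval_eq' _ q, taylorSum, map_sum]
  symm
  refine Finset.sum_bij_ne_zero (fun s _ _ => N.symm (Finsupp.equivFunOnFinite s)) ?_ ?_ ?_ ?_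
  · intro s hs _
    exact Finset.mem_range.2 ((hn₀ s hs).trans_le (hn.trans n.le_succ))
  · intro s _ _ t _ _ hst
    exact Finsupp.equivFunOnFinite.injective (N.symm.injective hst)
  · intro j hj hne
    refine ⟨Finsupp.equivFunOnFinite.symm (N j), ?_, ?_, by simp⟩
    · rw [MvPolynomial.mem_support_iff, ← hcoeff]
      intro h
      exact hne (by simp [h])
    · intro h
      refine hne (Eq.trans ?_ h)
      rw [hcoeff]
      simp
  · intro s hs _
    rw [hcoeff]
    simp

end

/-! ### Convergence in `A^∞(Ω, S)` -/

section

variable {d : ℕ} {Ω : Fin d → Opens ℂ} {S : Fin d → Set ℂ}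

theorem prodDomain_subset_partialClosure : prodDomain Ω ⊆ partialClosure Ω S :=
  pi_mono fun _ _ => subset_union_left

theorem subset_frontier
    (hS : ∀ i, ∃ O : Set ℂ, IsOpen O ∧ S i = frontier (Ω i : Set ℂ) ∩ O) (i : Fin d) :
    S i ⊆ frontier (Ω i : Set ℂ) := by
  obtain ⟨O, -, h⟩ := hS i
  exact h ▸ inter_subset_left

theorem partialClosure_subset_closure (hS : ∀ i, S i ⊆ frontier (Ω i : Set ℂ)) :
    partialClosure Ω S ⊆ closure (prodDomain Ω) := by
  rw [prodDomain, closure_pi_set]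
  exact pi_mono fun i _ => union_subset subset_closure ((hS i).trans frontier_subset_closure)

theorem mixedPartial_zero (F : (Fin d → ℂ) → ℂ) : mixedPartial 0 F = F := by
  unfold mixedPartial
  induction List.finRange d with
  | nil => rfl
  | cons i l _ => simp

theorem AInfty.analyticOnNhd (f : AInfty Ω S) : AnalyticOnNhd ℂ (zeroExt f.toFun) (prodDomain Ω) :=
  (Subtype.prop f : MemAInfty Ω S f.toFun).1

/-- Any continuous extension of `D_a f` is `extPartial`, as `∏ (Ω_i ∪ S_i)` lies in the closure
of `Ω`. -/
theorem AInfty.extPartial_eqOn (hS : ∀ i, S i ⊆ frontier (Ω i : Set ℂ)) (f : AInfty Ω S)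
    (a : Fin d → ℕ) {g : (Fin d → ℂ) → ℂ} (hg : ContinuousOn g (partialClosure Ω S))
    (hga : EqOn g (mixedPartial a (zeroExt f.toFun)) (prodDomain Ω)) :
    EqOn (f.extPartial a) g (partialClosure Ω S) := by
  intro z hz
  refine extendFrom_eq (partialClosure_subset_closure hS hz) ?_
  have h1 : Tendsto g (𝓝[prodDomain Ω] z) (𝓝 (g z)) :=
    (hg z hz).mono_left (nhdsWithin_mono _ prodDomain_subset_partialClosure)
  exact h1.congr' (eventually_nhdsWithin_of_forall fun w hw => hga hw)

theorem AInfty.continuousOn_extPartial (hS : ∀ i, S i ⊆ frontier (Ω i : Set ℂ)) (f : AInfty Ω S)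
    (a : Fin d → ℕ) : ContinuousOn (f.extPartial a) (partialClosure Ω S) := by
  obtain ⟨g, hg, hga⟩ := (Subtype.prop f : MemAInfty Ω S f.toFun).2 a
  exact hg.congr (f.extPartial_eqOn hS a hg hga)

theorem AInfty.extPartial_eqOn_prodDomain (hS : ∀ i, S i ⊆ frontier (Ω i : Set ℂ))
    (f : AInfty Ω S) (a : Fin d → ℕ) :
    EqOn (f.extPartial a) (mixedPartial a (zeroExt f.toFun)) (prodDomain Ω) := by
  obtain ⟨g, hg, hga⟩ := (Subtype.prop f : MemAInfty Ω S f.toFun).2 a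
  exact ((f.extPartial_eqOn hS a hg hga).mono prodDomain_subset_partialClosure).trans hga

theorem AInfty.extPartial_lin (hS : ∀ i, S i ⊆ frontier (Ω i : Set ℂ)) (c : ℂ) (f g : AInfty Ω S)
    (a : Fin d → ℕ) :
    EqOn ((c • f + g).extPartial a) (c • f.extPartial a + g.extPartial a)
      (partialClosure Ω S) := by
  refine AInfty.extPartial_eqOn hS _ a
    (((f.continuousOn_extPartial hS a).const_smul c).add (g.continuousOn_extPartial hS a)) ?_
  intro z hz
  obtain ⟨-, h2, h3⟩ := mixedPartial_aux (isOpen_prodDomain Ω) a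
  have h4 : EqOn (zeroExt (c • f + g).toFun) (c • zeroExt f.toFun + zeroExt g.toFun)
    (prodDomain Ω) := zeroExt_lin c f.toFun g.toFun
  rw [h2 _ _ h4 hz, h3 c _ _ f.analyticOnNhd g.analyticOnNhd hz]
  simp [f.extPartial_eqOn_prodDomain hS a hz, g.extPartial_eqOn_prodDomain hS a hz]

theorem AInfty.extPartial_ofPoly (hS : ∀ i, S i ⊆ frontier (Ω i : Set ℂ))
    (p : MvPolynomial (Fin d) ℂ) (a : Fin d → ℕ) :
    EqOn ((AInfty.ofPoly Ω S p).extPartial a) (fun z => MvPolynomial.eval z (mixedPDeriv a p))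
      (partialClosure Ω S) :=
  AInfty.extPartial_eqOn hS _ a (MvPolynomial.continuous_eval _).continuousOn
    (mixedPartial_zeroExt_ofPoly p a).symm

theorem AInfty.tendsto_nhds_iff {ι : Type*} {l : Filter ι} {u : ι → AInfty Ω S}
    {f : AInfty Ω S} :
    Tendsto u l (𝓝 f) ↔ ∀ a, ∀ L, IsCompact L → L ⊆ partialClosure Ω S →
      TendstoUniformlyOn (fun n => (u n).extPartial a) (f.extPartial a) l L := by
  have h : 𝓝 f = ⨅ a : Fin d → ℕ, Filter.comap
      (fun f : AInfty Ω S =>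
        UniformOnFun.ofFun {L : Set (Fin d → ℂ) | IsCompact L ∧ L ⊆ partialClosure Ω S}
        (f.extPartial a)) (𝓝 (UniformOnFun.ofFun _ (f.extPartial a))) := by
    rw [nhds_iInf]
    simp only [nhds_induced]
  rw [h, tendsto_iInf]
  refine forall_congr' fun a => ?_
  rw [tendsto_comap_iff, UniformOnFun.tendsto_iff_tendstoUniformlyOn]
  exact ⟨fun h L hL hLs => h L ⟨hL, hLs⟩, fun h L hL => h L hL.1 hL.2⟩

theorem AInfty.tendsto_ofPoly_iff (hS : ∀ i, S i ⊆ frontier (Ω i : Set ℂ)) {ι : Type*}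
    {l : Filter ι} {u : ι → MvPolynomial (Fin d) ℂ} {p : MvPolynomial (Fin d) ℂ} :
    Tendsto (fun n => AInfty.ofPoly Ω S (u n)) l (𝓝 (AInfty.ofPoly Ω S p)) ↔
      ∀ a, ∀ L, IsCompact L → L ⊆ partialClosure Ω S →
      TendstoUniformlyOn (fun n z => MvPolynomial.eval z (mixedPDeriv a (u n)))
        (fun z => MvPolynomial.eval z (mixedPDeriv a p)) l L := by
  rw [AInfty.tendsto_nhds_iff]
  refine forall_congr' fun a => forall_congr' fun L => forall_congr' fun _ =>
    forall_congr' fun hLs => ?_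
  constructor
  · intro h
    exact (h.congr (Eventually.of_forall fun n z hz =>
      AInfty.extPartial_ofPoly hS _ a (hLs hz))).congr_right
      fun z hz => AInfty.extPartial_ofPoly hS _ a (hLs hz)
  · intro h
    exact (h.congr (Eventually.of_forall fun n z hz =>
      (AInfty.extPartial_ofPoly hS _ a (hLs hz)).symm)).congr_right
      fun z hz => (AInfty.extPartial_ofPoly hS _ a (hLs hz)).symm

theorem AInfty.continuousAdd (hS : ∀ i, S i ⊆ frontier (Ω i : Set ℂ)) :
    ContinuousAdd (AInfty Ω S) := by
  refine ⟨continuous_iff_continuousAt.2 ?_⟩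
  rintro ⟨f, g⟩
  refine AInfty.tendsto_nhds_iff.2 fun a L hL hLs => ?_
  have h1 := AInfty.tendsto_nhds_iff.1 (continuous_fst.tendsto (f, g)) a L hL hLs
  have h2 := AInfty.tendsto_nhds_iff.1 (continuous_snd.tendsto (f, g)) a L hL hLs
  have h3 : ∀ f g : AInfty Ω S, EqOn ((f + g).extPartial a) (f.extPartial a + g.extPartial a) L := by
    intro f g z hz
    have := AInfty.extPartial_lin hS 1 f g a (hLs hz)
    simpa using this
  exact ((h1.add h2).congr (Eventually.of_forall fun n z hz => (h3 n.1 n.2 hz).symm)).congr_right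
    fun z hz => (h3 f g hz).symm

theorem AInfty.continuousConstSMul (hS : ∀ i, S i ⊆ frontier (Ω i : Set ℂ)) :
    ContinuousConstSMul ℂ (AInfty Ω S) := by
  refine ⟨fun c => continuous_iff_continuousAt.2 fun f => ?_⟩
  refine AInfty.tendsto_nhds_iff.2 fun a L hL hLs => ?_
  have h1 := AInfty.tendsto_nhds_iff.1 (continuous_id.tendsto f) a L hL hLs
  have h3 : ∀ f : AInfty Ω S, EqOn ((c • f).extPartial a) (fun z => c * f.extPartial a z) L := by
    intro f z hz
    have h0 : EqOn ((0 : AInfty Ω S).extPartial a) 0 (partialClosure Ω S) := by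
      intro w hw
      have := AInfty.extPartial_lin hS 1 (0 : AInfty Ω S) 0 a hw
      simpa using this
    have := AInfty.extPartial_lin hS c f 0 a (hLs hz)
    rw [add_zero] at this
    simp [this, h0 (hLs hz)]
  have h4 : TendstoUniformlyOn (fun (n : AInfty Ω S) z => c * n.extPartial a z)
      (fun z => c * f.extPartial a z) (𝓝 f) L :=
    (uniformContinuous_const_smul c).comp_tendstoUniformlyOn h1
  exact (h4.congr (Eventually.of_forall fun n z hz => (h3 n hz).symm)).congr_right
    fun z hz => (h3 f hz).symm

/-! ### Completeness of `A^∞(Ω, S)` -/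

theorem isLocallyClosed_union_of_frontier {U S O : Set ℂ} (hU : IsOpen U) (hO : IsOpen O)
    (hS : S = frontier U ∩ O) : IsLocallyClosed (U ∪ S) := by
  refine ⟨U ∪ O, closure U, hU.union hO, isClosed_closure, ?_⟩
  rw [hS, closure_eq_self_union_frontier]
  ext z
  simp only [mem_union, mem_inter_iff]
  tauto

theorem isLocallyClosed_partialClosure
    (hS : ∀ i, ∃ O : Set ℂ, IsOpen O ∧ S i = frontier (Ω i : Set ℂ) ∩ O) :
    IsLocallyClosed (partialClosure Ω S) := by
  have h : ∀ i, IsLocallyClosed ((Ω i : Set ℂ) ∪ S i) := fun i => by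
    obtain ⟨O, hO, h⟩ := hS i
    exact isLocallyClosed_union_of_frontier (Ω i).isOpen hO h
  choose U Z hU hZ hUZ using h
  refine ⟨univ.pi U, univ.pi Z, isOpen_set_pi finite_univ fun i _ => hU i,
    isClosed_set_pi fun i _ => hZ i, ?_⟩
  rw [← pi_inter_distrib, partialClosure]
  exact pi_congr rfl fun i _ => hUZ i

theorem exists_compact_nhdsWithin {X : Type*} [TopologicalSpace X] [LocallyCompactSpace X]
    {s : Set X} (hs : IsLocallyClosed s) {z : X} (hz : z ∈ s) :
    ∃ L, IsCompact L ∧ L ⊆ s ∧ L ∈ 𝓝[s] z := by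
  obtain ⟨U, Z, hU, hZ, rfl⟩ := hs
  obtain ⟨K, hKz, hKU, hK⟩ := local_compact_nhds (hU.mem_nhds hz.1)
  refine ⟨K ∩ Z, hK.inter_right hZ, inter_subset_inter_left _ hKU, ?_⟩
  exact inter_mem (mem_nhdsWithin_of_mem_nhds hKz)
    (mem_of_superset self_mem_nhdsWithin inter_subset_right)

theorem continuousOn_of_tendstoUniformlyOn_compacts {X ι : Type*} [TopologicalSpace X]
    [LocallyCompactSpace X] {s : Set X} (hs : IsLocallyClosed s) {l : Filter ι} [l.NeBot]
    {u : ι → X → ℂ} {g : X → ℂ} (hu : ∀ n, ContinuousOn (u n) s)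
    (h : ∀ L, IsCompact L → L ⊆ s → TendstoUniformlyOn u g l L) : ContinuousOn g s := by
  intro z hz
  obtain ⟨L, hL, hLs, hLz⟩ := exists_compact_nhdsWithin hs hz
  have h1 : ContinuousOn g L := (h L hL hLs).continuousOn
    (Eventually.frequently (Eventually.of_forall fun n => (hu n).mono hLs))
  have hzL : z ∈ L := mem_of_mem_nhdsWithin hz hLz
  have h2 : ContinuousWithinAt g L z := h1 z hzL
  exact h2.mono_of_mem_nhdsWithin hLz

/-- A locally closed subset of a locally compact second countable space has a compact exhaustion. -/
theorem exists_compact_exhaustion {X : Type*} [TopologicalSpace X] [LocallyCompactSpace X]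
    [SecondCountableTopology X] {s : Set X} (hs : IsLocallyClosed s) :
    ∃ t : ℕ → Set X, (∀ n, IsCompact (t n)) ∧ (∀ n, t n ⊆ s) ∧ Monotone t ∧
      ∀ L, IsCompact L → L ⊆ s → ∃ n, L ⊆ t n := by
  have := hs.locallyCompactSpace
  set K : CompactExhaustion s := CompactExhaustion.choice s
  refine ⟨fun n => Subtype.val '' K n, fun n => (K.isCompact n).image continuous_subtype_val,
    fun n => Subtype.coe_image_subset _ _, fun m n h => image_mono (K.subset h), fun L hL hLs => ?_⟩
  have h1 : IsCompact ((Subtype.val : s → X) ⁻¹' L) := by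
    rw [Subtype.isCompact_iff, Subtype.image_preimage_coe, inter_eq_right.2 hLs]
    exact hL
  obtain ⟨n, hn⟩ := K.exists_superset_of_isCompact h1
  refine ⟨n, fun z hz => ⟨⟨z, hLs hz⟩, hn hz, rfl⟩⟩

/-- `A^∞(Ω, S)` is complete: the extended derivatives of a Cauchy sequence converge uniformly on
compact sets, and by Weierstrass' theorem their limits are the derivatives of one holomorphic
function. The topology has a countable basis of entourages by the compact exhaustion. -/
theorem AInfty.isCompletelyPseudoMetrizableSpace
    (hS : ∀ i, ∃ O : Set ℂ, IsOpen O ∧ S i = frontier (Ω i : Set ℂ) ∩ O) :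
    IsCompletelyPseudoMetrizableSpace (AInfty Ω S) := by
  have hSf := subset_frontier hS
  have hlc := isLocallyClosed_partialClosure hS
  obtain ⟨t, htc, hts, htm, hex⟩ := exists_compact_exhaustion hlc
  set 𝔖 : Set (Set (Fin d → ℂ)) := {L | IsCompact L ∧ L ⊆ partialClosure Ω S} with h𝔖
  let E : (Fin d → ℕ) → AInfty Ω S → UniformOnFun (Fin d → ℂ) ℂ 𝔖 := fun a f =>
    UniformOnFun.ofFun 𝔖 (f.extPartial a)
  let us : (Fin d → ℕ) → UniformSpace (AInfty Ω S) := fun a => UniformSpace.comap (E a) inferInstance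
  let _ : UniformSpace (AInfty Ω S) := (⨅ a, us a).replaceTopology (by
    rw [UniformSpace.toTopologicalSpace_iInf]
    rfl)
  have hunif : uniformity (AInfty Ω S) =
      ⨅ a, Filter.comap (Prod.map (E a) (E a)) (uniformity (UniformOnFun (Fin d → ℂ) ℂ 𝔖)) :=
    iInf_uniformity
  have hcg : IsCountablyGenerated (uniformity (UniformOnFun (Fin d → ℂ) ℂ 𝔖)) :=
    UniformOnFun.isCountablyGenerated_uniformity 𝔖 (t := t) (fun n => ⟨htc n, hts n⟩) htm
      fun L hL => hex L hL.1 hL.2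
  have hcg' : IsCountablyGenerated (uniformity (AInfty Ω S)) := by
    rw [hunif]
    infer_instance
  have hEu : ∀ a, UniformContinuous (E a) := fun a => by
    rw [UniformContinuous, tendsto_iff_comap, hunif]
    exact iInf_le _ a
  have hcomplete : CompleteSpace (AInfty Ω S) := by
    refine UniformSpace.complete_of_cauchySeq_tendsto fun u hu => ?_
    have h1 : ∀ a, ∃ G : (Fin d → ℂ) → ℂ, ∀ L, IsCompact L → L ⊆ partialClosure Ω S →
        TendstoUniformlyOn (fun n => (u n).extPartial a) G atTop L := by
      intro a
      obtain ⟨G, hG⟩ := cauchySeq_tendsto_of_complete ((hEu a).comp_cauchySeq hu)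
      refine ⟨UniformOnFun.toFun 𝔖 G, fun L hL hLs => ?_⟩
      exact UniformOnFun.tendsto_iff_tendstoUniformlyOn.1 hG L ⟨hL, hLs⟩
    choose G hG using h1
    have hGc : ∀ a, ContinuousOn (G a) (partialClosure Ω S) := fun a =>
      continuousOn_of_tendstoUniformlyOn_compacts hlc
        (fun n => (u n).continuousOn_extPartial hSf a) (hG a)
    have hU := isOpen_prodDomain Ω
    have hloc : ∀ a, TendstoLocallyUniformlyOn (fun n => mixedPartial a (zeroExt (u n).toFun))
        (G a) atTop (prodDomain Ω) := by
      intro a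
      rw [tendstoLocallyUniformlyOn_iff_forall_isCompact hU]
      intro L hL hLc
      exact (hG a L hLc (hL.trans prodDomain_subset_partialClosure)).congr
        (Eventually.of_forall fun n z hz => (u n).extPartial_eqOn_prodDomain hSf a (hL hz))
    have hloc0 : TendstoLocallyUniformlyOn (fun n => zeroExt (u n).toFun) (G 0) atTop
        (prodDomain Ω) := by
      simpa only [mixedPartial_zero] using hloc 0
    have hGan : AnalyticOnNhd ℂ (G 0) (prodDomain Ω) :=
      analyticOnNhd_of_tendstoLocallyUniformlyOn hU (fun n => (u n).analyticOnNhd) hloc0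
    have hGa : ∀ a, EqOn (G a) (mixedPartial a (G 0)) (prodDomain Ω) := by
      intro a z hz
      have h2 := tendstoLocallyUniformlyOn_mixedPartial hU (fun n => (u n).analyticOnNhd) hGan
        hloc0 a
      exact tendsto_nhds_unique ((hloc a).tendsto_at hz) (h2.tendsto_at hz)
    have hze : EqOn (zeroExt fun z : prodDomain Ω => G 0 z) (G 0) (prodDomain Ω) := fun z hz =>
      zeroExt_eq (fun z : prodDomain Ω => G 0 z) ⟨z, hz⟩
    have hGa' : ∀ a, EqOn (G a) (mixedPartial a (zeroExt fun z : prodDomain Ω => G 0 z))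
        (prodDomain Ω) := fun a =>
      (hGa a).trans ((mixedPartial_aux hU a).2.1 _ _ hze).symm
    have hmem : MemAInfty Ω S fun z : prodDomain Ω => G 0 z :=
      ⟨hGan.congr hU hze.symm, fun a => ⟨G a, hGc a, hGa' a⟩⟩
    let f : AInfty Ω S := ⟨fun z => G 0 z, hmem⟩
    refine ⟨f, AInfty.tendsto_nhds_iff.2 fun a L hL hLs => ?_⟩
    exact (hG a L hL hLs).congr_right fun z hz =>
      (f.extPartial_eqOn hSf a (hGc a) (hGa' a) (hLs hz)).symm
  exact inferInstance

end

/-! ### Continuity of Taylor sums and approximation of derivatives -/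

section

variable {d : ℕ} {Ω : Fin d → Opens ℂ} {S : Fin d → Set ℂ}

/-- Polynomials as elements of the space of continuous functions on `ℂ^d` with the topology of
locally uniform convergence. -/
def polyMap : MvPolynomial (Fin d) ℂ →ₐ[ℂ] C(Fin d → ℂ, ℂ) :=
  MvPolynomial.aeval fun i => ⟨fun z => z i, continuous_apply i⟩

@[simp]
theorem polyMap_apply (p : MvPolynomial (Fin d) ℂ) (z : Fin d → ℂ) :
    polyMap p z = MvPolynomial.eval z p := by
  unfold polyMap
  induction p using MvPolynomial.induction_on with
  | C a => simp
  | add p q hp hq => simp [hp, hq]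
  | mul_X p i hp => simp [hp]

theorem tendsto_polyMap_iff {ι : Type*} {l : Filter ι} {u : ι → MvPolynomial (Fin d) ℂ}
    {p : MvPolynomial (Fin d) ℂ} :
    Tendsto (fun n => polyMap (u n)) l (𝓝 (polyMap p)) ↔ ∀ L, IsCompact L →
      TendstoUniformlyOn (fun n z => MvPolynomial.eval z (u n)) (fun z => MvPolynomial.eval z p)
        l L := by
  rw [ContinuousMap.tendsto_iff_forall_isCompact_tendstoUniformlyOn]
  refine forall_congr' fun L => forall_congr' fun _ => ?_
  have h : ∀ q : MvPolynomial (Fin d) ℂ, ⇑(polyMap q) = fun z => MvPolynomial.eval z q :=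
    fun q => funext fun z => polyMap_apply q z
  simp only [h]

/-- Locally uniform convergence on `ℂ^d` entails that of all derivatives. -/
theorem tendsto_polyMap_mixedPDeriv {ι : Type*} {l : Filter ι}
    {u : ι → MvPolynomial (Fin d) ℂ} {p : MvPolynomial (Fin d) ℂ}
    (h : Tendsto (fun n => polyMap (u n)) l (𝓝 (polyMap p))) (a : Fin d → ℕ) :
    Tendsto (fun n => polyMap (mixedPDeriv a (u n))) l (𝓝 (polyMap (mixedPDeriv a p))) := by
  rw [tendsto_polyMap_iff] at h ⊢
  have han : ∀ q : MvPolynomial (Fin d) ℂ,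
      AnalyticOnNhd ℂ (fun z => MvPolynomial.eval z q) univ := fun q =>
    AnalyticOnNhd.eval_mvPolynomial q
  have h1 := tendstoLocallyUniformlyOn_mixedPartial isOpen_univ (fun n => han (u n)) (han p)
    ((tendstoLocallyUniformlyOn_iff_forall_isCompact isOpen_univ).2 fun L _ hL => h L hL) a
  simp only [mixedPartial_eval] at h1
  exact fun L hL => (tendstoLocallyUniformlyOn_iff_forall_isCompact isOpen_univ).1 h1 L
    (subset_univ _) hL

theorem AInfty.tendsto_ofPoly (hS : ∀ i, S i ⊆ frontier (Ω i : Set ℂ)) {ι : Type*}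
    {l : Filter ι} {u : ι → MvPolynomial (Fin d) ℂ} {p : MvPolynomial (Fin d) ℂ}
    (h : Tendsto (fun n => polyMap (u n)) l (𝓝 (polyMap p))) :
    Tendsto (fun n => AInfty.ofPoly Ω S (u n)) l (𝓝 (AInfty.ofPoly Ω S p)) :=
  (AInfty.tendsto_ofPoly_iff hS).2 fun a L hL _ =>
    tendsto_polyMap_iff.1 (tendsto_polyMap_mixedPDeriv h a) L hL

theorem continuous_taylorCoeff (hS : ∀ i, S i ⊆ frontier (Ω i : Set ℂ)) (ζ : prodDomain Ω)
    (α : Fin d → ℕ) : Continuous fun f : AInfty Ω S => taylorCoeff f.toFun ζ α := by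
  refine Continuous.mul continuous_const (continuous_iff_continuousAt.2 fun f => ?_)
  have h := AInfty.tendsto_nhds_iff.1 (continuous_id.tendsto f) α {ζ.1} isCompact_singleton
    (singleton_subset_iff.2 (prodDomain_subset_partialClosure ζ.2))
  have h2 := h.tendsto_at (mem_singleton _)
  simp only [id] at h2
  rw [AInfty.extPartial_eqOn_prodDomain hS f α ζ.2] at h2
  exact h2.congr fun g => AInfty.extPartial_eqOn_prodDomain hS g α ζ.2

/-- The Taylor sums depend continuously on `f ∈ A^∞(Ω, S)`, for locally uniform convergence on the
whole of `ℂ^d`. -/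
theorem continuous_polyMap_taylorSum (hS : ∀ i, S i ⊆ frontier (Ω i : Set ℂ)) (ζ : prodDomain Ω)
    (N : ℕ ≃ (Fin d → ℕ)) (n : ℕ) :
    Continuous fun f : AInfty Ω S => polyMap (taylorSum N f.toFun ζ n) := by
  simp only [taylorSum, map_sum, map_mul]
  refine continuous_finsetSum _ fun j _ => ?_
  have h : ∀ c : ℂ, polyMap (MvPolynomial.C c : MvPolynomial (Fin d) ℂ) =
      ContinuousMap.const _ c := fun c => by ext z; simp
  simp only [h]
  exact (ContinuousMap.continuous_const'.comp (continuous_taylorCoeff hS ζ (N j))).mul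
    continuous_const

theorem continuous_ofPoly_taylorSum (hS : ∀ i, S i ⊆ frontier (Ω i : Set ℂ)) (ζ : prodDomain Ω)
    (N : ℕ ≃ (Fin d → ℕ)) (n : ℕ) :
    Continuous fun f : AInfty Ω S => AInfty.ofPoly Ω S (taylorSum N f.toFun ζ n) :=
  continuous_iff_continuousAt.2 fun f =>
    AInfty.tendsto_ofPoly hS ((continuous_polyMap_taylorSum hS ζ N n).tendsto f)

/-- There is a countable set of polynomials that is dense for locally uniform convergence. -/
theorem exists_countable_dense_polynomials (d : ℕ) :
    ∃ Q : Set (MvPolynomial (Fin d) ℂ), Q.Countable ∧ ∀ p, ∃ u : ℕ → MvPolynomial (Fin d) ℂ,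
      (∀ n, u n ∈ Q) ∧ Tendsto (fun n => polyMap (u n)) atTop (𝓝 (polyMap p)) := by
  let _ : TopologicalSpace (MvPolynomial (Fin d) ℂ) :=
    TopologicalSpace.induced (polyMap (d := d)) inferInstance
  have : SecondCountableTopology (MvPolynomial (Fin d) ℂ) := secondCountableTopology_induced _ _ _
  obtain ⟨Q, hQ, hd⟩ := TopologicalSpace.exists_countable_dense (MvPolynomial (Fin d) ℂ)
  refine ⟨Q, hQ, fun p => ?_⟩
  obtain ⟨u, hu, hup⟩ := mem_closure_iff_seq_limit.1 (hd p)
  exact ⟨u, hu, (continuous_induced_dom.tendsto p).comp hup⟩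

theorem finite_setOf_forall_le (s : ℕ) : {a : Fin d → ℕ | ∀ i, a i ≤ s}.Finite :=
  (Set.finite_Iic (fun _ : Fin d => s)).subset fun _ ha => ha

/-- The polynomials that are close to `p` on `K` together with their derivatives up to order `s`
in each variable. -/
def closeTo (K : Set (Fin d → ℂ)) (p : MvPolynomial (Fin d) ℂ) (s : ℕ) :
    Set (MvPolynomial (Fin d) ℂ) :=
  {q | ∀ a : Fin d → ℕ, (∀ i, a i ≤ s) → ∀ z ∈ K,
    ‖MvPolynomial.eval z (mixedPDeriv a q) - MvPolynomial.eval z (mixedPDeriv a p)‖ < 1 / (s + 1)}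

theorem isOpen_taylorSum_mem_closeTo (hS : ∀ i, S i ⊆ frontier (Ω i : Set ℂ)) (ζ : prodDomain Ω)
    (N : ℕ ≃ (Fin d → ℕ)) (n : ℕ) {K : Set (Fin d → ℂ)} (hK : IsCompact K)
    (p : MvPolynomial (Fin d) ℂ) (s : ℕ) :
    IsOpen {f : AInfty Ω S | taylorSum N f.toFun ζ n ∈ closeTo K p s} := by
  have h : {f : AInfty Ω S | taylorSum N f.toFun ζ n ∈ closeTo K p s} =
      ⋂ a ∈ {a : Fin d → ℕ | ∀ i, a i ≤ s},
        (fun f : AInfty Ω S => polyMap (mixedPDeriv a (taylorSum N f.toFun ζ n)) -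
          polyMap (mixedPDeriv a p)) ⁻¹' {g | MapsTo g K (Metric.ball 0 (1 / (s + 1)))} := by
    ext f
    simp [closeTo, MapsTo]
  rw [h]
  refine (finite_setOf_forall_le s).isOpen_biInter fun a _ => ?_
  refine (ContinuousMap.isOpen_setOfPred_mapsTo hK Metric.isOpen_ball).preimage ?_
  refine Continuous.sub (continuous_iff_continuousAt.2 fun f => ?_) continuous_const
  exact tendsto_polyMap_mixedPDeriv ((continuous_polyMap_taylorSum hS ζ N n).tendsto f) a

/-- **Runge's theorem** on products, with approximation of derivatives. -/
theorem runge_pi_mixedPartial {K : Fin d → Set ℂ} (hK : ∀ i, IsCompact (K i))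
    (hKc : ∀ i, IsPreconnected (K i)ᶜ) {h : (Fin d → ℂ) → ℂ} (hh : MemO (univ.pi K) h) (s : ℕ)
    {ε : ℝ} (hε : 0 < ε) :
    ∃ p : MvPolynomial (Fin d) ℂ, ∀ a : Fin d → ℕ, (∀ i, a i ≤ s) → ∀ z ∈ univ.pi K,
      ‖MvPolynomial.eval z (mixedPDeriv a p) - mixedPartial a h z‖ < ε := by
  obtain ⟨U, hU, hKU, hhU⟩ := hh
  obtain ⟨W, hW, hKW, hWU, happ⟩ := runge_pi hK hKc hU hKU
    (fun z hz => (hhU z hz).differentiableAt.differentiableWithinAt)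
  have hpos : ∀ n : ℕ, (0 : ℝ) < 1 / (n + 1) := fun n => by positivity
  choose u hu using fun n : ℕ => happ _ (hpos n)
  have h1 : TendstoLocallyUniformlyOn (fun n z => MvPolynomial.eval z (u n)) h atTop W := by
    refine TendstoUniformlyOn.tendstoLocallyUniformlyOn (Metric.tendstoUniformlyOn_iff.2 ?_)
    intro δ hδ
    filter_upwards [(tendsto_one_div_add_atTop_nhds_zero_nat (𝕜 := ℝ)).eventually_lt_const hδ]
      with n hn z hz
    rw [dist_comm, dist_eq_norm]
    exact (hu n z hz).trans hn
  have h2 : ∀ a, ∀ᶠ n in atTop, ∀ z ∈ univ.pi K,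
      ‖MvPolynomial.eval z (mixedPDeriv a (u n)) - mixedPartial a h z‖ < ε := by
    intro a
    have h3 := tendstoLocallyUniformlyOn_mixedPartial hW (fun n =>
      (AnalyticOnNhd.eval_mvPolynomial (u n)).mono (subset_univ W)) (hhU.mono hWU) h1 a
    have h4 := (tendstoLocallyUniformlyOn_iff_forall_isCompact hW).1 h3 _ hKW
      (isCompact_univ_pi hK)
    filter_upwards [Metric.tendstoUniformlyOn_iff.1 h4 ε hε] with n hn z hz
    have := hn z hz
    rwa [dist_comm, dist_eq_norm, mixedPartial_eval] at this
  obtain ⟨n, hn⟩ := ((finite_setOf_forall_le (d := d) s).eventually_all.2 fun a _ => h2 a).exists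
  exact ⟨u n, fun a ha => hn a ha⟩

end

/-! ### Admissible compact sets -/

section

/-- Among the compact sets off `U ∪ closure S` with connected complements there are countably many
such that each of these sets is contained in one of the countably many. They are closed discs minus
`U`, a thickening of `S` and finitely many balls of a countable family: the balls cover a path that
joins `U` to the outside of the disc, so that the complement is connected. -/
theorem exists_countable_cofinal_compacts {U S : Set ℂ} (hU : IsOpen U) (hUc : IsConnected U)
    (hS : S ⊆ frontier U) :
    ∃ 𝒞 : Set (Set ℂ), 𝒞.Countable ∧
      (∀ C ∈ 𝒞, IsCompact C ∧ IsConnected Cᶜ ∧ Disjoint C (U ∪ closure S)) ∧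
      ∀ K, IsCompact K → IsConnected Kᶜ → Disjoint K (U ∪ closure S) → ∃ C ∈ 𝒞, K ⊆ C := by
  set B : ℕ × ℕ → Set ℂ := fun k => Metric.ball (denseSeq ℂ k.1) (1 / (k.2 + 1)) with hB
  have hBo : ∀ k, IsOpen (B k) := fun k => Metric.isOpen_ball
  have hBc : ∀ k, IsPreconnected (B k) := fun k => (convex_ball _ _).isPreconnected
  set T : ℕ × Finset (ℕ × ℕ) → Set ℂ := fun m =>
    Metric.closedBall 0 m.1 \ (U ∪ Metric.thickening (1 / (m.1 + 1)) S ∪ ⋃ k ∈ m.2, B k) with hT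
  refine ⟨{C ∈ range T | IsConnected Cᶜ}, (countable_range T).mono (sep_subset _ _), ?_, ?_⟩
  · rintro _ ⟨⟨⟨n, F⟩, rfl⟩, hconn⟩
    refine ⟨(isCompact_closedBall _ _).diff ?_, hconn, ?_⟩
    · exact (hU.union Metric.isOpen_thickening).union (isOpen_biUnion fun k _ => hBo k)
    · refine disjoint_sdiff_left.mono_right (union_subset ?_ ?_)
      · exact subset_union_left.trans subset_union_left
      · exact ((Metric.closure_subset_thickening (by positivity) S).trans
          subset_union_right).trans subset_union_left
  · intro K hK hKc hKd
    obtain ⟨ζ, hζ⟩ := hUc.nonempty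
    have hKU : Disjoint K U := hKd.mono_right subset_union_left
    obtain ⟨δ, hδ, hdis⟩ := (hKd.mono_right subset_union_right).exists_thickenings hK isClosed_closure
    obtain ⟨n₁, hn₁⟩ := exists_nat_one_div_lt hδ
    obtain ⟨R, hR⟩ := hK.isBounded.subset_closedBall (0 : ℂ)
    obtain ⟨n₂, hn₂⟩ := exists_nat_ge R
    set n := max n₁ n₂
    have hKn : K ⊆ Metric.closedBall 0 (n : ℝ) :=
      hR.trans (Metric.closedBall_subset_closedBall (hn₂.trans (by exact_mod_cast le_max_right _ _)))
    have hn : 1 / ((n : ℝ) + 1) ≤ δ := by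
      refine le_trans ?_ hn₁.le
      exact one_div_le_one_div_of_le (by positivity)
        (by gcongr; exact le_max_left _ _)
    have hKS : Disjoint K (Metric.thickening (1 / ((n : ℝ) + 1)) S) := by
      refine hdis.mono (Metric.self_subset_thickening hδ K) ?_
      exact (Metric.thickening_mono hn S).trans (Metric.thickening_subset_of_subset δ subset_closure)
    -- A compact path `P` off `K` from `ζ` to a point `x` outside the disc of radius `n`.
    set x : ℂ := ((n + 1 : ℝ) : ℂ) with hx
    have hxn : x ∈ (Metric.closedBall (0 : ℂ) n)ᶜ := by
      rw [mem_compl_iff, Metric.mem_closedBall, dist_zero_right, hx, Complex.norm_real,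
        Real.norm_of_nonneg (by positivity)]
      linarith
    have hpath : IsPathConnected Kᶜ :=
      (hK.isClosed.isOpen_compl.isConnected_iff_isPathConnected).1 hKc
    have hj := hpath.joinedIn ζ (hKU.notMem_of_mem_right hζ) x fun h => hxn (hKn h)
    set P : Set ℂ := range hj.somePath with hP
    have hPc : IsCompact P := isCompact_range hj.somePath.continuous
    have hPconn : IsPreconnected P := isPreconnected_range hj.somePath.continuous
    have hPK : P ⊆ Kᶜ := by
      rintro _ ⟨t, rfl⟩
      exact hj.somePath_mem t
    have hζP : ζ ∈ P := ⟨0, hj.somePath.source⟩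
    have hxP : x ∈ P := ⟨1, hj.somePath.target⟩
    obtain ⟨b, hb, hbfin, hPb⟩ := hPc.elim_finite_subcover_image
      (b := {k | B k ⊆ Kᶜ ∧ (B k ∩ P).Nonempty}) (c := B) (fun k _ => hBo k) (by
        intro y hy
        obtain ⟨ε, hε, hball⟩ := Metric.isOpen_iff.1 hK.isClosed.isOpen_compl y (hPK hy)
        obtain ⟨j, hj⟩ := exists_nat_one_div_lt (half_pos hε)
        have hj0 : (0 : ℝ) < 1 / (j + 1) := by positivity
        obtain ⟨k, hk⟩ := (denseRange_denseSeq ℂ).exists_dist_lt y hj0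
        refine mem_iUnion₂.2 ⟨(k, j), ⟨fun v hv => hball ?_, y, hk, hy⟩, hk⟩
        rw [Metric.mem_ball] at hv ⊢
        calc dist v y ≤ dist v (denseSeq ℂ k) + dist (denseSeq ℂ k) y := dist_triangle _ _ _
          _ < ε := by
            rw [dist_comm _ y]
            linarith [show dist v (denseSeq ℂ k) < 1 / (j + 1) from hv])
    set F : Finset (ℕ × ℕ) := hbfin.toFinset with hF
    have hFb : ∀ k ∈ F, k ∈ b := fun k hk => hbfin.mem_toFinset.1 hk
    have hcompl : (T (n, F))ᶜ = (Metric.closedBall (0 : ℂ) n)ᶜ ∪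
        (U ∪ Metric.thickening (1 / ((n : ℝ) + 1)) S ∪ ⋃ k ∈ F, B k) := by
      rw [hT]
      ext v
      simp only [mem_compl_iff, Set.mem_sdiff, mem_union]
      tauto
    have hPF : P ⊆ ⋃ k ∈ F, B k := by
      refine hPb.trans (iUnion₂_subset fun k hk => ?_)
      exact subset_biUnion_of_mem (u := B) (hbfin.mem_toFinset.2 hk : k ∈ F)
    have hUsub : U ⊆ (T (n, F))ᶜ := by
      rw [hcompl]
      exact fun v hv => Or.inr (Or.inl (Or.inl hv))
    have hPsub : P ⊆ (T (n, F))ᶜ := by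
      rw [hcompl]
      exact fun v hv => Or.inr (Or.inr (hPF hv))
    refine ⟨T (n, F), ⟨⟨(n, F), rfl⟩, ⟨ζ, hUsub hζ⟩, ?_⟩, ?_⟩
    · refine isPreconnected_of_forall ζ fun y hy => ?_
      rw [hcompl] at hy
      rcases hy with hy | (hy | hy) | hy
      · refine ⟨P ∪ (Metric.closedBall (0 : ℂ) n)ᶜ, union_subset hPsub ?_, Or.inl hζP, Or.inr hy,
          hPconn.union x hxP hxn (isPreconnected_compl_closedBall _)⟩
        rw [hcompl]
        exact subset_union_left
      · exact ⟨U, hUsub, hζ, hy, hUc.isPreconnected⟩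
      · obtain ⟨s, hs, hys⟩ := Metric.mem_thickening_iff.1 hy
        have hr : (0 : ℝ) < 1 / (n + 1) := by positivity
        obtain ⟨v, hv, hsv⟩ := Metric.mem_closure_iff.1 (frontier_subset_closure (hS hs)) _ hr
        rw [dist_comm] at hsv
        refine ⟨U ∪ Metric.ball s (1 / (n + 1)), union_subset hUsub ?_, Or.inl hζ, Or.inr hys,
          hUc.isPreconnected.union v hv hsv (convex_ball _ _).isPreconnected⟩
        rw [hcompl]
        exact fun w hw => Or.inr (Or.inl (Or.inr (Metric.mem_thickening_iff.2 ⟨s, hs, hw⟩)))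
      · obtain ⟨k, hk, hyk⟩ := mem_iUnion₂.1 hy
        obtain ⟨v, hvB, hvP⟩ := (hb (hFb k hk)).2
        refine ⟨P ∪ B k, union_subset hPsub ?_, Or.inl hζP, Or.inr hyk,
          hPconn.union v hvP hvB (hBc k)⟩
        rw [hcompl]
        exact fun w hw => Or.inr (Or.inr (mem_iUnion₂.2 ⟨k, hk, hw⟩))
    · refine fun z hz => ⟨hKn hz, ?_⟩
      rintro ((h | h) | h)
      · exact hKU.notMem_of_mem_left hz h
      · exact hKS.notMem_of_mem_left hz h
      · obtain ⟨k, hk, hzk⟩ := mem_iUnion₂.1 h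
        exact (hb (hFb k hk)).1 hzk hz

variable {d : ℕ} {Ω : Fin d → Opens ℂ} {S : Fin d → Set ℂ}

/-- The products of compact sets on which universal functions have to approximate: factors with
connected complements, disjoint from `∏ (Ω_i ∪ closure S_i)`. -/
def Admissible (Ω : Fin d → Opens ℂ) (S : Fin d → Set ℂ) (K : Fin d → Set ℂ) : Prop :=
  (∀ i, IsCompact (K i)) ∧ (∀ i, IsConnected (K i)ᶜ) ∧
    Disjoint (univ.pi K) (univ.pi fun i => (Ω i : Set ℂ) ∪ closure (S i))

theorem isConnected_compl_closedBall (R : ℝ) : IsConnected (Metric.closedBall (0 : ℂ) R)ᶜ := by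
  refine ⟨⟨((|R| + 1 : ℝ) : ℂ), ?_⟩, isPreconnected_compl_closedBall R⟩
  rw [mem_compl_iff, Metric.mem_closedBall, dist_zero_right, Complex.norm_real,
    Real.norm_of_nonneg (by positivity)]
  linarith [le_abs_self R]

/-- As only the products are disjoint, this holds for just one of the factors; the others are
arbitrary. -/
theorem Admissible.exists_disjoint {K : Fin d → Set ℂ} (hK : Admissible Ω S K) :
    ∃ i, Disjoint (K i) ((Ω i : Set ℂ) ∪ closure (S i)) := by
  by_contra! h
  have h1 : ∀ i, ∃ z, z ∈ K i ∧ z ∈ (Ω i : Set ℂ) ∪ closure (S i) := fun i =>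
    not_disjoint_iff.1 (h i)
  choose z hz hz' using h1
  exact disjoint_left.1 hK.2.2 (fun i _ => hz i) fun i _ => hz' i

/-- Countably many admissible products contain all the others: in one factor use the countable
family of plane compact sets, in the others discs. -/
theorem exists_countable_cofinal_admissible (hΩ : ∀ i, IsConnected (Ω i : Set ℂ))
    (hS : ∀ i, S i ⊆ frontier (Ω i : Set ℂ)) :
    ∃ 𝒦 : Set (Fin d → Set ℂ), 𝒦.Countable ∧ (∀ K ∈ 𝒦, Admissible Ω S K) ∧
      ∀ K, Admissible Ω S K → ∃ K' ∈ 𝒦, univ.pi K ⊆ univ.pi K' := by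
  choose 𝒞 hc hadm hcof using fun i =>
    exists_countable_cofinal_compacts (Ω i).isOpen (hΩ i) (hS i)
  refine ⟨⋃ i, ⋃ n : ℕ, (fun C => Function.update (fun _ => Metric.closedBall (0 : ℂ) n) i C) '' 𝒞 i,
    countable_iUnion fun i => countable_iUnion fun n => (hc i).image _, ?_, ?_⟩
  · intro K hK
    obtain ⟨i, hK⟩ := mem_iUnion.1 hK
    obtain ⟨n, C, hC, rfl⟩ := mem_iUnion.1 hK
    obtain ⟨h1, h2, h3⟩ := hadm i C hC
    refine ⟨fun j => ?_, fun j => ?_, ?_⟩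
    · by_cases hj : j = i
      · subst hj; simpa using h1
      · simpa [hj] using isCompact_closedBall (0 : ℂ) n
    · by_cases hj : j = i
      · subst hj; simpa using h2
      · simpa [hj] using isConnected_compl_closedBall n
    · refine disjoint_left.2 fun z hz hz' => ?_
      have h4 : z i ∈ C := by simpa using hz i (mem_univ i)
      exact disjoint_left.1 h3 h4 (hz' i (mem_univ i))
  · intro K hK
    obtain ⟨i, hi⟩ := hK.exists_disjoint
    obtain ⟨C, hC, hKC⟩ := hcof i (K i) (hK.1 i) (hK.2.1 i) hi
    obtain ⟨R, hR⟩ := (isCompact_univ_pi hK.1).isBounded.subset_closedBall (0 : Fin d → ℂ)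
    obtain ⟨n, hn⟩ := exists_nat_ge R
    refine ⟨_, mem_iUnion.2 ⟨i, mem_iUnion.2 ⟨n, C, hC, rfl⟩⟩, fun z hz j _ => ?_⟩
    by_cases hj : j = i
    · subst hj; simpa using hKC (hz j (mem_univ j))
    · have h1 := hR hz
      rw [Metric.mem_closedBall] at h1
      have h2 := (dist_le_pi_dist z 0 j).trans (h1.trans hn)
      simpa [hj] using h2

/-- A compact subset of a set with connected, empty or unbounded complement has a compact
neighbour in that set with connected complement. -/
theorem exists_hull_subset {E L : Set ℂ} (hL : IsCompact L) (hLE : L ⊆ E) (hE : IsPreconnected Eᶜ)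
    (hunb : Eᶜ.Nonempty → ¬ Bornology.IsBounded Eᶜ) :
    ∃ L', IsCompact L' ∧ L ⊆ L' ∧ L' ⊆ E ∧ IsPreconnected L'ᶜ := by
  obtain ⟨R, hR⟩ := hL.isBounded.subset_closedBall (0 : ℂ)
  obtain ⟨L', h1, h2, -, h3, h4⟩ := exists_hull hL hR
  refine ⟨L', h1, h2, ?_, h3⟩
  rcases Eᶜ.eq_empty_or_nonempty with hne | hne
  · rw [compl_empty_iff.1 hne]
    exact subset_univ _
  · refine compl_subset_compl.1 (h4 _ hE (compl_subset_compl.2 hLE) ?_)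
    by_contra! hcon
    have hsub : Eᶜ ⊆ Metric.closedBall (0 : ℂ) R := fun z hz => by simpa using hcon z hz
    exact hunb hne (Metric.isBounded_closedBall.subset hsub)

/-- Simultaneous approximation: some polynomial `q` is close to `g` on a compact subset of
`∏ (Ω_i ∪ S_i)` and close to `p` on an admissible compact set. The two sets are separated by one
coordinate, so Runge's theorem applies to the function that is `g` near the first and `p` near the
second, on a product of a disjoint union in that coordinate and of discs in the others. -/
theorem exists_polynomial_mem_closeTo
    (hconn : ∀ i, IsPreconnected ((Ω i : Set ℂ) ∪ S i)ᶜ)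
    (hunb : ∀ i, ((Ω i : Set ℂ) ∪ S i)ᶜ.Nonempty →
      ¬ Bornology.IsBounded ((Ω i : Set ℂ) ∪ S i)ᶜ)
    {K : Fin d → Set ℂ} (hK : Admissible Ω S K) {L : Set (Fin d → ℂ)} (hL : IsCompact L)
    (hLs : L ⊆ partialClosure Ω S) (g p : MvPolynomial (Fin d) ℂ) (s : ℕ) :
    ∃ q, q ∈ closeTo L g s ∧ q ∈ closeTo (univ.pi K) p s := by
  obtain ⟨i, hi⟩ := hK.exists_disjoint
  obtain ⟨L', hL'c, hLL', hL'E, hL'conn⟩ := exists_hull_subset (E := (Ω i : Set ℂ) ∪ S i)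
    (hL.image (continuous_apply i)) (image_subset_iff.2 fun z hz => hLs hz i (mem_univ i))
    (hconn i) (hunb i)
  have hdis : Disjoint L' (K i) :=
    (hi.mono_right (hL'E.trans (union_subset_union_right _ subset_closure))).symm
  obtain ⟨R, hR⟩ := (hL.union (isCompact_univ_pi hK.1)).isBounded.subset_closedBall (0 : Fin d → ℂ)
  set X : Fin d → Set ℂ := Function.update (fun _ => Metric.closedBall (0 : ℂ) R) i (L' ∪ K i)
    with hX
  have hXc : ∀ j, IsCompact (X j) := fun j => by
    by_cases hj : j = i
    · subst hj; simpa [hX] using hL'c.union (hK.1 j)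
    · simpa [hX, hj] using isCompact_closedBall (0 : ℂ) R
  have hXconn : ∀ j, IsPreconnected (X j)ᶜ := fun j => by
    by_cases hj : j = i
    · subst hj
      simp only [hX, Function.update_self]
      exact isPreconnected_compl_union hL'c (hK.1 j) hL'conn (hK.2.1 j).isPreconnected hdis
    · simpa [hX, hj] using isPreconnected_compl_closedBall R
  have hmemX : ∀ z ∈ L ∪ univ.pi K, z i ∈ L' ∪ K i → z ∈ univ.pi X := by
    intro z hz hzi j _
    by_cases hj : j = i
    · subst hj; simpa [hX] using hzi
    · have h1 := hR hz
      rw [Metric.mem_closedBall] at h1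
      have h2 := (dist_le_pi_dist z 0 j).trans h1
      simpa [hX, hj] using h2
  obtain ⟨V₁, V₂, hV₁, hV₂, hLV, hKV, hV⟩ := SeparatedNhds.of_isCompact_isCompact hL'c (hK.1 i) hdis
  classical
  set h : (Fin d → ℂ) → ℂ := fun z =>
    if z i ∈ V₁ then MvPolynomial.eval z g else MvPolynomial.eval z p with hh
  have hU₁ : IsOpen {z : Fin d → ℂ | z i ∈ V₁} := hV₁.preimage (continuous_apply i)
  have hU₂ : IsOpen {z : Fin d → ℂ | z i ∈ V₂} := hV₂.preimage (continuous_apply i)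
  have he₁ : EqOn h (fun z => MvPolynomial.eval z g) {z | z i ∈ V₁} := fun z hz => if_pos hz
  have he₂ : EqOn h (fun z => MvPolynomial.eval z p) {z | z i ∈ V₂} := fun z hz =>
    if_neg (disjoint_right.1 hV hz)
  have hmem : MemO (univ.pi X) h := by
    refine ⟨{z | z i ∈ V₁} ∪ {z | z i ∈ V₂}, hU₁.union hU₂, fun z hz => ?_, ?_⟩
    · have h1 : z i ∈ L' ∪ K i := by simpa [hX] using hz i (mem_univ i)
      exact h1.imp (fun h => hLV h) fun h => hKV h
    · rintro z (hz | hz)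
      · exact (AnalyticOnNhd.eval_mvPolynomial g z (mem_univ z)).congr
          (he₁.eventuallyEq_of_mem (hU₁.mem_nhds hz)).symm
      · exact (AnalyticOnNhd.eval_mvPolynomial p z (mem_univ z)).congr
          (he₂.eventuallyEq_of_mem (hU₂.mem_nhds hz)).symm
  obtain ⟨q, hq⟩ := runge_pi_mixedPartial hXc hXconn hmem s
    (show (0 : ℝ) < 1 / (s + 1) by positivity)
  refine ⟨q, fun a ha z hz => ?_, fun a ha z hz => ?_⟩
  · have hzL : z i ∈ L' := hLL' (mem_image_of_mem _ hz)
    have h1 := hq a ha z (hmemX z (Or.inl hz) (Or.inl hzL))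
    rwa [(mixedPartial_aux hU₁ a).2.1 _ _ he₁ (hLV hzL), mixedPartial_eval] at h1
  · have hzK : z i ∈ K i := hz i (mem_univ i)
    have h1 := hq a ha z (hmemX z (Or.inr hz) (Or.inr hzK))
    rwa [(mixedPartial_aux hU₂ a).2.1 _ _ he₂ (hKV hzK), mixedPartial_eval] at h1

end

/-! ### Linearity -/

section

variable {d : ℕ} {Ω : Fin d → Opens ℂ} {S : Fin d → Set ℂ}

theorem isLinearMap_of_map_smul_add {V W : Type*} [AddCommGroup V] [AddCommGroup W] [Module ℂ V]
    [Module ℂ W] {f : V → W} (h : ∀ (c : ℂ) x y, f (c • x + y) = c • f x + f y) :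
    IsLinearMap ℂ f := by
  have h0 : f 0 = 0 := by simpa using h 1 0 0
  exact ⟨fun x y => by simpa using h 1 x y, fun c x => by simpa [h0] using h c x 0⟩

theorem _root_.IsLinearMap.map_sum_smul {V W J : Type*} [AddCommGroup V] [AddCommGroup W]
    [Module ℂ V] [Module ℂ W] [Fintype J] {f : V → W} (h : IsLinearMap ℂ f) (c : J → ℂ)
    (x : J → V) : f (∑ j, c j • x j) = ∑ j, c j • f (x j) := by
  have := map_sum (h.mk' f) (fun j => c j • x j) Finset.univ
  simpa only [IsLinearMap.mk'_apply, h.map_smul] using this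

theorem isLinearMap_ofPoly : IsLinearMap ℂ (AInfty.ofPoly Ω S) := by
  refine isLinearMap_of_map_smul_add fun c p q => Subtype.ext (funext fun z => ?_)
  change MvPolynomial.eval z.1 (c • p + q) =
    c • MvPolynomial.eval z.1 p + MvPolynomial.eval z.1 q
  rw [map_add, MvPolynomial.smul_eval, smul_eq_mul]

theorem isLinearMap_mixedPDeriv (a : Fin d → ℕ) : IsLinearMap ℂ (mixedPDeriv a) := by
  refine isLinearMap_of_map_smul_add fun c p q => ?_
  have hiter : ∀ (i : Fin d) (k : ℕ) (p q : MvPolynomial (Fin d) ℂ),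
      (MvPolynomial.pderiv i)^[k] (c • p + q) =
        c • (MvPolynomial.pderiv i)^[k] p + (MvPolynomial.pderiv i)^[k] q := by
    intro i k
    induction k with
    | zero => exact fun p q => rfl
    | succ k ih =>
      intro p q
      rw [Function.iterate_succ_apply, map_add, Derivation.map_smul, ih]
      rfl
  unfold mixedPDeriv
  induction List.finRange d with
  | nil => rfl
  | cons i l ih => rw [List.foldr_cons, ih, hiter]; rfl

theorem isLinearMap_taylorSum (N : ℕ ≃ (Fin d → ℕ)) (ζ : prodDomain Ω) (n : ℕ) :
    IsLinearMap ℂ fun f : AInfty Ω S => taylorSum N f.toFun ζ n := by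
  refine isLinearMap_of_map_smul_add fun c f g => ?_
  have h : ∀ α, taylorCoeff (c • f + g).toFun ζ α =
      c * taylorCoeff f.toFun ζ α + taylorCoeff g.toFun ζ α := by
    intro α
    obtain ⟨-, h2, h3⟩ := mixedPartial_aux (isOpen_prodDomain Ω) α
    have h4 : EqOn (zeroExt (c • f + g).toFun) (c • zeroExt f.toFun + zeroExt g.toFun)
      (prodDomain Ω) := zeroExt_lin c f.toFun g.toFun
    rw [taylorCoeff, h2 _ _ h4 ζ.2, h3 c _ _ f.analyticOnNhd g.analyticOnNhd ζ.2]
    simp only [taylorCoeff, Pi.add_apply, Pi.smul_apply, smul_eq_mul]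
    ring
  simp only [taylorSum, h, map_add, map_mul, add_mul, Finset.sum_add_distrib, mul_assoc,
    MvPolynomial.smul_eq_C_mul, Finset.mul_sum]

/-! ### Simultaneous approximation by Taylor sums -/

theorem closeTo_anti (X : Set (Fin d → ℂ)) (p : MvPolynomial (Fin d) ℂ) {s t : ℕ} (h : s ≤ t) :
    closeTo X p t ⊆ closeTo X p s := fun q hq a ha z hz =>
  (hq a (fun i => (ha i).trans h) z hz).trans_le
    (one_div_le_one_div_of_le (by positivity) (by gcongr))

theorem closeTo_mono {X Y : Set (Fin d → ℂ)} (h : X ⊆ Y) (p : MvPolynomial (Fin d) ℂ) (s : ℕ) :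
    closeTo Y p s ⊆ closeTo X p s := fun _ hq a ha z hz => hq a ha z (h hz)

theorem sum_smul_mem_closeTo {J : Type*} [Fintype J] {X : Set (Fin d → ℂ)}
    {p q : J → MvPolynomial (Fin d) ℂ} (c : J → ℂ) {s t : ℕ} (hst : s ≤ t)
    (ht : (∑ j, ‖c j‖) * (s + 1) < t + 1) (h : ∀ j, q j ∈ closeTo X (p j) t) :
    ∑ j, c j • q j ∈ closeTo X (∑ j, c j • p j) s := by
  intro a ha z hz
  rw [(isLinearMap_mixedPDeriv a).map_sum_smul, (isLinearMap_mixedPDeriv a).map_sum_smul,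
    map_sum, map_sum, ← Finset.sum_sub_distrib]
  calc ‖∑ j, (MvPolynomial.eval z (c j • mixedPDeriv a (q j)) -
        MvPolynomial.eval z (c j • mixedPDeriv a (p j)))‖
      ≤ ∑ j, ‖c j‖ * (1 / (t + 1)) := by
        refine norm_sum_le_of_le _ fun j _ => ?_
        rw [MvPolynomial.smul_eval, MvPolynomial.smul_eval, ← mul_sub, norm_mul]
        gcongr
        exact (h j a (fun i => (ha i).trans hst) z hz).le
    _ < 1 / (s + 1) := by
        rw [← Finset.sum_mul, mul_one_div, div_lt_div_iff₀ (by positivity) (by positivity), one_mul]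
        exact ht

/-- The families `F` all of whose members have, for one common index `n ∈ μ` with `n ≥ n₀`,
a Taylor sum `S_n` that is close to `p j` on `X` and close to `F j` itself in `A^∞(Ω, S)`. The
sets `U s` stand for a basis of neighbourhoods of `0`. -/
def approxSet {J : Type*} (N : ℕ ≃ (Fin d → ℕ)) (ζ : prodDomain Ω) (μ : Set ℕ)
    (U : ℕ → Set (AInfty Ω S)) (X : Set (Fin d → ℂ)) (p : J → MvPolynomial (Fin d) ℂ) (s n₀ : ℕ) :
    Set (J → AInfty Ω S) :=
  {F | ∃ n ∈ μ, n₀ ≤ n ∧ ∀ j, taylorSum N (F j).toFun ζ n ∈ closeTo X (p j) s ∧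
    AInfty.ofPoly Ω S (taylorSum N (F j).toFun ζ n) - F j ∈ U s}

variable {N : ℕ ≃ (Fin d → ℕ)} {ζ : prodDomain Ω} {μ : Set ℕ} {U : ℕ → Set (AInfty Ω S)}
  {X : Set (Fin d → ℂ)} {J : Type*}

theorem AInfty.isTopologicalAddGroup (hS : ∀ i, S i ⊆ frontier (Ω i : Set ℂ)) :
    IsTopologicalAddGroup (AInfty Ω S) := by
  have := AInfty.continuousAdd hS
  have := AInfty.continuousConstSMul hS
  have : ContinuousNeg (AInfty Ω S) := ContinuousNeg.of_continuousConstSMul ℂ _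
  exact ⟨⟩

theorem isOpen_approxSet [Finite J] (hS : ∀ i, S i ⊆ frontier (Ω i : Set ℂ))
    (hU : ∀ s, IsOpen (U s)) (hX : IsCompact X) (p : J → MvPolynomial (Fin d) ℂ) (s n₀ : ℕ) :
    IsOpen (approxSet N ζ μ U X p s n₀) := by
  have := AInfty.isTopologicalAddGroup hS
  have h : approxSet N ζ μ U X p s n₀ = ⋃ n ∈ {n | n ∈ μ ∧ n₀ ≤ n}, ⋂ j : J,
      (fun F : J → AInfty Ω S => F j) ⁻¹' ({f | taylorSum N f.toFun ζ n ∈ closeTo X (p j) s} ∩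
        (fun f => AInfty.ofPoly Ω S (taylorSum N f.toFun ζ n) - f) ⁻¹' U s) := by
    ext F
    simp [approxSet, and_assoc]
  rw [h]
  refine isOpen_biUnion fun n _ => isOpen_iInter_of_finite fun j =>
    IsOpen.preimage (continuous_apply j) ?_
  exact (isOpen_taylorSum_mem_closeTo hS ζ N n hX (p j) s).inter
    ((hU s).preimage ((continuous_ofPoly_taylorSum hS ζ N n).sub continuous_id))

theorem eventually_mem_closeTo {X : Set (Fin d → ℂ)} (hX : IsCompact X)
    {u : ℕ → MvPolynomial (Fin d) ℂ} {p : MvPolynomial (Fin d) ℂ}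
    (h : Tendsto (fun n => polyMap (u n)) atTop (𝓝 (polyMap p))) (s : ℕ) :
    ∀ᶠ n in atTop, u n ∈ closeTo X p s := by
  refine (finite_setOf_forall_le (d := d) s).eventually_all.2 fun a _ => ?_
  have h1 := tendsto_polyMap_iff.1 (tendsto_polyMap_mixedPDeriv h a) X hX
  filter_upwards [Metric.tendstoUniformlyOn_iff.1 h1 (1 / (s + 1)) (by positivity)] with n hn z hz
  rw [← dist_eq_norm, dist_comm]
  exact hn z hz

theorem mem_closeTo_trans {p q r : MvPolynomial (Fin d) ℂ} {s : ℕ}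
    (h₁ : p ∈ closeTo X q (2 * s + 1)) (h₂ : q ∈ closeTo X r (2 * s + 1)) : p ∈ closeTo X r s := by
  intro a ha z hz
  have hs : ∀ i, a i ≤ 2 * s + 1 := fun i => (ha i).trans (by omega)
  have h4 := add_lt_add (h₁ a hs z hz) (h₂ a hs z hz)
  have h5 : (1 : ℝ) / ((2 * s + 1 : ℕ) + 1) + 1 / ((2 * s + 1 : ℕ) + 1) = 1 / (s + 1) := by
    push_cast
    field_simp
    ring
  rw [h5] at h4
  refine lt_of_le_of_lt ?_ h4
  refine le_trans (le_of_eq ?_) (norm_add_le _ _)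
  congr 1
  ring

/-- It is enough to approximate the targets in a dense set of polynomials. -/
theorem mem_approxSet_of_dense [Finite J] (hU : Antitone U) (hX : IsCompact X)
    {Q : Set (MvPolynomial (Fin d) ℂ)}
    (hQ : ∀ p, ∃ u : ℕ → MvPolynomial (Fin d) ℂ,
      (∀ n, u n ∈ Q) ∧ Tendsto (fun n => polyMap (u n)) atTop (𝓝 (polyMap p)))
    {F : J → AInfty Ω S}
    (hF : ∀ p : J → MvPolynomial (Fin d) ℂ, (∀ j, p j ∈ Q) → ∀ s n₀,
      F ∈ approxSet N ζ μ U X p s n₀) (p : J → MvPolynomial (Fin d) ℂ) (s n₀ : ℕ) :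
    F ∈ approxSet N ζ μ U X p s n₀ := by
  have h : ∀ j, ∃ q ∈ Q, q ∈ closeTo X (p j) (2 * s + 1) := fun j => by
    obtain ⟨u, hu, hup⟩ := hQ (p j)
    obtain ⟨n, hn⟩ := (eventually_mem_closeTo hX hup (2 * s + 1)).exists
    exact ⟨u n, hu n, hn⟩
  choose q hqQ hq using h
  obtain ⟨n, hn, hn₀, hclose⟩ := hF q hqQ (2 * s + 1) n₀
  exact ⟨n, hn, hn₀, fun j => ⟨mem_closeTo_trans (hclose j).1 (hq j),
    hU (by omega : s ≤ 2 * s + 1) (hclose j).2⟩⟩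

/-- A non-trivial linear combination of functions that can be approximated simultaneously has the
approximation property itself: the targets are `p / c_k` for the index `k` and `0` for the
others. -/
theorem sum_smul_mem_approxSet [Fintype J] (hS : ∀ i, S i ⊆ frontier (Ω i : Set ℂ))
    (hU : (𝓝 (0 : AInfty Ω S)).HasAntitoneBasis U) {F : J → AInfty Ω S}
    (hF : ∀ (p : J → MvPolynomial (Fin d) ℂ) (s n₀ : ℕ), F ∈ approxSet N ζ μ U X p s n₀)
    {c : J → ℂ} {k : J} (hk : c k ≠ 0) (p : MvPolynomial (Fin d) ℂ) (s n₀ : ℕ) :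
    (fun _ : Unit => ∑ j, c j • F j) ∈ approxSet N ζ μ U X (fun _ => p) s n₀ := by
  classical
  have := AInfty.continuousAdd hS
  have := AInfty.continuousConstSMul hS
  set q : J → MvPolynomial (Fin d) ℂ := Pi.single k ((c k)⁻¹ • p) with hq
  have hqp : ∑ j, c j • q j = p := by
    rw [Finset.sum_eq_single k]
    · simp [hq, smul_smul, hk]
    · intro j _ hj
      simp [hq, hj]
    · simp
  choose n hn hn₀ hclose using fun t => hF q t n₀
  have hlin : ∀ t, taylorSum N (∑ j, c j • F j).toFun ζ (n t) =
      ∑ j, c j • taylorSum N (F j).toFun ζ (n t) := fun t =>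
    (isLinearMap_taylorSum N ζ (n t)).map_sum_smul c F
  have htend : Tendsto (fun t => ∑ j, c j •
      (AInfty.ofPoly Ω S (taylorSum N (F j).toFun ζ (n t)) - F j)) atTop (𝓝 0) := by
    have h1 : ∀ j, Tendsto (fun t => c j •
        (AInfty.ofPoly Ω S (taylorSum N (F j).toFun ζ (n t)) - F j)) atTop (𝓝 (c j • 0)) :=
      fun j => (hU.tendsto fun t => (hclose t j).2).const_smul (c j)
    simpa using tendsto_finsetSum Finset.univ fun j _ => h1 j
  obtain ⟨b, hb⟩ := exists_nat_ge ((∑ j, ‖c j‖) * (s + 1))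
  obtain ⟨t, hts, htb, htU⟩ := ((eventually_ge_atTop s).and ((eventually_ge_atTop b).and
    (htend.eventually_mem (hU.mem s)))).exists
  refine ⟨n t, hn t, hn₀ t, fun _ => ⟨?_, ?_⟩⟩
  · rw [hlin, ← hqp]
    refine sum_smul_mem_closeTo c hts (hb.trans_lt ?_) fun j => (hclose t j).1
    have : (b : ℝ) ≤ t := by exact_mod_cast htb
    linarith
  · rw [hlin, isLinearMap_ofPoly.map_sum_smul, ← Finset.sum_sub_distrib]
    simpa only [← smul_sub] using htU

/-- The countable cofinal family `𝒦` of compact sets and polynomial targets suffice for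
universality, by Runge's theorem. -/
theorem isUniversal_of_mem_approxSet (hS : ∀ i, S i ⊆ frontier (Ω i : Set ℂ))
    (hU : (𝓝 (0 : AInfty Ω S)).HasAntitoneBasis U) {𝒦 : Set (Fin d → Set ℂ)}
    (h𝒦 : ∀ K, Admissible Ω S K → ∃ K' ∈ 𝒦, univ.pi K ⊆ univ.pi K') {f : AInfty Ω S}
    (hf : ∀ K ∈ 𝒦, ∀ (p : MvPolynomial (Fin d) ℂ) (s n₀ : ℕ),
      (fun _ : Unit => f) ∈ approxSet N ζ μ U (univ.pi K) (fun _ => p) s n₀) :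
    IsUniversal N ζ μ f := by
  intro K hK hKc hKd h hh
  have := AInfty.isTopologicalAddGroup hS
  obtain ⟨K', hK', hKK'⟩ := h𝒦 K ⟨hK, hKc, hKd⟩
  choose p hp using fun s : ℕ => runge_pi_mixedPartial hK (fun i => (hKc i).isPreconnected) hh s
    (show (0 : ℝ) < 1 / (s + 1) by positivity)
  have hfreq : ∀ s : ℕ, ∃ᶠ n in atTop, n ∈ μ ∧
      taylorSum N f.toFun ζ n ∈ closeTo (univ.pi K) (p s) s ∧
      AInfty.ofPoly Ω S (taylorSum N f.toFun ζ n) - f ∈ U s := by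
    intro s
    refine frequently_atTop.2 fun n₀ => ?_
    obtain ⟨n, hn, hn₀, hclose⟩ := hf K' hK' (p s) s n₀
    exact ⟨n, hn₀, hn, closeTo_mono hKK' _ _ (hclose ()).1, (hclose ()).2⟩
  obtain ⟨l, hl, hlp⟩ := extraction_forall_of_frequently hfreq
  refine ⟨l, hl, fun n => (hlp n).1, fun a => Metric.tendstoUniformlyOn_iff.2 fun ε hε => ?_, ?_⟩
  · obtain ⟨m, hm⟩ := exists_nat_one_div_lt (half_pos hε)
    filter_upwards [eventually_ge_atTop m, eventually_ge_atTop (∑ i, a i)] with n hnm hna z hz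
    have ha : ∀ i, a i ≤ n := fun i =>
      (Finset.single_le_sum (fun j _ => Nat.zero_le (a j)) (Finset.mem_univ i)).trans hna
    have h1 := (hlp n).2.1 a ha z hz
    have h2 := hp n a ha z hz
    have h3 : (1 : ℝ) / (n + 1) ≤ 1 / (m + 1) :=
      one_div_le_one_div_of_le (by positivity) (by gcongr)
    rw [mixedPartial_eval, dist_comm, dist_eq_norm]
    have h4 := norm_sub_le_norm_sub_add_norm_sub
      (MvPolynomial.eval z (mixedPDeriv a (taylorSum N f.toFun ζ (l n))))
      (MvPolynomial.eval z (mixedPDeriv a (p n))) (mixedPartial a h z)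
    linarith
  · have h1 : Tendsto (fun n => AInfty.ofPoly Ω S (taylorSum N f.toFun ζ (l n)) - f) atTop (𝓝 0) :=
      hU.tendsto fun n => (hlp n).2.2
    simpa using h1.add_const f

theorem IsUniversal.mem_approxSet (hS : ∀ i, S i ⊆ frontier (Ω i : Set ℂ))
    (hU : ∀ s, U s ∈ 𝓝 (0 : AInfty Ω S)) {K : Fin d → Set ℂ} (hK : Admissible Ω S K)
    {f : AInfty Ω S} (hf : IsUniversal N ζ μ f) (p : MvPolynomial (Fin d) ℂ) (s n₀ : ℕ) :
    (fun _ : Unit => f) ∈ approxSet N ζ μ U (univ.pi K) (fun _ => p) s n₀ := by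
  have := AInfty.isTopologicalAddGroup hS
  obtain ⟨l, hl, hlμ, hO, hA⟩ := hf K hK.1 hK.2.1 hK.2.2 (fun z => MvPolynomial.eval z p)
    ⟨univ, isOpen_univ, subset_univ _, AnalyticOnNhd.eval_mvPolynomial p⟩
  have h1 : ∀ᶠ n in atTop, taylorSum N f.toFun ζ (l n) ∈ closeTo (univ.pi K) p s := by
    refine (finite_setOf_forall_le (d := d) s).eventually_all.2 fun a _ => ?_
    filter_upwards [Metric.tendstoUniformlyOn_iff.1 (hO a) (1 / (s + 1)) (by positivity)]
      with n hn z hz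
    have := hn z hz
    rwa [mixedPartial_eval, mixedPartial_eval, dist_comm, dist_eq_norm] at this
  have h2 : Tendsto (fun n => AInfty.ofPoly Ω S (taylorSum N f.toFun ζ (l n)) - f) atTop (𝓝 0) := by
    simpa using hA.sub_const f
  obtain ⟨n, hn1, hn2, hn3⟩ := (h1.and ((h2.eventually_mem (hU s)).and
    (hl.tendsto_atTop.eventually_ge_atTop n₀))).exists
  exact ⟨l n, hlμ n, hn3, fun _ => ⟨hn1, hn2⟩⟩

/-- Every polynomial is, in `A^∞(Ω, S)`, a limit of polynomials that are close to `p` on a given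
admissible product of compact sets. -/
theorem exists_tendsto_ofPoly_mem_closeTo
    (hS : ∀ i, ∃ O : Set ℂ, IsOpen O ∧ S i = frontier (Ω i : Set ℂ) ∩ O)
    (hconn : ∀ i, IsPreconnected ((Ω i : Set ℂ) ∪ S i)ᶜ)
    (hunb : ∀ i, ((Ω i : Set ℂ) ∪ S i)ᶜ.Nonempty →
      ¬ Bornology.IsBounded ((Ω i : Set ℂ) ∪ S i)ᶜ)
    {K : Fin d → Set ℂ} (hK : Admissible Ω S K) (g p : MvPolynomial (Fin d) ℂ) (s : ℕ) :
    ∃ q : ℕ → MvPolynomial (Fin d) ℂ,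
      Tendsto (fun k => AInfty.ofPoly Ω S (q k)) atTop (𝓝 (AInfty.ofPoly Ω S g)) ∧
      ∀ k, q k ∈ closeTo (univ.pi K) p s := by
  obtain ⟨t, htc, hts, htm, hex⟩ := exists_compact_exhaustion (isLocallyClosed_partialClosure hS)
  choose q hqg hqp using fun k =>
    exists_polynomial_mem_closeTo hconn hunb hK (htc k) (hts k) g p (max k s)
  refine ⟨q, (AInfty.tendsto_ofPoly_iff (subset_frontier hS)).2 fun a L hL hLs => ?_, fun k =>
    closeTo_anti _ _ (le_max_right _ _) (hqp k)⟩
  obtain ⟨n, hn⟩ := hex L hL hLs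
  refine Metric.tendstoUniformlyOn_iff.2 fun ε hε => ?_
  obtain ⟨m, hm⟩ := exists_nat_one_div_lt hε
  filter_upwards [eventually_ge_atTop n, eventually_ge_atTop m, eventually_ge_atTop (∑ i, a i)]
    with k hkn hkm hka z hz
  have ha : ∀ i, a i ≤ k := fun i =>
    (Finset.single_le_sum (fun j _ => Nat.zero_le (a j)) (Finset.mem_univ i)).trans hka
  have h1 := closeTo_anti _ _ (le_max_left k s) (hqg k) a ha z (htm hkn (hn hz))
  rw [dist_comm, dist_eq_norm]
  refine h1.trans_le (le_trans ?_ hm.le)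
  exact one_div_le_one_div_of_le (by positivity) (by gcongr)

/-! ### Generic sequences -/

theorem denseRange_ofPoly : DenseRange fun p : MvPolynomial (Fin d) ℂ =>
    (⟨AInfty.ofPoly Ω S p, subset_closure (mem_range_self p)⟩ : XInfty Ω S) := by
  intro f
  rw [closure_subtype, ← range_comp]
  exact f.2

/-- The density needed for the Baire category theorem. Sequences of polynomials are dense in
`ℕ → X^∞(Ω, S)`, and each of their members can be moved slightly so as to become close to its
target; the Taylor sums of a polynomial are eventually that polynomial. -/
theorem dense_setOf_mem_approxSet
    (hS : ∀ i, ∃ O : Set ℂ, IsOpen O ∧ S i = frontier (Ω i : Set ℂ) ∩ O)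
    (hconn : ∀ i, IsPreconnected ((Ω i : Set ℂ) ∪ S i)ᶜ)
    (hunb : ∀ i, ((Ω i : Set ℂ) ∪ S i)ᶜ.Nonempty →
      ¬ Bornology.IsBounded ((Ω i : Set ℂ) ∪ S i)ᶜ)
    (hμ : μ.Infinite) (hU : ∀ s, U s ∈ 𝓝 (0 : AInfty Ω S)) {K : Fin d → Set ℂ}
    (hK : Admissible Ω S K) {L : ℕ} (p : Fin L → MvPolynomial (Fin d) ℂ) (s n₀ : ℕ) :
    Dense {F : ℕ → XInfty Ω S |
      (fun j : Fin L => (F j : AInfty Ω S)) ∈ approxSet N ζ μ U (univ.pi K) p s n₀} := by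
  have hd : Dense (univ.pi fun _ : ℕ => range fun p : MvPolynomial (Fin d) ℂ =>
      (⟨AInfty.ofPoly Ω S p, subset_closure (mem_range_self p)⟩ : XInfty Ω S)) :=
    dense_pi univ fun _ _ => denseRange_ofPoly
  refine dense_closure.1 (hd.mono fun F hF => ?_)
  choose g hg using fun l => hF l (mem_univ l)
  -- The members of index at least `L` have no target; they get the target `0`.
  set P : ℕ → MvPolynomial (Fin d) ℂ := fun l => if h : l < L then p ⟨l, h⟩ else 0 with hP
  choose q hqt hqp using fun l =>
    exists_tendsto_ofPoly_mem_closeTo hS hconn hunb hK (g l) (P l) s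
  set G : ℕ → ℕ → XInfty Ω S := fun k l =>
    ⟨AInfty.ofPoly Ω S (q l k), subset_closure (mem_range_self _)⟩ with hG
  have hGF : Tendsto G atTop (𝓝 F) := by
    refine tendsto_pi_nhds.2 fun l => ?_
    rw [← hg l, tendsto_subtype_rng]
    exact hqt l
  refine mem_closure_of_tendsto hGF (Eventually.of_forall fun k => ?_)
  have h1 : ∀ᶠ n in atTop, ∀ j : Fin L,
      taylorSum N (AInfty.ofPoly Ω S (q j k)).toFun ζ n = q j k :=
    eventually_all.2 fun j => eventually_taylorSum_ofPoly N ζ _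
  obtain ⟨n₁, hn₁⟩ := eventually_atTop.1 h1
  obtain ⟨n, hn, hlt⟩ := hμ.exists_gt (max n₀ n₁)
  refine ⟨n, hn, (le_max_left _ _).trans hlt.le, fun j => ?_⟩
  have h2 := hn₁ n ((le_max_right _ _).trans hlt.le) j
  refine ⟨?_, ?_⟩
  · change taylorSum N (AInfty.ofPoly Ω S (q j k)).toFun ζ n ∈ _
    rw [h2]
    simpa [hP] using hqp j k
  · change AInfty.ofPoly Ω S (taylorSum N (AInfty.ofPoly Ω S (q j k)).toFun ζ n) -
      AInfty.ofPoly Ω S (q j k) ∈ U s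
    rw [h2, sub_self]
    exact mem_of_mem_nhds (hU s)

theorem dense_setOf_exists_mem {Y : Type*} [TopologicalSpace Y] {B : Set Y} (hB : B.Nonempty) :
    Dense {F : ℕ → Y | ∃ l, F l ∈ B} := by
  obtain ⟨b, hb⟩ := hB
  intro F
  have h : Tendsto (fun l => Function.update F l b) atTop (𝓝 F) := by
    refine tendsto_pi_nhds.2 fun i => tendsto_const_nhds.congr' ?_
    filter_upwards [eventually_gt_atTop i] with l hl
    rw [Function.update_of_ne hl.ne]
  exact mem_closure_of_tendsto h (Eventually.of_forall fun l => ⟨l, by simpa using hb⟩)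

theorem secondCountableTopology_XInfty
    (hS : ∀ i, ∃ O : Set ℂ, IsOpen O ∧ S i = frontier (Ω i : Set ℂ) ∩ O) :
    SecondCountableTopology (XInfty Ω S) := by
  have := AInfty.isCompletelyPseudoMetrizableSpace hS
  obtain ⟨Q, hQ, hd⟩ := exists_countable_dense_polynomials d
  set e : MvPolynomial (Fin d) ℂ → XInfty Ω S := fun p =>
    ⟨AInfty.ofPoly Ω S p, subset_closure (mem_range_self p)⟩ with he
  have hsep : SeparableSpace (XInfty Ω S) := by
    refine ⟨e '' Q, hQ.image e, dense_closure.1 (Dense.mono ?_ denseRange_ofPoly)⟩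
    rintro _ ⟨p, rfl⟩
    obtain ⟨u, hu, hup⟩ := hd p
    refine mem_closure_of_tendsto (b := atTop) (f := fun n => e (u n)) ?_
      (Eventually.of_forall fun n => mem_image_of_mem e (hu n))
    rw [tendsto_subtype_rng]
    exact AInfty.tendsto_ofPoly (subset_frontier hS) hup
  let _ := pseudoMetrizableSpacePseudoMetric (XInfty Ω S)
  exact UniformSpace.secondCountable_of_separable (XInfty Ω S)

/-- `X^∞(Ω, S)` is the closure of a subspace, hence a subspace. -/
theorem span_subset_XInfty (hS : ∀ i, S i ⊆ frontier (Ω i : Set ℂ)) {A : Set (AInfty Ω S)}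
    (hA : A ⊆ XInfty Ω S) : (Submodule.span ℂ A : Set (AInfty Ω S)) ⊆ XInfty Ω S := by
  have := AInfty.continuousAdd hS
  have := AInfty.continuousConstSMul hS
  have h : ((LinearMap.range (isLinearMap_ofPoly.mk' (AInfty.ofPoly Ω S))).topologicalClosure :
      Set (AInfty Ω S)) = XInfty Ω S := by
    rw [Submodule.topologicalClosure_coe, LinearMap.coe_range]
    rfl
  rw [← h] at hA ⊢
  exact Submodule.span_le.2 hA

end

end PartialTaylor

end

/-! ### Generic sequences of functions span universal subspaces -/

open PartialTaylor
theorem theorem3p8 {d : ℕ} (Ω : Fin d → Opens ℂ) (S : Fin d → Set ℂ)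
    (hΩ : ∀ i, IsSimplyConnected (Ω i : Set ℂ))
    (hS : ∀ i, ∃ O : Set ℂ, IsOpen O ∧ S i = frontier (Ω i : Set ℂ) ∩ O)
    (hconn : ∀ i, IsPreconnected ((Ω i : Set ℂ) ∪ S i)ᶜ)
    (hunb : ∀ i, ((Ω i : Set ℂ) ∪ S i)ᶜ.Nonempty →
      ¬ Bornology.IsBounded ((Ω i : Set ℂ) ∪ S i)ᶜ)
    (ζ : prodDomain Ω) (N : ℕ ≃ (Fin d → ℕ)) (μ : Set ℕ) (hμ : μ.Infinite) :
    (∃ f : AInfty Ω S, IsUniversal N ζ μ f) ∧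
      IsGδ {f : XInfty Ω S | IsUniversal N ζ μ (f : AInfty Ω S)} ∧
      Dense {f : XInfty Ω S | IsUniversal N ζ μ (f : AInfty Ω S)} ∧
      ∃ V : Submodule ℂ (AInfty Ω S),
        (V : Set (AInfty Ω S)) ⊆ XInfty Ω S ∧
        XInfty Ω S ⊆ closure (V : Set (AInfty Ω S)) ∧
        ∀ f ∈ V, f ≠ 0 → IsUniversal N ζ μ f := by
  have hSf := subset_frontier hS
  have hΩc : ∀ i, IsConnected (Ω i : Set ℂ) := fun i => (hΩ i).isPathConnected.isConnected
  obtain ⟨𝒦, h𝒦c, h𝒦adm, h𝒦⟩ := exists_countable_cofinal_admissible hΩc hSf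
  obtain ⟨Q, hQc, hQ⟩ := exists_countable_dense_polynomials d
  have := AInfty.isCompletelyPseudoMetrizableSpace hS
  have : IsCompletelyPseudoMetrizableSpace (XInfty Ω S) :=
    isClosed_closure.isCompletelyPseudoMetrizableSpace
  have := secondCountableTopology_XInfty hS
  obtain ⟨U, hUo, hU⟩ := (nhds_basis_opens (0 : AInfty Ω S)).exists_antitone_subbasis
  have hcpt : ∀ K ∈ 𝒦, IsCompact (univ.pi K) := fun K hK => isCompact_univ_pi (h𝒦adm K hK).1
  have := h𝒦c.to_subtype
  have := hQc.to_subtype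
  have := (countable_countableBasis (XInfty Ω S)).to_subtype
  -- The conditions on a sequence in `X^∞(Ω, S)` that make all non-trivial linear combinations of
  -- its members universal.
  set A : (𝒦 × (Σ L : ℕ, Fin L → Q) × ℕ × ℕ) → Set (ℕ → XInfty Ω S) := fun x =>
    {F | (fun j : Fin x.2.1.1 => (F j : AInfty Ω S)) ∈
      approxSet N ζ μ U (univ.pi x.1.1) (fun j => (x.2.1.2 j).1) x.2.2.1 x.2.2.2} with hA
  -- The conditions that make the sequence dense in `X^∞(Ω, S)`.
  set D : countableBasis (XInfty Ω S) → Set (ℕ → XInfty Ω S) := fun B => {F | ∃ l, F l ∈ B.1} with hD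
  have hAo : ∀ x, IsOpen (A x) := fun x =>
    (isOpen_approxSet hSf (fun s => (hUo s).2) (hcpt _ x.1.2) _ _ _).preimage
      (continuous_pi fun j => continuous_subtype_val.comp (continuous_apply _))
  have hAd : ∀ x, Dense (A x) := fun x =>
    dense_setOf_mem_approxSet hS hconn hunb hμ hU.mem (h𝒦adm _ x.1.2) _ _ _
  have hDo : ∀ B, IsOpen (D B) := fun B => by
    have : D B = ⋃ l, (fun F : ℕ → XInfty Ω S => F l) ⁻¹' B.1 := by
      ext F
      simp [hD]
    rw [this]
    exact isOpen_iUnion fun l =>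
      (isOpen_of_mem_countableBasis B.2).preimage (continuous_apply l)
  have hDd : ∀ B, Dense (D B) := fun B =>
    dense_setOf_exists_mem (nonempty_of_mem_countableBasis B.2)
  have hgen : Dense (⋂ x, (Sum.elim A D) x) := by
    refine dense_iInter_of_isOpen ?_ ?_
    · rintro (x | B)
      exacts [hAo x, hDo B]
    · rintro (x | B)
      exacts [hAd x, hDd B]
  have huniv : ∀ F ∈ ⋂ x, (Sum.elim A D) x, ∀ (L : ℕ) (c : Fin L → ℂ) (k : Fin L), c k ≠ 0 →
      IsUniversal N ζ μ (∑ j, c j • (F j : AInfty Ω S)) := by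
    intro F hF L c k hk
    refine isUniversal_of_mem_approxSet hSf hU h𝒦 fun K hK p s n₀ => ?_
    refine sum_smul_mem_approxSet hSf hU (F := fun j : Fin L => (F j : AInfty Ω S)) ?_ hk p s n₀
    refine mem_approxSet_of_dense hU.antitone (hcpt K hK) hQ fun q hq s n₀ => ?_
    exact mem_iInter.1 hF (Sum.inl (⟨K, hK⟩, ⟨L, fun j => ⟨q j, hq j⟩⟩, s, n₀))
  have hne : Nonempty (XInfty Ω S) := ⟨⟨_, subset_closure (mem_range_self 0)⟩⟩
  -- The members of generic sequences are dense, as evaluation at `0` maps dense sets to dense sets.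
  have hdense : Dense {f : XInfty Ω S | IsUniversal N ζ μ (f : AInfty Ω S)} := by
    have h1 : Dense ((fun F : ℕ → XInfty Ω S => F 0) '' ⋂ x, (Sum.elim A D) x) :=
      (Function.surjective_eval 0).denseRange.dense_image (continuous_apply 0) hgen
    refine h1.mono ?_
    rintro _ ⟨F, hF, rfl⟩
    simpa using huniv F hF 1 (fun _ => 1) 0 one_ne_zero
  refine ⟨?_, ?_, hdense, ?_⟩
  · obtain ⟨f, hf⟩ := hdense.nonempty
    exact ⟨f, hf⟩
  · have h1 : {f : XInfty Ω S | IsUniversal N ζ μ (f : AInfty Ω S)} =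
        ⋂ x : 𝒦 × Q × ℕ × ℕ, {f : XInfty Ω S | (fun _ : Unit => (f : AInfty Ω S)) ∈
          approxSet N ζ μ U (univ.pi x.1.1) (fun _ => x.2.1.1) x.2.2.1 x.2.2.2} := by
      ext f
      rw [mem_iInter]
      constructor
      · exact fun hf x => hf.mem_approxSet hSf hU.mem (h𝒦adm _ x.1.2) _ _ _
      · intro hf
        refine isUniversal_of_mem_approxSet hSf hU h𝒦 fun K hK p s n₀ => ?_
        refine mem_approxSet_of_dense hU.antitone (hcpt K hK) hQ (fun q hq s n₀ => ?_) (fun _ => p) s n₀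
        exact hf (⟨K, hK⟩, ⟨q (), hq ()⟩, s, n₀)
    rw [h1]
    refine IsGδ.iInter fun x => IsOpen.isGδ ?_
    exact (isOpen_approxSet hSf (fun s => (hUo s).2) (hcpt _ x.1.2) _ _ _).preimage
      (continuous_pi fun _ => continuous_subtype_val)
  · obtain ⟨F, hF⟩ := hgen.nonempty
    refine ⟨Submodule.span ℂ (range fun l => (F l : AInfty Ω S)), ?_, ?_, ?_⟩
    · refine span_subset_XInfty hSf ?_
      rintro _ ⟨l, rfl⟩
      exact (F l).2
    · have h1 : DenseRange F := by
        refine (isBasis_countableBasis (XInfty Ω S)).dense_iff.2 fun B hB _ => ?_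
        obtain ⟨l, hl⟩ := mem_iInter.1 hF (Sum.inr ⟨B, hB⟩)
        exact ⟨F l, hl, mem_range_self l⟩
      intro f hf
      have h2 := h1 ⟨f, hf⟩
      rw [closure_subtype, ← range_comp] at h2
      exact closure_mono Submodule.subset_span h2
    · intro f hf hf0
      obtain ⟨c, rfl⟩ := Finsupp.mem_span_range_iff_exists_finsupp.1 hf
      have hc : c ≠ 0 := fun h => hf0 (by simp [h])
      obtain ⟨k, hk⟩ := Finsupp.ne_iff.1 hc
      obtain ⟨L, hL⟩ := c.support.bddAbove
      have hlt : ∀ l ∈ c.support, l < L + 1 := fun l hl => Nat.lt_succ_of_le (hL hl)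
      have h1 : (c.sum fun l a => a • (F l : AInfty Ω S)) =
          ∑ j : Fin (L + 1), c j • (F j : AInfty Ω S) := by
        rw [Fin.sum_univ_eq_sum_range (fun l => c l • (F l : AInfty Ω S)) (L + 1)]
        exact Finsupp.sum_of_support_subset c (fun l hl => Finset.mem_range.2 (hlt l hl)) _
          fun l _ => zero_smul ℂ _
      rw [h1]
      exact huniv F hF (L + 1) (fun j => c j)
        ⟨k, hlt k (Finsupp.mem_support_iff.2 hk)⟩ hk
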